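/- Work in a coordinate chart $x=(t,x^1,x^2,x^3)$, with signature $(-,+,+,+)$ and units $8\pi G=1$. Let $U\subset\mathbb R^4$ be open and contain the exterior end $\{t=t_0,\ |x|>R_0\}$ of a time slice ($R_0>0$). On $U$ let $g$ be a smooth Lorentzian metric with vanishing Ricci tensor (vacuum), and let $\Gamma$ be a smooth connection with zero torsion and zero curvature. Write $\mathcal D$ for the Levi-Civita derivative of $g$, $\nabla$ for the derivative of $\Gamma$, $\boldsymbol\epsilon$ for the volume form of $g$, $Q_{abc}=\nabla_a g_{bc}$, $Q_a=Q_{ab}{}^b$, $\tilde Q_a=Q_b{}^b{}_a$, $$\mathbb Q=\tfrac14Q_{abc}Q^{abc}-\tfrac12Q_{abc}Q^{bac}-\tfrac14Q_aQ^a+\tfrac12Q_a\tilde Q^a,$$ $$P^{abc}=-\tfrac14Q^{abc}+\tfrac14Q^{bac}+\tfrac14Q^{cab}+\tfrac14g^{bc}(Q^a-\tilde Q^a)-\tfrac18g^{ab}Q^c-\tfrac18g^{ac}Q^b .$$ The STEGR Lagrangian form is $\mathbf L=-\tfrac12\mathbb Q\,\boldsymbol\epsilon$. Its boundary term is $\boldsymbol\Theta_{efg}=\boldsymbol\epsilon_{aefg}\Theta^a$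 with $\Theta^a=\tfrac12(-g^{ac}\delta\Gamma^b_{bc}+g^{bc}\delta\Gamma^a_{bc})+P^{abc}\delta g_{bc}$. The Noether current of a vector field $V$ is $\mathbf J[V]=\boldsymbol\Theta(g,\Gamma;\mathcal L_Vg,\mathcal L_V\Gamma)-i_V\mathbf L$. A Noether charge is a map that sends each smooth vector field $V$ to a smooth 2-form $\mathbf Q_N[V]$ on $U$, linearly and locally in $V$, with $d\mathbf Q_N[V]=\mathbf J[V]$. With $t^a=(\partial_t)^a$, the canonical energy (the energy in the first law) is $$E=\int_\infty(\mathbf Q_N[t]-i_t\mathbf B),\qquad \delta\int_\infty i_t\mathbf B=\int_\infty i_t\boldsymbol\Theta ,$$ where $\int_\infty$ is the limit as $r\to\infty$ of the integrals over the coordinate spheres $\{t=t_0,\ |x|=r\}$. Asymptotically flat means that, on the slice $t=t_0$, $g_{\mu\nu}=\eta_{\mu\nu}+O(1/r)$ and $\partial_\alpha g_{\mu\nu}=O(1/r^2)$. Then: 1. The 2-form $$\mathbf q[V]_{fg}=\tfrac12\boldsymbol\epsilon_{abfg}\Big(-\mathcal D^aV^b+\delta^{[b}_d\big(Q^{a]}-\tilde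 Q^{a]}\big)V^d\Big)$$ is a Noether charge, and every Noether charge $\mathbf Q_N$ satisfies $\int_{S_r}\mathbf Q_N[t]=\int_{S_r}\mathbf q[t]$ for every $r>R_0$. 2. Let $g$ be asymptotically flat and $\Gamma=O(1/r^2)$ on the slice. Then $\mathbf B=0$ is admissible for variations that vanish at infinity ($\delta g=o(1)$, $\delta\Gamma=o(1/r^2)$ on the slice). With $\mathbf B=0$ and any Noether charge, the energy is $$E=\int_\infty\tfrac12\boldsymbol\epsilon_{abfg}\Big(-\mathcal D^at^b+\delta^{[b}_d\big(Q^{a]}-\tilde Q^{a]}\big)t^d\Big),$$ i.e. half of the Komar term plus a non-metricity term (one side exists if and only if the other does). 3. Let $g$ be asymptotically flat and take the coincident gauge $\Gamma=0$. Then the energy with $\mathbf B=0$ exists, the ADM mass exists, and $$E=\tfrac12\int_\infty dS\,h^{ij}(\partial_ih_{rj}-\partial_rh_{ij})=\tfrac12\int_\infty dS\,n^i(\partial_jh_{ij}-\partial_ih_{jj})=M_{ADM}.$$ Here $h_{ij}=g_{ij}$ is the spatial metric with inverse $h^{ij}$, $n^i=x^i/r$, $dS$ is the Euclidean area element, and an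 index $r$ means contraction with $n$ after differentiation. -/

import Mathlib

open Filter Asymptotics Topology Set
open scoped ContDiff

namespace STEGR

noncomputable section

/-!
Everything takes place in a coordinate chart with coordinates `x 0 = t` and `x 1, x 2, x 3`
(inertial coordinates of the asymptotic flat metric), signature `(-,+,+,+)`, units `8πG = 1`.
-/

/-! ### Fields and tensor calculus in coordinates -/

/-- Points of the chart, and also the component vectors of tangent vectors. -/
abbrev Spacetime := Fin 4 → ℝ

/-- Components `g_{ab}` of a metric (also used for metric variations). -/
abbrev MetricField := Spacetime → Matrix (Fin 4) (Fin 4) ℝ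

/-- Connection symbols: `Γ x a b c` is `Γ^a_{bc}` at `x` (also used for variations of them). -/
abbrev ConnField := Spacetime → Fin 4 → Fin 4 → Fin 4 → ℝ

abbrev VField := Spacetime → Spacetime

/-- Differential `n`-forms on the chart. -/
abbrev Form (n : ℕ) := Spacetime → Spacetime [⋀^Fin n]→L[ℝ] ℝ

/-- The coordinate basis vector `∂_a`. -/
def basisVec (a : Fin 4) : Spacetime := Pi.single a 1

/-- The partial derivative `∂_a f`. -/
def pd (a : Fin 4) (f : Spacetime → ℝ) (x : Spacetime) : ℝ := fderiv ℝ f x (basisVec a)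

/-- The Minkowski metric. -/
def minkowski : Matrix (Fin 4) (Fin 4) ℝ := Matrix.diagonal ![-1, 1, 1, 1]

/-- `g` is a smooth metric of Lorentzian signature `(-,+,+,+)` on `U`. -/
structure IsLorentzMetricOn (U : Set Spacetime) (g : MetricField) : Prop where
  smooth : ∀ a b, ContDiffOn ℝ ∞ (fun x => g x a b) U
  lorentzian : ∀ x ∈ U, ∃ P : Matrix (Fin 4) (Fin 4) ℝ, P.det ≠ 0 ∧ g x = P.transpose * minkowski * P

/-- The inverse metric `g^{ab}`. -/
def inv (g : MetricField) (x : Spacetime) (a b : Fin 4) : ℝ := (g x)⁻¹ a b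

/-- Christoffel symbols of the Levi-Civita connection. -/
def christoffel (g : MetricField) : ConnField := fun x a b c =>
  ∑ d, (1 / 2) * inv g x a d *
    (pd b (fun y => g y d c) x + pd c (fun y => g y d b) x - pd d (fun y => g y b c) x)

/-- Curvature `R^a_{bcd} = ∂_c Γ^a_{db} - ∂_d Γ^a_{cb} + Γ^a_{ce} Γ^e_{db} - Γ^a_{de} Γ^e_{cb}`. -/
def riemann (Γ : ConnField) (x : Spacetime) (a b c d : Fin 4) : ℝ :=
  pd c (fun y => Γ y a d b) x - pd d (fun y => Γ y a c b) x
    + ∑ e, (Γ x a c e * Γ x e d b - Γ x a d e * Γ x e c b)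

/-- The Ricci tensor of the Levi-Civita connection of `g`. -/
def ricci (g : MetricField) (x : Spacetime) (b d : Fin 4) : ℝ :=
  ∑ a, riemann (christoffel g) x a b a d

/-- `g` solves the vacuum Einstein equations on `U`. -/
def IsVacuumOn (U : Set Spacetime) (g : MetricField) : Prop :=
  ∀ x ∈ U, ∀ a b, ricci g x a b = 0

/-- `Γ` is a smooth symmetric teleparallel connection on `U`: no torsion and no curvature. -/
structure IsSymmetricTeleparallelOn (U : Set Spacetime) (Γ : ConnField) : Prop where
  smooth : ∀ a b c, ContDiffOn ℝ ∞ (fun x => Γ x a b c) U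
  torsion_free : ∀ x ∈ U, ∀ a b c, Γ x a b c = Γ x a c b
  flat : ∀ x ∈ U, ∀ a b c d, riemann Γ x a b c d = 0

/-- The coincident gauge `Γ = 0`. -/
def IsCoincidentGaugeOn (U : Set Spacetime) (Γ : ConnField) : Prop :=
  ∀ x ∈ U, ∀ a b c, Γ x a b c = 0

/-! ### Non-metricity -/

/-- `Q_{abc} = ∇_a g_{bc}`. -/
def nonmet (g : MetricField) (Γ : ConnField) (x : Spacetime) (a b c : Fin 4) : ℝ :=
  pd a (fun y => g y b c) x - ∑ d, (Γ x d a b * g x d c + Γ x d a c * g x b d)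

/-- `Q^{abc}`. -/
def nonmetUp (g : MetricField) (Γ : ConnField) (x : Spacetime) (a b c : Fin 4) : ℝ :=
  ∑ d, ∑ e, ∑ f, inv g x a d * inv g x b e * inv g x c f * nonmet g Γ x d e f

/-- `Q_a = Q_{ab}{}^b`. -/
def trOne (g : MetricField) (Γ : ConnField) (x : Spacetime) (a : Fin 4) : ℝ :=
  ∑ b, ∑ c, inv g x b c * nonmet g Γ x a b c

/-- `Q̃_a = Q_b{}^b{}_a`. -/
def trTwo (g : MetricField) (Γ : ConnField) (x : Spacetime) (a : Fin 4) : ℝ :=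
  ∑ b, ∑ c, inv g x b c * nonmet g Γ x b c a

/-- `Q^a`. -/
def trOneUp (g : MetricField) (Γ : ConnField) (x : Spacetime) (a : Fin 4) : ℝ :=
  ∑ b, inv g x a b * trOne g Γ x b

/-- `Q̃^a`. -/
def trTwoUp (g : MetricField) (Γ : ConnField) (x : Spacetime) (a : Fin 4) : ℝ :=
  ∑ b, inv g x a b * trTwo g Γ x b

/-- The quadratic form
`ℚ = ¼ Q_{abc} Q^{abc} - ½ Q_{abc} Q^{bac} - ¼ Q_a Q^a + ½ Q_a Q̃^a`. -/
def quadQ (g : MetricField) (Γ : ConnField) (x : Spacetime) : ℝ :=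
  (1 / 4) * ∑ a, ∑ b, ∑ c, nonmet g Γ x a b c * nonmetUp g Γ x a b c
    - (1 / 2) * ∑ a, ∑ b, ∑ c, nonmet g Γ x a b c * nonmetUp g Γ x b a c
    - (1 / 4) * ∑ a, trOne g Γ x a * trOneUp g Γ x a
    + (1 / 2) * ∑ a, trOne g Γ x a * trTwoUp g Γ x a

/-- The non-metricity conjugate `P^{abc}`. -/
def conjP (g : MetricField) (Γ : ConnField) (x : Spacetime) (a b c : Fin 4) : ℝ :=
  -(1 / 4) * nonmetUp g Γ x a b c + (1 / 4) * nonmetUp g Γ x b a c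
    + (1 / 4) * nonmetUp g Γ x c a b
    + (1 / 4) * inv g x b c * (trOneUp g Γ x a - trTwoUp g Γ x a)
    - (1 / 8) * inv g x a b * trOneUp g Γ x c - (1 / 8) * inv g x a c * trOneUp g Γ x b

/-! ### Differential forms built from the metric -/

/-- The determinant as an alternating 4-form: `d t ∧ d x ∧ d y ∧ d z`. -/
def coordVol : Spacetime [⋀^Fin 4]→L[ℝ] ℝ :=
  { (Matrix.detRowAlternating : (Fin 4 → ℝ) [⋀^Fin 4]→ₗ[ℝ] ℝ) with
    cont := by
      change Continuous fun v : Fin 4 → Fin 4 → ℝ => Matrix.det (Matrix.of v)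
      exact Continuous.matrix_det continuous_id }

/-- The Levi-Civita tensor `ε = √(-det g) dt ∧ dx ∧ dy ∧ dz`. -/
def volForm (g : MetricField) : Form 4 := fun x => Real.sqrt (-(g x).det) • coordVol

/-- The 3-form `ε_{abcd} A^a` of a vector field `A`. -/
def dualVec (g : MetricField) (A : VField) : Form 3 := fun x => (volForm g x).curryLeft (A x)

/-- The 2-form `½ ε_{abfg} W^{ab}`. -/
def dualTwo (g : MetricField) (W : Spacetime → Fin 4 → Fin 4 → ℝ) : Form 2 := fun x =>
  (1 / 2 : ℝ) • ∑ a, ∑ b,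
    W x a b • ((volForm g x).curryLeft (basisVec a)).curryLeft (basisVec b)

/-- The interior product `i_V α`. -/
def interiorProd {n : ℕ} (V : VField) (α : Form (n + 1)) : Form n := fun x => (α x).curryLeft (V x)

/-! ### Boundary term, Noether current and Noether charge of STEGR -/

/-- The Lie derivative of `g_{ab}`. -/
def lieMetric (V : VField) (g : MetricField) : MetricField := fun x => Matrix.of fun a b =>
  ∑ d, (V x d * pd d (fun y => g y a b) x + pd a (fun y => V y d) x * g x d b
    + pd b (fun y => V y d) x * g x a d)

/-- The Lie derivative of the connection symbols. -/
def lieConn (V : VField) (Γ : ConnField) : ConnField := fun x a b c =>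
  pd b (pd c fun y => V y a) x
    + ∑ d, (V x d * pd d (fun y => Γ y a b c) x - pd d (fun y => V y a) x * Γ x d b c
      + pd b (fun y => V y d) x * Γ x a d c + pd c (fun y => V y d) x * Γ x a b d)

/-- The STEGR boundary vector
`Θ^a = ½ (-g^{ac} δΓ^b_{bc} + g^{bc} δΓ^a_{bc}) + P^{abc} δg_{bc}`. -/
def theta (g : MetricField) (Γ : ConnField) (δg : MetricField) (δΓ : ConnField) : VField :=
  fun x a => (1 / 2) * ∑ b, ∑ c, (-(inv g x a c * δΓ x b b c) + inv g x b c * δΓ x a b c)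
    + ∑ b, ∑ c, conjP g Γ x a b c * δg x b c

/-- The boundary term `Θ(φ, δφ)` as a 3-form. -/
def thetaForm (g : MetricField) (Γ : ConnField) (δg : MetricField) (δΓ : ConnField) : Form 3 :=
  dualVec g (theta g Γ δg δΓ)

/-- The STEGR Lagrangian 4-form on connections without torsion and curvature,
where the terms with the Lagrange multipliers are zero: `L = -½ ℚ ε`. -/
def lagrangianForm (g : MetricField) (Γ : ConnField) : Form 4 := fun x =>
  (-(1 / 2) * quadQ g Γ x) • volForm g x

/-- The Noether current `J[V] = Θ(φ, ℒ_V φ) - i_V L`. -/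
def noetherCurrent (g : MetricField) (Γ : ConnField) (V : VField) : Form 3 := fun x =>
  thetaForm g Γ (lieMetric V g) (lieConn V Γ) x - interiorProd V (lagrangianForm g Γ) x

/-- `N` is a Noether charge of the fields `(g, Γ)` on `U`: it assigns to every smooth vector field
`V` a smooth 2-form `N V`, linearly and locally in `V`, such that `d (N V) = J[V]`. -/
structure IsNoetherCharge (U : Set Spacetime) (g : MetricField) (Γ : ConnField)
    (N : VField → Form 2) : Prop where
  smooth : ∀ V, ContDiffOn ℝ ∞ V U → ContDiffOn ℝ ∞ (N V) U
  add : ∀ V W, ContDiffOn ℝ ∞ V U → ContDiffOn ℝ ∞ W U →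
    ∀ x ∈ U, N (V + W) x = N V x + N W x
  smul : ∀ (c : ℝ) V, ContDiffOn ℝ ∞ V U → ∀ x ∈ U, N (c • V) x = c • N V x
  isLocal : ∀ V W, ContDiffOn ℝ ∞ V U → ContDiffOn ℝ ∞ W U →
    ∀ O : Set Spacetime, IsOpen O → O ⊆ U → EqOn V W O → EqOn (N V) (N W) O
  potential : ∀ V, ContDiffOn ℝ ∞ V U → ∀ x ∈ U, extDeriv (N V) x = noetherCurrent g Γ V x

/-- `𝒟^a V^b`, with the Levi-Civita derivative. -/
def gradUp (g : MetricField) (V : VField) (x : Spacetime) (a b : Fin 4) : ℝ :=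
  ∑ c, inv g x a c * (pd c (fun y => V y b) x + ∑ d, christoffel g x b c d * V x d)

/-- The 2-form `½ ε_{abfg} (-𝒟^a V^b + δ^{[b}_d (Q^{a]} - Q̃^{a]}) V^d)`. -/
def chargeForm (g : MetricField) (Γ : ConnField) (V : VField) : Form 2 :=
  dualTwo g fun x a b =>
    -gradUp g V x a b
      + ∑ d, (1 / 2) * ((if b = d then 1 else 0) * (trOneUp g Γ x a - trTwoUp g Γ x a)
          - (if a = d then 1 else 0) * (trOneUp g Γ x b - trTwoUp g Γ x b)) * V x d

/-! ### Spheres and spatial infinity -/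

/-- The coordinate radius. -/
def radius (x : Spacetime) : ℝ := Real.sqrt (x 1 ^ 2 + x 2 ^ 2 + x 3 ^ 2)

/-- The point with time `t₀` and spherical coordinates `(r, θ, φ)`. -/
def spherePoint (t₀ r θ φ : ℝ) : Spacetime :=
  ![t₀, r * Real.sin θ * Real.cos φ, r * Real.sin θ * Real.sin φ, r * Real.cos θ]

/-- The integral of a 2-form over the sphere `t = t₀`, `radius = r`, oriented by `dθ ∧ dφ`. -/
def sphereFlux (t₀ r : ℝ) (α : Form 2) : ℝ :=
  ∫ θ in (0 : ℝ)..Real.pi, ∫ φ in (0 : ℝ)..(2 * Real.pi),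
    α (spherePoint t₀ r θ φ)
      ![deriv (fun θ' => spherePoint t₀ r θ' φ) θ, deriv (fun φ' => spherePoint t₀ r θ φ') φ]

/-- The integral `∫ f dS` of a function over the sphere `t = t₀`, `radius = r`,
with the area element `r² sin θ dθ dφ`. -/
def sphereIntegral (t₀ r : ℝ) (f : Spacetime → ℝ) : ℝ :=
  ∫ θ in (0 : ℝ)..Real.pi, ∫ φ in (0 : ℝ)..(2 * Real.pi),
    f (spherePoint t₀ r θ φ) * (r ^ 2 * Real.sin θ)

/-- Spatial infinity of the slice `t = t₀`. -/
def spatialInfinity (t₀ : ℝ) : Filter Spacetime := comap radius atTop ⊓ 𝓟 {x | x 0 = t₀}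

/-- `g = η + O(1/r)` and `∂g = O(1/r²)` on the slice `t = t₀`. -/
def IsAsymptoticallyFlat (t₀ : ℝ) (g : MetricField) : Prop :=
  ∀ a b, ((fun x => g x a b - minkowski a b) =O[spatialInfinity t₀] fun x => 1 / radius x) ∧
    ∀ c, (pd c fun x => g x a b) =O[spatialInfinity t₀] fun x => 1 / radius x ^ 2

/-- `Γ = O(1/r²)` on the slice `t = t₀`. -/
def ConnDecays (t₀ : ℝ) (Γ : ConnField) : Prop :=
  ∀ a b c, (fun x => Γ x a b c) =O[spatialInfinity t₀] fun x => 1 / radius x ^ 2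

/-- The variations vanish at infinity: `δg = o(1)` and `δΓ = o(1/r²)`. -/
def VariationVanishesAtInfinity (t₀ : ℝ) (δg : MetricField) (δΓ : ConnField) : Prop :=
  (∀ a b, (fun x => δg x a b) =o[spatialInfinity t₀] fun _ => (1 : ℝ)) ∧
    ∀ a b c, (fun x => δΓ x a b c) =o[spatialInfinity t₀] fun x => 1 / radius x ^ 2

/-! ### Energy -/

/-- The asymptotic time translation `t^a = (∂_t)^a`. -/
def timeTranslation : VField := fun _ => basisVec 0

/-- `B`, a 3-form depending on the fields, satisfies `δ ∫_∞ i_t B = ∫_∞ i_t Θ(φ, δφ)` at `(g, Γ)`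
for all variations that vanish at infinity. -/
def IsBoundaryFunctional (t₀ : ℝ) (g : MetricField) (Γ : ConnField)
    (B : MetricField → ConnField → Form 3) : Prop :=
  ∀ δg δΓ, VariationVanishesAtInfinity t₀ δg δΓ →
    ∃ (b : ℝ → ℝ) (d : ℝ),
      (∀ᶠ s in 𝓝 (0 : ℝ), Tendsto
        (fun r => sphereFlux t₀ r (interiorProd timeTranslation (B (g + s • δg) (Γ + s • δΓ))))
        atTop (𝓝 (b s))) ∧
      HasDerivAt b d 0 ∧
      Tendsto (fun r => sphereFlux t₀ r (interiorProd timeTranslation (thetaForm g Γ δg δΓ)))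
        atTop (𝓝 d)

/-- `E` is the canonical energy `∫_∞ (N[t] - i_t B)` of `(g, Γ)`, for the Noether charge `N` and
the boundary functional `B`. -/
structure IsCanonicalEnergy (U : Set Spacetime) (t₀ : ℝ) (g : MetricField) (Γ : ConnField)
    (N : VField → Form 2) (B : MetricField → ConnField → Form 3) (E : ℝ) : Prop where
  noether : IsNoetherCharge U g Γ N
  boundary : IsBoundaryFunctional t₀ g Γ B
  limit : Tendsto
    (fun r => sphereFlux t₀ r fun x => N timeTranslation x - interiorProd timeTranslation (B g Γ) x)
    atTop (𝓝 E)

/-- Components of the unit coordinate radial vector. -/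
def radial (x : Spacetime) (i : Fin 3) : ℝ := x i.succ / radius x

/-- The spatial metric `h_{ij} = g_{ij}`. -/
def spatialMetric (g : MetricField) (x : Spacetime) : Matrix (Fin 3) (Fin 3) ℝ :=
  Matrix.of fun i j => g x i.succ j.succ

/-- `M` is the ADM mass of `g` (in units `8πG = 1`, so that `1 / 16πG = 1 / 2`):
the limit of `½ ∫ (∂_j h_{ij} - ∂_i h_{jj}) n^i dS` over large spheres. -/
def IsADMMass (t₀ : ℝ) (g : MetricField) (M : ℝ) : Prop :=
  Tendsto (fun r => (1 / 2) * sphereIntegral t₀ r fun x =>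
    ∑ i, ∑ j, (pd j.succ (fun y => spatialMetric g y i j) x
      - pd i.succ (fun y => spatialMetric g y j j) x) * radial x i) atTop (𝓝 M)

/-- `h^{ij} (∂_i h_{rj} - ∂_r h_{ij})`, where the index `r` is contraction with the radial vector
(after differentiation). -/
def admIntegrand (g : MetricField) (x : Spacetime) : ℝ :=
  ∑ i, ∑ j, (spatialMetric g x)⁻¹ i j *
    ∑ k, radial x k * (pd i.succ (fun y => spatialMetric g y k j) x
      - pd k.succ (fun y => spatialMetric g y i j) x)

end

end STEGR

namespace STEGR

/-! ### Partial derivatives -/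

section PartialDerivatives

variable {U : Set Spacetime} {x : Spacetime} {f h : Spacetime → ℝ}

/-! Write K = Γ − C, where C is the Levi-Civita connection, and put κ_c = K^b_{bc}, k^a = g^{bc}
K^a_{bc}, A = k − κ. Because 𝒟g = 0, everything built from the non-metricity is algebraic in K: Q^a
− Q̃^a = A^a (`tr_sub_eq`), P is given by `conjP_eq`, and ℚ = κ_a k^a − g^{bd} K^a_{de} K^e_{ab}
(`quadQ_eq_distortion`). The trace of the flatness condition on Γ, with Ric(g) = 0, reads 𝒟_a A^a =
−ℚ (`div_eq_neg_quadQ`), so the Lagrangian is a total divergence on shell.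

The Lie derivative of Γ is 𝒟𝒟V, plus a curvature term, plus the Lie derivative of the tensor K
(`lieConn_eq`). In the two traces that enter Θ the curvature reduces to Ricci and drops out, and
most products of 𝒟V with K cancel against P·ℒ_V g (`theta_lie_eq`). What remains of Θ^a + ½ℚV^a is
the divergence of the antisymmetric part of −𝒟^aV^b + A^{[a}V^{b]} (`divergence_chargeTensor`).
Since d of a dual 2-form is the dual of a divergence (`extDeriv_dualTwo`), this tensor defines a
Noether charge.

Uniqueness of the flux needs no classification of closed local 2-forms. Multiply t by a cutoff χ
that is 1 near the sphere of radius r and 0 near the sphere of radius r + 1. Locality keeps the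
inner flux and kills the outer one, and Stokes' theorem on the shell (`sphereFlux_sub`) gives minus
the integral of J[χt], in which the choice of charge no longer appears
(`IsNoetherCharge.sphereFlux_eq`).

At infinity Θ is o(1/r²) for vanishing variations, so its flux tends to zero and B = 0 is
admissible. In the coincident gauge the time component of J[t] is quadratic in first derivatives of
g, hence O(1/r⁴). By Stokes the fluxes are then Cauchy in r, which gives existence of the energy
(`exists_tendsto_sphereFlux`). For its value, compare integrands to order 1/r²
(`chargeFlux_leadingOrder`): the Komar part contributes −∂_r g_{00} + ∂_t g_{0r}, and the
non-metricity part cancels exactly these terms and adds ∂_j h_{rj} − ∂_r h_{jj}. Errors of order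
o(1/r²) do not survive integration over large spheres (`LeadingOrder.tendsto_sphereIntegral_iff`).
-/

theorem differentiableAt_of_smoothOn (hU : IsOpen U) (hf : ContDiffOn ℝ ∞ f U) (hx : x ∈ U) :
    DifferentiableAt ℝ f x :=
  (hf.contDiffAt (hU.mem_nhds hx)).differentiableAt (by simp)

theorem pd_smoothOn (hU : IsOpen U) (hf : ContDiffOn ℝ ∞ f U) (a : Fin 4) :
    ContDiffOn ℝ ∞ (pd a f) U :=
  (hf.fderiv_of_isOpen hU (by simp)).clm_apply contDiffOn_const

theorem pd_congr (hU : IsOpen U) (hx : x ∈ U) (hfh : EqOn f h U) (a : Fin 4) :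
    pd a f x = pd a h x := by
  unfold pd
  rw [(hfh.eventuallyEq_of_mem (hU.mem_nhds hx)).fderiv_eq]

theorem pd_const (a : Fin 4) (c : ℝ) : pd a (fun _ => c) x = 0 := by
  simp [pd]

theorem pd_add (hf : DifferentiableAt ℝ f x) (hh : DifferentiableAt ℝ h x) (a : Fin 4) :
    pd a (fun y => f y + h y) x = pd a f x + pd a h x := by
  simp [pd, fderiv_fun_add hf hh]

theorem pd_sub (hf : DifferentiableAt ℝ f x) (hh : DifferentiableAt ℝ h x) (a : Fin 4) :
    pd a (fun y => f y - h y) x = pd a f x - pd a h x := by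
  simp [pd, fderiv_fun_sub hf hh]

theorem pd_mul (hf : DifferentiableAt ℝ f x) (hh : DifferentiableAt ℝ h x) (a : Fin 4) :
    pd a (fun y => f y * h y) x = pd a f x * h x + f x * pd a h x := by
  simp [pd, fderiv_fun_mul hf hh]; ring

theorem pd_const_mul (c : ℝ) (hf : DifferentiableAt ℝ f x) (a : Fin 4) :
    pd a (fun y => c * f y) x = c * pd a f x := by
  rw [pd_mul (differentiableAt_const c) hf, pd_const]; ring

theorem pd_sum {ι : Type*} {s : Finset ι} {F : ι → Spacetime → ℝ}
    (hF : ∀ i ∈ s, DifferentiableAt ℝ (F i) x) (a : Fin 4) :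
    pd a (fun y => ∑ i ∈ s, F i y) x = ∑ i ∈ s, pd a (F i) x := by
  simp [pd, fderiv_fun_sum hF]

/-- Symmetry of the second Fréchet derivative. Its one use is the commutator of partial derivatives
of the metric in `riemann_antisymm_left`. -/
theorem pd_comm (hU : IsOpen U) (hf : ContDiffOn ℝ ∞ f U) (hx : x ∈ U) (a b : Fin 4) :
    pd a (pd b f) x = pd b (pd a f) x := by
  have hc : ContDiffAt ℝ ∞ f x := hf.contDiffAt (hU.mem_nhds hx)
  have hs : IsSymmSndFDerivAt ℝ f x := hc.isSymmSndFDerivAt (by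
    simp only [minSmoothness_of_isRCLikeNormedField]; exact WithTop.coe_le_coe.2 le_top)
  have hd : DifferentiableAt ℝ (fderiv ℝ f) x :=
    (hc.fderiv_right (m := 1) (WithTop.coe_le_coe.2 le_top)).differentiableAt (by simp)
  have key : ∀ c d : Fin 4, pd c (pd d f) x = fderiv ℝ (fderiv ℝ f) x (basisVec c) (basisVec d) := by
    intro c d
    simp only [pd, show pd d f = fun y => fderiv ℝ f y (basisVec d) from rfl]
    rw [fderiv_clm_apply hd (differentiableAt_const _)]
    simp
  rw [key, key]
  exact hs _ _

end PartialDerivatives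

/-! ### The metric, its inverse and the Levi-Civita connection -/

section Metric

variable {U : Set Spacetime} {x : Spacetime} {g : MetricField} {Γ : ConnField}

theorem IsLorentzMetricOn.det_neg (hg : IsLorentzMetricOn U g) (hx : x ∈ U) : (g x).det < 0 := by
  obtain ⟨P, hP, h⟩ := hg.lorentzian x hx
  have : (minkowski).det = -1 := by
    simp [minkowski, Matrix.det_diagonal, Fin.prod_univ_four]
  rw [h, Matrix.det_mul, Matrix.det_mul, Matrix.det_transpose, this]
  nlinarith [mul_self_pos.2 hP]

theorem IsLorentzMetricOn.symm (hg : IsLorentzMetricOn U g) (hx : x ∈ U) (a b : Fin 4) :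
    g x a b = g x b a := by
  obtain ⟨P, hP, h⟩ := hg.lorentzian x hx
  have : (g x).transpose = g x := by
    rw [h]
    simp [Matrix.transpose_mul, minkowski, Matrix.mul_assoc]
  exact congrFun (congrFun this b) a

theorem IsLorentzMetricOn.isUnit_det (hg : IsLorentzMetricOn U g) (hx : x ∈ U) :
    IsUnit (g x).det := (hg.det_neg hx).ne.isUnit

theorem inv_symm (hg : IsLorentzMetricOn U g) (hx : x ∈ U) (a b : Fin 4) :
    inv g x a b = inv g x b a := by
  have : (g x).transpose = g x := by
    ext i j; exact hg.symm hx j i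
  have h2 : ((g x)⁻¹).transpose = (g x)⁻¹ := by rw [Matrix.transpose_nonsing_inv, this]
  exact congrFun (congrFun h2 b) a

theorem metric_mul_inv (hg : IsLorentzMetricOn U g) (hx : x ∈ U) (a c : Fin 4) :
    ∑ b, g x a b * inv g x b c = if a = c then 1 else 0 := by
  have := congrFun (congrFun (Matrix.mul_nonsing_inv _ (hg.isUnit_det hx)) a) c
  rwa [Matrix.mul_apply, Matrix.one_apply] at this

theorem inv_mul_metric (hg : IsLorentzMetricOn U g) (hx : x ∈ U) (a c : Fin 4) :
    ∑ b, inv g x a b * g x b c = if a = c then 1 else 0 := by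
  have := congrFun (congrFun (Matrix.nonsing_inv_mul _ (hg.isUnit_det hx)) a) c
  rwa [Matrix.mul_apply, Matrix.one_apply] at this

theorem det_smoothOn {ι : Type*} [Fintype ι] [DecidableEq ι] {M : Spacetime → Matrix ι ι ℝ}
    (hM : ∀ a b, ContDiffOn ℝ ∞ (fun x => M x a b) U) : ContDiffOn ℝ ∞ (fun x => (M x).det) U := by
  simp only [Matrix.det_apply]
  refine ContDiffOn.sum fun σ _ => ?_
  simp only [Units.smul_def, zsmul_eq_mul]
  exact contDiffOn_const.mul (contDiffOn_prod fun i _ => hM _ _)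

/-- Cramer's rule: each entry is a quotient of determinants in the smooth components, and the
denominator is negative on `U`. -/
theorem inv_smoothOn (hg : IsLorentzMetricOn U g) (a b : Fin 4) :
    ContDiffOn ℝ ∞ (fun x => inv g x a b) U := by
  have h : ∀ x, inv g x a b = (g x).det⁻¹ * ((g x).updateRow b (Pi.single a 1)).det := by
    intro x
    simp [inv, Matrix.inv_def, Matrix.adjugate_apply, Ring.inverse_eq_inv']
  simp only [h]
  refine ((det_smoothOn hg.smooth).inv fun x hx => (hg.det_neg hx).ne).mul
    (det_smoothOn fun i j => ?_)
  by_cases hib : i = b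
  · subst hib
    simpa using contDiffOn_const
  · simpa [Matrix.updateRow_ne hib] using hg.smooth i j

theorem christoffel_smoothOn (hU : IsOpen U) (hg : IsLorentzMetricOn U g) (a b c : Fin 4) :
    ContDiffOn ℝ ∞ (fun x => christoffel g x a b c) U := by
  unfold christoffel
  refine ContDiffOn.sum fun d _ => ?_
  exact (contDiffOn_const.mul (inv_smoothOn hg a d)).mul
    (((pd_smoothOn hU (hg.smooth _ _) _).add (pd_smoothOn hU (hg.smooth _ _) _)).sub
      (pd_smoothOn hU (hg.smooth _ _) _))

theorem pd_metric_symm (hU : IsOpen U) (hg : IsLorentzMetricOn U g) (hx : x ∈ U) (c a b : Fin 4) :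
    pd c (fun y => g y a b) x = pd c (fun y => g y b a) x :=
  pd_congr hU hx (fun _ hy => hg.symm hy a b) c

theorem christoffel_symm (hU : IsOpen U) (hg : IsLorentzMetricOn U g) (hx : x ∈ U)
    (a b c : Fin 4) : christoffel g x a b c = christoffel g x a c b := by
  unfold christoffel
  refine Finset.sum_congr rfl fun d _ => ?_
  rw [pd_metric_symm hU hg hx d b c]; ring

theorem sum_delta_mul (a : Fin 4) (f : Fin 4 → ℝ) :
    ∑ b, (if a = b then (1 : ℝ) else 0) * f b = f a := by
  simp

theorem lower_christoffel (hg : IsLorentzMetricOn U g) (hx : x ∈ U) (e b c : Fin 4) :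
    ∑ a, g x e a * christoffel g x a b c = (1 / 2) * (pd b (fun y => g y e c) x
      + pd c (fun y => g y e b) x - pd e (fun y => g y b c) x) := by
  have h := sum_delta_mul e fun d => (1 / 2) * (pd b (fun y => g y d c) x
      + pd c (fun y => g y d b) x - pd d (fun y => g y b c) x)
  rw [← h]
  simp only [← metric_mul_inv hg hx, christoffel, Finset.mul_sum, Finset.sum_mul]
  rw [Finset.sum_comm]
  refine Finset.sum_congr rfl fun d _ => Finset.sum_congr rfl fun a _ => by ring

/-- The Levi-Civita connection is metric. -/
theorem pd_metric (hU : IsOpen U) (hg : IsLorentzMetricOn U g) (hx : x ∈ U) (c a b : Fin 4) :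
    pd c (fun y => g y a b) x
      = ∑ d, (christoffel g x d c a * g x d b + christoffel g x d c b * g x a d) := by
  have h1 := lower_christoffel hg hx b c a
  have h2 := lower_christoffel hg hx a c b
  rw [Finset.sum_add_distrib]
  have e1 : ∑ d, christoffel g x d c a * g x d b = ∑ d, g x b d * christoffel g x d c a :=
    Finset.sum_congr rfl fun d _ => by rw [hg.symm hx d b]; ring
  have e2 : ∑ d, christoffel g x d c b * g x a d = ∑ d, g x a d * christoffel g x d c b :=
    Finset.sum_congr rfl fun d _ => by ring
  rw [e1, e2, h1, h2, pd_metric_symm hU hg hx c b a, pd_metric_symm hU hg hx b c a,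
    pd_metric_symm hU hg hx a b c]
  ring

/-- Differentiating g g⁻¹ = 1 gives ∂g⁻¹ = −g⁻¹ (∂g) g⁻¹; metric compatibility replaces ∂g by
Christoffel symbols. In other words 𝒟g⁻¹ = 0. -/
theorem pd_inv (hU : IsOpen U) (hg : IsLorentzMetricOn U g) (hx : x ∈ U) (c a b : Fin 4) :
    pd c (fun y => inv g y a b) x
      = -∑ d, (christoffel g x a c d * inv g x d b + christoffel g x b c d * inv g x a d) := by
  let dG : Matrix (Fin 4) (Fin 4) ℝ := Matrix.of fun i j => pd c (fun y => inv g y i j) x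
  let dg : Matrix (Fin 4) (Fin 4) ℝ := Matrix.of fun i j => pd c (fun y => g y i j) x
  let C : Matrix (Fin 4) (Fin 4) ℝ := Matrix.of fun i j => christoffel g x i c j
  have hG : ∀ i j, DifferentiableAt ℝ (fun y => inv g y i j) x := fun i j =>
    differentiableAt_of_smoothOn hU (inv_smoothOn hg i j) hx
  have hg' : ∀ i j, DifferentiableAt ℝ (fun y => g y i j) x := fun i j =>
    differentiableAt_of_smoothOn hU (hg.smooth i j) hx
  have h1 : dg * (g x)⁻¹ + g x * dG = 0 := by
    ext i j
    have hz : pd c (fun y => ∑ k, g y i k * inv g y k j) x = 0 := by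
      rw [pd_congr hU hx (fun y hy => metric_mul_inv hg hy i j), pd_const]
    rw [pd_sum fun k _ => (hg' i k).fun_mul (hG k j)] at hz
    simp only [Matrix.add_apply, Matrix.mul_apply, ← Finset.sum_add_distrib, Matrix.zero_apply]
    rw [← hz]
    exact Finset.sum_congr rfl fun k _ => by rw [pd_mul (hg' i k) (hG k j)]; rfl
  have h2 : dg = C.transpose * g x + g x * C := by
    ext i j
    simp only [dg, C, Matrix.of_apply, Matrix.add_apply, Matrix.mul_apply, Matrix.transpose_apply,
      pd_metric hU hg hx, ← Finset.sum_add_distrib]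
    exact Finset.sum_congr rfl fun k _ => by ring
  have hu := hg.isUnit_det hx
  have h3 : dG = -((g x)⁻¹ * C.transpose) - C * (g x)⁻¹ := by
    have h4 : (g x)⁻¹ * (dg * (g x)⁻¹ + g x * dG) = 0 := by rw [h1, mul_zero]
    rw [h2, mul_add, ← Matrix.mul_assoc _ (g x) dG, Matrix.nonsing_inv_mul _ hu, Matrix.one_mul,
      Matrix.add_mul, Matrix.mul_assoc _ (g x) (g x)⁻¹, Matrix.mul_nonsing_inv _ hu, Matrix.mul_one,
      Matrix.mul_add, Matrix.mul_assoc (g x) C, ← Matrix.mul_assoc _ (g x) (C * (g x)⁻¹),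
      Matrix.nonsing_inv_mul _ hu, Matrix.one_mul] at h4
    rw [sub_eq_add_neg, ← neg_add, eq_neg_iff_add_eq_zero, add_comm]
    exact h4
  have h5 := congrFun (congrFun h3 a) b
  simp only [dG, C, Matrix.of_apply, Matrix.sub_apply, Matrix.neg_apply, Matrix.mul_apply,
    Matrix.transpose_apply] at h5
  rw [h5, Finset.sum_add_distrib]
  simp only [inv]
  have : ∀ d, (g x)⁻¹ a d * christoffel g x b c d = christoffel g x b c d * (g x)⁻¹ a d :=
    fun d => mul_comm _ _
  simp only [this]
  ring

/-- The square root of the metric determinant. -/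
noncomputable def volDensity (g : MetricField) (x : Spacetime) : ℝ := Real.sqrt (-(g x).det)

theorem volDensity_pos (hg : IsLorentzMetricOn U g) (hx : x ∈ U) : 0 < volDensity g x :=
  Real.sqrt_pos.2 (neg_pos.2 (hg.det_neg hx))

theorem volDensity_smoothOn (hg : IsLorentzMetricOn U g) : ContDiffOn ℝ ∞ (volDensity g) U :=
  (det_smoothOn hg.smooth).neg.sqrt fun x hx => by
    have := hg.det_neg hx
    simp only [ne_eq]; linarith

/-- Jacobi's formula. The determinant is multilinear in the rows, and replacing row i by a basis
vector gives an adjugate entry, so ∂ det g = det g · tr(g⁻¹ ∂g). By `pd_metric` this trace is two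
equal copies of the Christoffel trace. -/
theorem pd_det (hU : IsOpen U) (hg : IsLorentzMetricOn U g) (hx : x ∈ U) (c : Fin 4) :
    pd c (fun y => (g y).det) x = 2 * (∑ d, christoffel g x d c d) * (g x).det := by
  have hg' : ∀ i, DifferentiableAt ℝ (fun y => g y i) x := fun i =>
    differentiableAt_pi.2 fun j => differentiableAt_of_smoothOn hU (hg.smooth i j) hx
  have hgd : HasFDerivAt (fun y i => g y i) (ContinuousLinearMap.pi fun i =>
      fderiv ℝ (fun y => g y i) x) x := hasFDerivAt_pi.2 fun i => (hg' i).hasFDerivAt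
  have h := (coordVol.toContinuousMultilinearMap.hasFDerivAt (x := fun i => g x i)).comp x hgd
  have h1 : pd c (fun y => (g y).det) x
      = ∑ i, coordVol (Function.update (fun i => g x i) i (fderiv ℝ (fun y => g y i) x
          (basisVec c))) := by
    unfold pd
    have e : (fun y => (g y).det) = coordVol.toContinuousMultilinearMap ∘ fun y i => g y i := rfl
    rw [e, h.fderiv]
    simp [ContinuousMultilinearMap.linearDeriv_apply]
  have h2 : ∀ i, coordVol (Function.update (fun i => g x i) i (fderiv ℝ (fun y => g y i) x
          (basisVec c))) = ∑ j, (g x).det * (pd c (fun y => g y i j) x * inv g x j i) := by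
    intro i
    have hadj : ∀ j, coordVol (Function.update (fun i => g x i) i (Pi.single j 1))
        = (g x).det * inv g x j i := by
      intro j
      have : (g x).det * inv g x j i = (g x).adjugate j i := by
        simp only [inv, Matrix.inv_def, Ring.inverse_eq_inv', Matrix.smul_apply, smul_eq_mul]
        rw [mul_inv_cancel_left₀ (hg.det_neg hx).ne]
      rw [this, Matrix.adjugate_apply]
      rfl
    have hrow : fderiv ℝ (fun y => g y i) x (basisVec c) = fun j => pd c (fun y => g y i j) x := by
      ext j
      exact (DFunLike.congr_fun (hasFDerivAt_pi'.1 (hg' i).hasFDerivAt j).fderiv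
        (basisVec c)).symm
    have hlin := map_sum (coordVol.toContinuousLinearMap (fun i => g x i) i)
      (fun j => pd c (fun y => g y i j) x • (Pi.single j 1 : Fin 4 → ℝ)) Finset.univ
    rw [hrow, pi_eq_sum_univ' (fun j => pd c (fun y => g y i j) x)]
    refine Eq.trans hlin (Finset.sum_congr rfl fun j _ => ?_)
    rw [map_smul, smul_eq_mul]
    change _ * coordVol (Function.update (fun i => g x i) i (Pi.single j 1)) = _
    rw [hadj]; ring
  simp only [h1, h2, pd_metric hU hg hx, ← Finset.mul_sum]
  have h3 : ∑ i, ∑ j, (∑ d, (christoffel g x d c i * g x d j + christoffel g x d c j * g x i d))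
      * inv g x j i = ∑ i, ∑ d, christoffel g x d c i * (∑ j, g x d j * inv g x j i)
        + ∑ j, ∑ d, christoffel g x d c j * ∑ i, inv g x j i * g x i d := by
    simp only [Fin.sum_univ_four]; ring
  rw [h3]
  simp only [metric_mul_inv hg hx, inv_mul_metric hg hx]
  simp
  ring

theorem pd_volDensity (hU : IsOpen U) (hg : IsLorentzMetricOn U g) (hx : x ∈ U) (c : Fin 4) :
    pd c (volDensity g) x = (∑ d, christoffel g x d c d) * volDensity g x := by
  have hd : DifferentiableAt ℝ (fun y => (g y).det) x :=
    differentiableAt_of_smoothOn hU (det_smoothOn hg.smooth) hx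
  have hne : -(g x).det ≠ 0 := by have := hg.det_neg hx; linarith
  have h := pd_det hU hg hx c
  unfold pd at h ⊢
  have e : volDensity g = fun y => Real.sqrt (-(g y).det) := rfl
  rw [e, fderiv_sqrt hd.fun_neg hne, fderiv_fun_neg]
  simp only [smul_apply, neg_apply, smul_eq_mul, h]
  have hs : Real.sqrt (-(g x).det) * Real.sqrt (-(g x).det) = -(g x).det :=
    Real.mul_self_sqrt (by have := hg.det_neg hx; linarith)
  have hp := volDensity_pos hg hx
  rw [e] at hp
  have hs0 := hp.ne'
  field_simp
  linear_combination (-∑ d, christoffel g x d c d) * hs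

end Metric

/-! ### Levi-Civita derivatives -/

section LeviCivita

variable {U : Set Spacetime} {x : Spacetime} {g : MetricField} {Γ : ConnField}

/-- `𝒟_a V^b`. -/
noncomputable def covVec (g : MetricField) (V : VField) (x : Spacetime) (a b : Fin 4) : ℝ :=
  pd a (fun y => V y b) x + ∑ d, christoffel g x b a d * V x d

/-- `𝒟_c T_a{}^b`. -/
noncomputable def covMixed (g : MetricField) (T : Spacetime → Fin 4 → Fin 4 → ℝ) (x : Spacetime)
    (c a b : Fin 4) : ℝ :=
  pd c (fun y => T y a b) x
    + ∑ e, (christoffel g x b c e * T x a e - christoffel g x e c a * T x e b)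

/-- `𝒟_c Y^{ab}`. -/
noncomputable def covUp (g : MetricField) (Y : Spacetime → Fin 4 → Fin 4 → ℝ) (x : Spacetime)
    (c a b : Fin 4) : ℝ :=
  pd c (fun y => Y y a b) x
    + ∑ e, (christoffel g x a c e * Y x e b + christoffel g x b c e * Y x a e)

/-- `𝒟_d K^a{}_{bc}`. -/
noncomputable def covConn (g : MetricField) (K : ConnField) (x : Spacetime)
    (a b c d : Fin 4) : ℝ :=
  pd d (fun y => K y a b c) x + ∑ e, (christoffel g x a d e * K x e b c
    - christoffel g x e d b * K x a e c - christoffel g x e d c * K x a b e)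

/-- `𝒟_b κ_c` for a covector. -/
noncomputable def covCovec (g : MetricField) (κ : Spacetime → Fin 4 → ℝ) (x : Spacetime)
    (b c : Fin 4) : ℝ :=
  pd b (fun y => κ y c) x - ∑ e, christoffel g x e b c * κ x e

/-- Raising an index commutes with 𝒟 because 𝒟g⁻¹ = 0, which is `pd_inv`. -/
theorem covUp_raise (hU : IsOpen U) (hg : IsLorentzMetricOn U g) (hx : x ∈ U)
    {T : Spacetime → Fin 4 → Fin 4 → ℝ} (hT : ∀ a b, DifferentiableAt ℝ (fun y => T y a b) x)
    (c a b : Fin 4) :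
    covUp g (fun y a b => ∑ d, inv g y a d * T y d b) x c a b
      = ∑ d, inv g x a d * covMixed g T x c d b := by
  have hG : ∀ i j, DifferentiableAt ℝ (fun y => inv g y i j) x := fun i j =>
    differentiableAt_of_smoothOn hU (inv_smoothOn hg i j) hx
  unfold covUp covMixed
  rw [pd_sum fun d _ => (hG a d).fun_mul (hT d b)]
  simp only [pd_mul (hG _ _) (hT _ _), pd_inv hU hg hx]
  -- Once derivatives are expanded, the claim is a polynomial identity in finitely many components.
  -- Replacing the analytic expressions by free variables lets `ring` decide it; the same device
  -- recurs below.
  generalize christoffel g x = C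
  generalize inv g x = G
  generalize T x = t
  generalize h : (fun d => pd c (fun y => T y d b) x) = dt
  have h' : ∀ d, pd c (fun y => T y d b) x = dt d := fun d => by rw [← h]
  simp only [h', Fin.sum_univ_four]
  ring

theorem covVec_raise (hU : IsOpen U) (hg : IsLorentzMetricOn U g) (hx : x ∈ U)
    {κ : Spacetime → Fin 4 → ℝ} (hκ : ∀ b, DifferentiableAt ℝ (fun y => κ y b) x) (c a : Fin 4) :
    covVec g (fun y a => ∑ d, inv g y a d * κ y d) x c a
      = ∑ d, inv g x a d * covCovec g κ x c d := by
  have hG : ∀ i j, DifferentiableAt ℝ (fun y => inv g y i j) x := fun i j =>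
    differentiableAt_of_smoothOn hU (inv_smoothOn hg i j) hx
  unfold covVec covCovec
  rw [pd_sum fun d _ => (hG a d).fun_mul (hκ d)]
  simp only [pd_mul (hG _ _) (hκ _), pd_inv hU hg hx]
  generalize christoffel g x = C
  generalize inv g x = G
  generalize κ x = t
  generalize h : (fun d => pd c (fun y => κ y d) x) = dt
  have h' : ∀ d, pd c (fun y => κ y d) x = dt d := fun d => by rw [← h]
  simp only [h', Fin.sum_univ_four]
  ring

theorem covCovec_trace {K : ConnField} (hK : ∀ a b c, DifferentiableAt ℝ (fun y => K y a b c) x)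
    (d c : Fin 4) :
    covCovec g (fun y c => ∑ b, K y b b c) x d c = ∑ b, covConn g K x b b c d := by
  unfold covCovec covConn
  rw [pd_sum fun b _ => hK b b c]
  generalize christoffel g x = C
  simp only [Fin.sum_univ_four]
  ring

theorem covVec_contract (hU : IsOpen U) (hg : IsLorentzMetricOn U g) (hx : x ∈ U)
    {K : ConnField} (hK : ∀ a b c, DifferentiableAt ℝ (fun y => K y a b c) x) (d a : Fin 4) :
    covVec g (fun y a => ∑ b, ∑ c, inv g y b c * K y a b c) x d a
      = ∑ b, ∑ c, inv g x b c * covConn g K x a b c d := by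
  have hG : ∀ i j, DifferentiableAt ℝ (fun y => inv g y i j) x := fun i j =>
    differentiableAt_of_smoothOn hU (inv_smoothOn hg i j) hx
  unfold covVec covConn
  rw [pd_sum fun b _ => DifferentiableAt.fun_sum fun c _ => (hG b c).fun_mul (hK a b c)]
  simp only [pd_sum fun c _ => (hG _ c).fun_mul (hK a _ c), pd_mul (hG _ _) (hK _ _ _),
    pd_inv hU hg hx]
  generalize christoffel g x = C
  generalize inv g x = G
  generalize K x = k
  generalize h : (fun b c => pd d (fun y => K y a b c) x) = dt
  have h' : ∀ b c, pd d (fun y => K y a b c) x = dt b c := fun b c => by rw [← h]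
  simp only [h', Fin.sum_univ_four]
  ring

theorem covUp_mul {A V : Spacetime → Fin 4 → ℝ} (hA : ∀ a, DifferentiableAt ℝ (fun y => A y a) x)
    (hV : ∀ a, DifferentiableAt ℝ (fun y => V y a) x) (c a b : Fin 4) :
    covUp g (fun y a b => A y a * V y b) x c a b
      = covVec g A x c a * V x b + A x a * covVec g V x c b := by
  unfold covUp covVec
  rw [pd_mul (hA a) (hV b)]
  simp only [Fin.sum_univ_four]
  ring

/-- The divergence of an antisymmetric tensor. -/
theorem sum_pd_volDensity_mul (hU : IsOpen U) (hg : IsLorentzMetricOn U g) (hx : x ∈ U)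
    {Y : Spacetime → Fin 4 → Fin 4 → ℝ} (hY : ∀ a b, DifferentiableAt ℝ (fun y => Y y a b) x)
    (a : Fin 4) :
    ∑ b, pd b (fun y => volDensity g y * (Y y a b - Y y b a)) x
      = volDensity g x * ∑ b, (covUp g Y x b a b - covUp g Y x b b a) := by
  have hs := differentiableAt_of_smoothOn hU (volDensity_smoothOn hg) hx
  simp only [pd_mul hs ((hY _ _).fun_sub (hY _ _)), pd_sub (hY _ _) (hY _ _),
    pd_volDensity hU hg hx]
  unfold covUp
  have hC := christoffel_symm hU hg hx
  generalize christoffel g x = C at *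
  generalize volDensity g x = s
  generalize Y x = t
  have h1 : ∀ b, ∑ e, (C a b e * t e b + C b b e * t a e) - ∑ e, (C b b e * t e a + C a b e * t b e)
     = ∑ e, (C b b e * (t a e - t e a)) + ∑ e, C a b e * (t e b - t b e) := fun b => by
    simp only [← Finset.sum_sub_distrib, ← Finset.sum_add_distrib]
    exact Finset.sum_congr rfl fun e _ => by ring
  -- A connection symmetric in its lower indices, contracted with an antisymmetric tensor.
  have h2 : ∑ b, ∑ e, C a b e * (t e b - t b e) = 0 := by
    simp only [mul_sub, Finset.sum_sub_distrib]
    rw [sub_eq_zero, Finset.sum_comm]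
    exact Finset.sum_congr rfl fun b _ => Finset.sum_congr rfl fun e _ => by rw [hC a e b]
  -- This trace is exactly the term produced by differentiating the volume density.
  have h3 : ∑ b, ∑ e, C b b e * (t a e - t e a) = ∑ b, (∑ d, C d b d) * (t a b - t b a) := by
    rw [Finset.sum_comm]
    refine Finset.sum_congr rfl fun e _ => ?_
    rw [Finset.sum_mul]
    exact Finset.sum_congr rfl fun b _ => by rw [hC b b e]
  have h4 : ∀ b, pd b (fun y => Y y a b) x + ∑ e, (C a b e * t e b + C b b e * t a e)
      - (pd b (fun y => Y y b a) x + ∑ e, (C b b e * t e a + C a b e * t b e))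
      = (pd b (fun y => Y y a b) x - pd b (fun y => Y y b a) x)
        + (∑ e, (C b b e * (t a e - t e a)) + ∑ e, C a b e * (t e b - t b e)) := fun b => by
    rw [← h1]; ring
  have h5 := (Finset.sum_congr rfl fun b (_ : b ∈ Finset.univ) => h4 b).trans
    (Finset.sum_add_distrib.trans (congrArg _ (Finset.sum_add_distrib.trans
      (congrArg₂ _ h3 h2))))
  rw [h5, add_zero, ← Finset.sum_add_distrib, Finset.mul_sum]
  exact Finset.sum_congr rfl fun b _ => by ring

end LeviCivita

/-! ### The difference of the two connections -/

section Distortion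

variable {U : Set Spacetime} {x : Spacetime} {g : MetricField} {Γ : ConnField}

/-- The difference `K^a_{bc}` of `Γ` and the Levi-Civita connection. -/
noncomputable def distortion (g : MetricField) (Γ : ConnField) : ConnField := fun x a b c =>
  Γ x a b c - christoffel g x a b c

/-- `κ_c = K^b_{bc}`. -/
noncomputable def distTrace (g : MetricField) (Γ : ConnField) (x : Spacetime) (c : Fin 4) : ℝ :=
  ∑ b, distortion g Γ x b b c

/-- `κ^a`. -/
noncomputable def distTraceUp (g : MetricField) (Γ : ConnField) (x : Spacetime) (a : Fin 4) : ℝ :=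
  ∑ d, inv g x a d * distTrace g Γ x d

/-- `k^a = g^{bc} K^a_{bc}`. -/
noncomputable def distContr (g : MetricField) (Γ : ConnField) (x : Spacetime) (a : Fin 4) : ℝ :=
  ∑ b, ∑ c, inv g x b c * distortion g Γ x a b c

/-- `K^{abc}`. -/
noncomputable def distUp (g : MetricField) (Γ : ConnField) (x : Spacetime) (a b c : Fin 4) : ℝ :=
  ∑ d, ∑ e, inv g x b d * inv g x c e * distortion g Γ x a d e

/-- `K_{abc}`. -/
noncomputable def distDown (g : MetricField) (Γ : ConnField) (x : Spacetime) (a b c : Fin 4) : ℝ :=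
  ∑ h, g x a h * distortion g Γ x h b c

theorem distortion_smoothOn (hU : IsOpen U) (hg : IsLorentzMetricOn U g)
    (hΓ : IsSymmetricTeleparallelOn U Γ) (a b c : Fin 4) :
    ContDiffOn ℝ ∞ (fun x => distortion g Γ x a b c) U :=
  (hΓ.smooth a b c).sub (christoffel_smoothOn hU hg a b c)

theorem distTraceUp_smoothOn (hU : IsOpen U) (hg : IsLorentzMetricOn U g)
    (hΓ : IsSymmetricTeleparallelOn U Γ) (a : Fin 4) :
    ContDiffOn ℝ ∞ (fun x => distTraceUp g Γ x a) U :=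
  ContDiffOn.sum fun _ _ => (inv_smoothOn hg _ _).mul
    (ContDiffOn.sum fun _ _ => distortion_smoothOn hU hg hΓ _ _ _)

theorem distContr_smoothOn (hU : IsOpen U) (hg : IsLorentzMetricOn U g)
    (hΓ : IsSymmetricTeleparallelOn U Γ) (a : Fin 4) :
    ContDiffOn ℝ ∞ (fun x => distContr g Γ x a) U :=
  ContDiffOn.sum fun _ _ => ContDiffOn.sum fun _ _ => (inv_smoothOn hg _ _).mul
    (distortion_smoothOn hU hg hΓ _ _ _)

theorem distortion_symm (hU : IsOpen U) (hg : IsLorentzMetricOn U g)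
    (hΓ : IsSymmetricTeleparallelOn U Γ) (hx : x ∈ U) (a b c : Fin 4) :
    distortion g Γ x a b c = distortion g Γ x a c b := by
  unfold distortion
  rw [hΓ.torsion_free x hx, christoffel_symm hU hg hx]

theorem distDown_symm (hU : IsOpen U) (hg : IsLorentzMetricOn U g)
    (hΓ : IsSymmetricTeleparallelOn U Γ) (hx : x ∈ U) (a b c : Fin 4) :
    distDown g Γ x a b c = distDown g Γ x a c b :=
  Finset.sum_congr rfl fun h _ => by rw [distortion_symm hU hg hΓ hx]

theorem distUp_symm (hU : IsOpen U) (hg : IsLorentzMetricOn U g)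
    (hΓ : IsSymmetricTeleparallelOn U Γ) (hx : x ∈ U) (a b c : Fin 4) :
    distUp g Γ x a b c = distUp g Γ x a c b := by
  unfold distUp
  rw [Finset.sum_comm]
  exact Finset.sum_congr rfl fun h _ => Finset.sum_congr rfl fun h _ => by
    rw [distortion_symm hU hg hΓ hx]; ring

/-- ∇g differs from 𝒟g = 0 only by the action of the distortion on the two indices of g. -/
theorem nonmet_eq (hU : IsOpen U) (hg : IsLorentzMetricOn U g) (hx : x ∈ U) (a b c : Fin 4) :
    nonmet g Γ x a b c = -(distDown g Γ x c a b + distDown g Γ x b a c) := by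
  unfold nonmet distDown distortion
  rw [pd_metric hU hg hx, ← Finset.sum_sub_distrib, ← Finset.sum_add_distrib,
    ← Finset.sum_neg_distrib]
  exact Finset.sum_congr rfl fun d _ => by rw [hg.symm hx c d]; ring

theorem inv_mul_distDown (hg : IsLorentzMetricOn U g) (hx : x ∈ U) (a b c : Fin 4) :
    ∑ e, inv g x a e * distDown g Γ x e b c = distortion g Γ x a b c := by
  rw [← sum_delta_mul a fun h => distortion g Γ x h b c]
  simp only [← inv_mul_metric hg hx, distDown, Finset.sum_mul, Finset.mul_sum]
  rw [Finset.sum_comm]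
  exact Finset.sum_congr rfl fun h _ => Finset.sum_congr rfl fun h _ => by ring

theorem nonmetUp_eq (hU : IsOpen U) (hg : IsLorentzMetricOn U g) (hx : x ∈ U) (a b c : Fin 4) :
    nonmetUp g Γ x a b c = -(distUp g Γ x c a b + distUp g Γ x b a c) := by
  have e1 : ∀ d e, ∑ f, inv g x a d * inv g x b e * inv g x c f * nonmet g Γ x d e f
      = -(inv g x a d * inv g x b e * distortion g Γ x c d e)
        - ∑ f, inv g x a d * inv g x c f * (inv g x b e * distDown g Γ x e d f) := by
    intro d e
    rw [← inv_mul_distDown hg hx c d e, Finset.mul_sum, ← Finset.sum_neg_distrib,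
      ← Finset.sum_sub_distrib]
    exact Finset.sum_congr rfl fun f _ => by rw [nonmet_eq hU hg hx]; ring
  have e2 : ∀ d, ∑ e, ∑ f, inv g x a d * inv g x c f * (inv g x b e * distDown g Γ x e d f)
      = ∑ f, inv g x a d * inv g x c f * distortion g Γ x b d f := by
    intro d
    rw [Finset.sum_comm]
    exact Finset.sum_congr rfl fun f _ => by rw [← Finset.mul_sum, inv_mul_distDown hg hx]
  unfold nonmetUp distUp
  simp only [e1, Finset.sum_sub_distrib, e2, Finset.sum_neg_distrib]
  ring

theorem trOne_eq (hU : IsOpen U) (hg : IsLorentzMetricOn U g)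
    (hΓ : IsSymmetricTeleparallelOn U Γ) (hx : x ∈ U) (a : Fin 4) :
    trOne g Γ x a = -2 * distTrace g Γ x a := by
  have e : ∀ b, ∑ c, inv g x b c * distDown g Γ x c a b = distortion g Γ x b b a := fun b => by
    rw [inv_mul_distDown hg hx, distortion_symm hU hg hΓ hx]
  have e' : ∑ b, ∑ c, inv g x b c * distDown g Γ x b a c
      = ∑ b, ∑ c, inv g x b c * distDown g Γ x c a b := by
    rw [Finset.sum_comm]
    exact Finset.sum_congr rfl fun b _ => Finset.sum_congr rfl fun c _ => by
      rw [inv_symm hg hx]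
  unfold trOne distTrace
  simp only [nonmet_eq hU hg hx, mul_neg, mul_add, Finset.sum_neg_distrib, Finset.sum_add_distrib,
    e', e]
  ring

theorem trTwo_eq (hU : IsOpen U) (hg : IsLorentzMetricOn U g) (hx : x ∈ U) (a : Fin 4) :
    trTwo g Γ x a = -distTrace g Γ x a - ∑ h, g x a h * distContr g Γ x h := by
  have e : ∑ b, ∑ c, inv g x b c * distDown g Γ x c b a = distTrace g Γ x a :=
    Finset.sum_congr rfl fun b _ => inv_mul_distDown hg hx b b a
  have e' : ∑ b, ∑ c, inv g x b c * distDown g Γ x a b c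
      = ∑ h, g x a h * distContr g Γ x h := by
    unfold distDown distContr
    simp only [Fin.sum_univ_four]
    ring
  unfold trTwo
  simp only [nonmet_eq hU hg hx, mul_neg, mul_add, Finset.sum_neg_distrib, Finset.sum_add_distrib,
    e', e]
  ring

theorem trOneUp_eq (hU : IsOpen U) (hg : IsLorentzMetricOn U g)
    (hΓ : IsSymmetricTeleparallelOn U Γ) (hx : x ∈ U) (a : Fin 4) :
    trOneUp g Γ x a = -2 * distTraceUp g Γ x a := by
  unfold trOneUp distTraceUp
  rw [Finset.mul_sum]
  exact Finset.sum_congr rfl fun b _ => by rw [trOne_eq hU hg hΓ hx]; ring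

theorem inv_mul_metric_mul (hg : IsLorentzMetricOn U g) (hx : x ∈ U) (a : Fin 4)
    (v : Fin 4 → ℝ) : ∑ b, inv g x a b * ∑ h, g x b h * v h = v a := by
  rw [← sum_delta_mul a v]
  simp only [← inv_mul_metric hg hx, Finset.sum_mul, Finset.mul_sum]
  rw [Finset.sum_comm]
  exact Finset.sum_congr rfl fun h _ => Finset.sum_congr rfl fun h _ => by ring

theorem metric_mul_inv_mul (hg : IsLorentzMetricOn U g) (hx : x ∈ U) (a : Fin 4)
    (v : Fin 4 → ℝ) : ∑ b, g x a b * ∑ h, inv g x b h * v h = v a := by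
  rw [← sum_delta_mul a v]
  simp only [← metric_mul_inv hg hx, Finset.sum_mul, Finset.mul_sum]
  rw [Finset.sum_comm]
  exact Finset.sum_congr rfl fun h _ => Finset.sum_congr rfl fun h _ => by ring

theorem trTwoUp_eq (hU : IsOpen U) (hg : IsLorentzMetricOn U g) (hx : x ∈ U) (a : Fin 4) :
    trTwoUp g Γ x a = -distTraceUp g Γ x a - distContr g Γ x a := by
  unfold trTwoUp distTraceUp
  simp only [trTwo_eq hU hg hx, mul_sub, Finset.sum_sub_distrib, inv_mul_metric_mul hg hx, mul_neg,
    Finset.sum_neg_distrib]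

/-- This identifies the vector in the charge with A = k − κ, the vector whose divergence the
flatness of Γ controls. -/
theorem tr_sub_eq (hU : IsOpen U) (hg : IsLorentzMetricOn U g)
    (hΓ : IsSymmetricTeleparallelOn U Γ) (hx : x ∈ U) (a : Fin 4) :
    trOneUp g Γ x a - trTwoUp g Γ x a = distContr g Γ x a - distTraceUp g Γ x a := by
  rw [trOneUp_eq hU hg hΓ hx, trTwoUp_eq hU hg hx]; ring

/-- Of the six terms from `nonmetUp_eq`, those with b or c in the first slot of K cancel by symmetry
of the last two slots; the two with a in front combine. -/
theorem conjP_eq (hU : IsOpen U) (hg : IsLorentzMetricOn U g)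
    (hΓ : IsSymmetricTeleparallelOn U Γ) (hx : x ∈ U) (a b c : Fin 4) :
    conjP g Γ x a b c = -(1 / 2) * distUp g Γ x a b c
      + (1 / 4) * inv g x b c * (distContr g Γ x a - distTraceUp g Γ x a)
      + (1 / 4) * (inv g x a b * distTraceUp g Γ x c + inv g x a c * distTraceUp g Γ x b) := by
  unfold conjP
  rw [tr_sub_eq hU hg hΓ hx]
  simp only [nonmetUp_eq hU hg hx, trOneUp_eq hU hg hΓ hx]
  rw [distUp_symm hU hg hΓ hx c b a, distUp_symm hU hg hΓ hx b c a, distUp_symm hU hg hΓ hx a c b]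
  ring

/-- Relabelling of dummy indices. This and the next three lemmas bring the products in `quadQ_eq` to
two normal forms. -/
theorem sum_rotate (f : Fin 4 → Fin 4 → Fin 4 → ℝ) :
    ∑ a, ∑ b, ∑ c, f c a b = ∑ a, ∑ b, ∑ c, f a b c := by
  simp only [Fin.sum_univ_four]; ring

theorem sum_swap_left (f : Fin 4 → Fin 4 → Fin 4 → ℝ) :
    ∑ a, ∑ b, ∑ c, f b a c = ∑ a, ∑ b, ∑ c, f a b c :=
  Finset.sum_comm

theorem sum_rotate_left (f : Fin 4 → Fin 4 → Fin 4 → ℝ) :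
    ∑ a, ∑ b, ∑ c, f b c a = ∑ a, ∑ b, ∑ c, f a b c := by
  simp only [Fin.sum_univ_four]; ring

theorem sum_reverse (f : Fin 4 → Fin 4 → Fin 4 → ℝ) :
    ∑ a, ∑ b, ∑ c, f c b a = ∑ a, ∑ b, ∑ c, f a b c := by
  simp only [Fin.sum_univ_four]; ring

/-- Up to relabelling only K_{abc}K^{abc} and K_{abc}K^{bac} occur. The coefficients ¼ and −½ in ℚ
give the first weight 2/4 − 1/2 = 0 and the second 2/4 − 3/2 = −1. In the trace part the κ_a κ^a
terms cancel and κ_a k^a remains. -/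
theorem quadQ_eq (hU : IsOpen U) (hg : IsLorentzMetricOn U g)
    (hΓ : IsSymmetricTeleparallelOn U Γ) (hx : x ∈ U) :
    quadQ g Γ x = ∑ a, distTrace g Γ x a * distContr g Γ x a
      - ∑ a, ∑ b, ∑ c, distDown g Γ x a b c * distUp g Γ x b a c := by
  unfold quadQ
  simp only [trOne_eq hU hg hΓ hx, trOneUp_eq hU hg hΓ hx, trTwoUp_eq hU hg hx,
    nonmet_eq hU hg hx, nonmetUp_eq hU hg hx]
  have hp := distDown_symm hU hg hΓ hx
  have hq := distUp_symm hU hg hΓ hx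
  generalize distDown g Γ x = p at *
  generalize distUp g Γ x = q at *
  have e1 : ∑ a, ∑ b, ∑ c, -(p c a b + p b a c) * -(q c a b + q b a c)
      = 2 * (∑ a, ∑ b, ∑ c, p a b c * q a b c) + 2 * ∑ a, ∑ b, ∑ c, p a b c * q b a c := by
    have : ∀ a b c, -(p c a b + p b a c) * -(q c a b + q b a c)
        = p c a b * q c a b + p b a c * q b a c + p c b a * q b c a + p b c a * q c b a :=
      fun a b c => by rw [hp c b a, hp b c a, hq b c a, hq c b a]; ring
    simp only [this, Finset.sum_add_distrib]
    rw [sum_rotate fun a b c => p a b c * q a b c, sum_swap_left fun a b c => p a b c * q a b c,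
      sum_reverse fun a b c => p a b c * q b a c, sum_rotate_left fun a b c => p a b c * q b a c]
    ring
  have e2 : ∑ a, ∑ b, ∑ c, -(p c a b + p b a c) * -(q c b a + q a b c)
      = (∑ a, ∑ b, ∑ c, p a b c * q a b c) + 3 * ∑ a, ∑ b, ∑ c, p a b c * q b a c := by
    have : ∀ a b c, -(p c a b + p b a c) * -(q c b a + q a b c)
        = p c a b * q c a b + p c a b * q a c b + p b c a * q c b a + p b a c * q a b c :=
      fun a b c => by rw [hq c b a, hp b c a, hq a c b]; ring
    simp only [this, Finset.sum_add_distrib]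
    rw [sum_rotate fun a b c => p a b c * q a b c, sum_rotate fun a b c => p a b c * q b a c,
      sum_rotate_left fun a b c => p a b c * q b a c, sum_swap_left fun a b c => p a b c * q b a c]
    ring
  rw [e1, e2]
  simp only [Fin.sum_univ_four]
  ring

/-- `ℚ = κ_a k^a - g^{bd} K^a_{de} K^e_{ab}`. -/
theorem quadQ_eq_distortion (hU : IsOpen U) (hg : IsLorentzMetricOn U g)
    (hΓ : IsSymmetricTeleparallelOn U Γ) (hx : x ∈ U) :
    quadQ g Γ x = ∑ a, distTrace g Γ x a * distContr g Γ x a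
      - ∑ b, ∑ d, inv g x b d * ∑ a, ∑ e, distortion g Γ x a d e * distortion g Γ x e a b := by
  rw [quadQ_eq hU hg hΓ hx]
  congr 1
  have e1 : ∀ b c, ∑ a, distDown g Γ x a b c * distUp g Γ x b a c
      = ∑ d, distortion g Γ x d b c * ∑ e, inv g x c e * distortion g Γ x b e d := by
    intro b c
    have h : ∀ d, distortion g Γ x d b c = ∑ a, inv g x a d * distDown g Γ x a b c := fun d => by
      rw [← inv_mul_distDown hg hx]
      exact Finset.sum_congr rfl fun a _ => by rw [inv_symm hg hx]
    have h' : ∀ d e, distortion g Γ x b e d = distortion g Γ x b d e :=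
      fun d e => distortion_symm hU hg hΓ hx b e d
    generalize hk : distortion g Γ x b = k at h'
    simp only [h, distUp, hk, fun d e : Fin 4 => (h' d e)]
    generalize inv g x = G
    generalize distDown g Γ x = p
    simp only [Fin.sum_univ_four]
    ring
  rw [← sum_rotate fun a b c => distDown g Γ x a b c * distUp g Γ x b a c]
  simp only [e1]
  generalize inv g x = G
  generalize distortion g Γ x = K
  simp only [Fin.sum_univ_four]
  ring

end Distortion

/-! ### Curvature -/

section Curvature

variable {U : Set Spacetime} {x : Spacetime} {g : MetricField} {Γ : ConnField}

theorem riemann_antisymm_right (Γ : ConnField) (x : Spacetime) (a b c d : Fin 4) :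
    riemann Γ x a b c d = -riemann Γ x a b d c := by
  unfold riemann
  simp only [Finset.sum_sub_distrib]
  ring

/-- The curvature of the Levi-Civita connection is antisymmetric in the first pair of indices. -/
theorem riemann_antisymm_left (hU : IsOpen U) (hg : IsLorentzMetricOn U g) (hx : x ∈ U)
    (a b c d : Fin 4) :
    ∑ e, g x a e * riemann (christoffel g) x e b c d
      = -∑ e, g x b e * riemann (christoffel g) x e a c d := by
  have hg' : ∀ i j, DifferentiableAt ℝ (fun y => g y i j) x := fun i j =>
    differentiableAt_of_smoothOn hU (hg.smooth i j) hx
  have hC : ∀ i j k, DifferentiableAt ℝ (fun y => christoffel g y i j k) x := fun i j k =>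
    differentiableAt_of_smoothOn hU (christoffel_smoothOn hU hg i j k) hx
  have h2 : ∀ c d, pd c (pd d fun y => g y a b) x
      = ∑ e, ((pd c (fun y => christoffel g y e d a) x * g x e b
          + christoffel g x e d a * pd c (fun y => g y e b) x)
        + (pd c (fun y => christoffel g y e d b) x * g x a e
          + christoffel g x e d b * pd c (fun y => g y a e) x)) := by
    intro c d
    rw [pd_congr hU hx (fun y hy => pd_metric hU hg hy d a b),
      pd_sum fun e _ => ((hC e d a).fun_mul (hg' e b)).fun_add ((hC e d b).fun_mul (hg' a e))]
    exact Finset.sum_congr rfl fun e _ => by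
      rw [pd_add ((hC e d a).fun_mul (hg' e b)) ((hC e d b).fun_mul (hg' a e)),
        pd_mul (hC e d a) (hg' e b), pd_mul (hC e d b) (hg' a e)]
  -- Expanding ∂_c∂_d g − ∂_d∂_c g = 0 by metric compatibility, applied twice, produces the lowered
  -- curvature symmetrised in its first two indices.
  have h3 := pd_comm hU (hg.smooth a b) hx c d
  rw [h2, h2] at h3
  simp only [pd_metric hU hg hx] at h3
  unfold riemann
  have hs := hg.symm hx
  have hs' : ∀ e, g x e b = g x b e := fun e => hs e b
  simp only [hs'] at h3
  have hCs := christoffel_symm hU hg hx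
  generalize hdC : (fun c a b d => pd c (fun y => christoffel g y a b d) x) = dC
  have hdC' : ∀ a b c d, pd c (fun y => christoffel g y a b d) x = dC c a b d := fun a b c d => by
    rw [← hdC]
  simp only [hdC'] at h3 ⊢
  generalize christoffel g x = C at *
  generalize g x = m at *
  rw [← sub_eq_zero] at h3
  rw [← sub_eq_zero, ← h3]
  simp only [Fin.sum_univ_four]
  rw [hs 1 0, hs 2 0, hs 3 0, hs 2 1, hs 3 1, hs 3 2]
  ring

theorem ricci_trace (g : MetricField) (x : Spacetime) (c d : Fin 4) :
    ∑ b, riemann (christoffel g) x b c d b = -ricci g x c d := by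
  unfold ricci
  rw [← Finset.sum_neg_distrib]
  exact Finset.sum_congr rfl fun b _ => riemann_antisymm_right _ _ _ _ _ _

/-- Antisymmetry in the first pair moves the contraction onto the trace that defines Ricci, and
antisymmetry in the second pair fixes the sign. Neither pair exchange symmetry nor the Bianchi
identity enters. -/
theorem riemann_contract (hU : IsOpen U) (hg : IsLorentzMetricOn U g) (hx : x ∈ U)
    (a d : Fin 4) :
    ∑ b, ∑ c, inv g x b c * riemann (christoffel g) x a c d b
      = ∑ e, inv g x a e * ricci g x e d := by
  have h1 : ∀ c d b, riemann (christoffel g) x a c d b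
      = -∑ e, inv g x a e * ∑ f, g x c f * riemann (christoffel g) x f e d b := fun c d b => by
    rw [← inv_mul_metric_mul hg hx a fun e => riemann (christoffel g) x e c d b,
      ← Finset.sum_neg_distrib]
    exact Finset.sum_congr rfl fun e _ => by rw [riemann_antisymm_left hU hg hx]; ring
  have h3 : ∀ e, ricci g x e d = -∑ b, ∑ c, inv g x b c * ∑ f, g x c f *
      riemann (christoffel g) x f e d b := fun e => by
    rw [← neg_neg (ricci g x e d), ← ricci_trace]
    exact congrArg _ (Finset.sum_congr rfl fun b _ =>
      (inv_mul_metric_mul hg hx b fun f => riemann (christoffel g) x f e d b).symm)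
  simp only [h1, h3]
  generalize hS : (fun c e b => ∑ f, g x c f * riemann (christoffel g) x f e d b) = S
  have hS' : ∀ c e b, ∑ f, g x c f * riemann (christoffel g) x f e d b = S c e b :=
    fun c e b => by rw [← hS]
  simp only [hS']
  simp only [Fin.sum_univ_four]
  ring

/-- The curvature of `Γ` in terms of the Levi-Civita curvature and the distortion. -/
theorem riemann_eq (hU : IsOpen U) (hg : IsLorentzMetricOn U g)
    (hΓ : IsSymmetricTeleparallelOn U Γ) (hx : x ∈ U) (a b c d : Fin 4) :
    riemann Γ x a b c d = riemann (christoffel g) x a b c d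
      + covConn g (distortion g Γ) x a d b c - covConn g (distortion g Γ) x a c b d
      + ∑ e, (distortion g Γ x a c e * distortion g Γ x e d b
        - distortion g Γ x a d e * distortion g Γ x e c b) := by
  have hC : ∀ i j k, DifferentiableAt ℝ (fun y => christoffel g y i j k) x := fun i j k =>
    differentiableAt_of_smoothOn hU (christoffel_smoothOn hU hg i j k) hx
  have hG : ∀ i j k, DifferentiableAt ℝ (fun y => Γ y i j k) x := fun i j k =>
    differentiableAt_of_smoothOn hU (hΓ.smooth i j k) hx
  have hCs := christoffel_symm hU hg hx
  unfold riemann covConn distortion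
  simp only [pd_sub (hG _ _ _) (hC _ _ _)]
  generalize christoffel g x = C at *
  simp only [Fin.sum_univ_four]
  -- The two covariant derivatives each contain a Christoffel term in the pair c, d; these cancel
  -- since C is symmetric.
  rw [hCs 0 d c, hCs 1 d c, hCs 2 d c, hCs 3 d c]
  ring

/-- The contracted flatness condition: `𝒟_a (k^a - κ^a) = -ℚ` in vacuum. -/
theorem div_eq_neg_quadQ (hU : IsOpen U) (hg : IsLorentzMetricOn U g)
    (hΓ : IsSymmetricTeleparallelOn U Γ) (hx : x ∈ U) (hvac : IsVacuumOn U g) :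
    ∑ a, ∑ b, ∑ c, inv g x b c * covConn g (distortion g Γ) x a b c a
      - ∑ a, ∑ d, inv g x a d * ∑ b, covConn g (distortion g Γ) x b b d a = -quadQ g Γ x := by
  have h1 : ∀ b d, ∑ a, covConn g (distortion g Γ) x a d b a
      - ∑ a, covConn g (distortion g Γ) x a a b d
      + (∑ e, distTrace g Γ x e * distortion g Γ x e d b
        - ∑ a, ∑ e, distortion g Γ x a d e * distortion g Γ x e a b) = 0 := by
    intro b d
    have h2 : ∑ a, riemann Γ x a b a d = 0 := Finset.sum_eq_zero fun a _ => hΓ.flat x hx _ _ _ _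
    have h3 : ∑ a, riemann (christoffel g) x a b a d = 0 := hvac x hx b d
    simp only [riemann_eq hU hg hΓ hx, Finset.sum_add_distrib, Finset.sum_sub_distrib, h3] at h2
    rw [← h2]
    have h4 : ∑ a, ∑ e, distortion g Γ x a a e * distortion g Γ x e d b
        = ∑ e, distTrace g Γ x e * distortion g Γ x e d b := by
      rw [Finset.sum_comm]
      exact Finset.sum_congr rfl fun e _ => by rw [distTrace, Finset.sum_mul]
    rw [h4]; ring
  -- The traced flatness condition, contracted once more with the inverse metric: the derivative
  -- terms become 𝒟_a A^a and the quadratic ones become ℚ.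
  have h5 : ∑ b, ∑ d, inv g x b d * (∑ a, covConn g (distortion g Γ) x a d b a
      - ∑ a, covConn g (distortion g Γ) x a a b d
      + (∑ e, distTrace g Γ x e * distortion g Γ x e d b
        - ∑ a, ∑ e, distortion g Γ x a d e * distortion g Γ x e a b)) = 0 := by
    simp only [h1, mul_zero, Finset.sum_const_zero]
  rw [quadQ_eq_distortion hU hg hΓ hx]
  simp only [mul_add, mul_sub, Finset.sum_add_distrib, Finset.sum_sub_distrib] at h5
  have hsw : ∀ f : Fin 4 → Fin 4 → ℝ,
      ∑ b, ∑ d, inv g x b d * f b d = ∑ b, ∑ d, inv g x d b * f b d := fun f =>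
    Finset.sum_congr rfl fun b _ => Finset.sum_congr rfl fun d _ => by rw [inv_symm hg hx]
  have e1 : ∑ b, ∑ d, inv g x b d * ∑ e, distTrace g Γ x e * distortion g Γ x e d b
      = ∑ a, distTrace g Γ x a * distContr g Γ x a := by
    rw [hsw fun b d => ∑ e, distTrace g Γ x e * distortion g Γ x e d b]
    unfold distContr
    simp only [Fin.sum_univ_four]
    ring
  have e2 : ∑ b, ∑ d, inv g x b d * ∑ a, covConn g (distortion g Γ) x a d b a
      = ∑ a, ∑ b, ∑ c, inv g x b c * covConn g (distortion g Γ) x a b c a := by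
    rw [hsw fun b d => ∑ a, covConn g (distortion g Γ) x a d b a]
    simp only [Fin.sum_univ_four]
    ring
  have e3 : ∑ b, ∑ d, inv g x b d * ∑ a, covConn g (distortion g Γ) x a a b d
      = ∑ a, ∑ d, inv g x a d * ∑ b, covConn g (distortion g Γ) x b b d a := by
    rw [Finset.sum_comm]
    exact Finset.sum_congr rfl fun b _ => Finset.sum_congr rfl fun d _ => by rw [inv_symm hg hx]
  rw [e1, e2, e3] at h5
  linarith

end Curvature

/-! ### The Noether identity -/

section NoetherIdentity

variable {U : Set Spacetime} {x : Spacetime} {g : MetricField} {Γ : ConnField} {V : VField}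

theorem smoothOn_apply (hV : ContDiffOn ℝ ∞ V U) (a : Fin 4) :
    ContDiffOn ℝ ∞ (fun y => V y a) U :=
  contDiffOn_pi.1 hV a

theorem covVec_smoothOn (hU : IsOpen U) (hg : IsLorentzMetricOn U g) (hV : ContDiffOn ℝ ∞ V U)
    (a b : Fin 4) : ContDiffOn ℝ ∞ (fun y => covVec g V y a b) U :=
  (pd_smoothOn hU (smoothOn_apply hV b) a).add
    (ContDiffOn.sum fun _ _ => (christoffel_smoothOn hU hg _ _ _).mul (smoothOn_apply hV _))

theorem lieMetric_eq (hU : IsOpen U) (hg : IsLorentzMetricOn U g) (hx : x ∈ U) (b c : Fin 4) :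
    lieMetric V g x b c = ∑ d, (covVec g V x b d * g x d c + covVec g V x c d * g x b d) := by
  unfold lieMetric covVec
  simp only [Matrix.of_apply, pd_metric hU hg hx]
  have hCs := christoffel_symm hU hg hx
  generalize christoffel g x = C at *
  have h : ∀ e d, C e d b = C e b d := fun e d => hCs e d b
  have h' : ∀ e d, C e d c = C e c d := fun e d => hCs e d c
  simp only [h, h', Fin.sum_univ_four]
  ring

/-- Split Γ = C + K. The Lie derivative of C is 𝒟_b 𝒟_c V^a plus curvature applied to V. That of the
tensor K may be written with 𝒟 in place of ∂, since C has no torsion. -/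
theorem lieConn_eq (hU : IsOpen U) (hg : IsLorentzMetricOn U g)
    (hΓ : IsSymmetricTeleparallelOn U Γ) (hx : x ∈ U) (hV : ContDiffOn ℝ ∞ V U) (a b c : Fin 4) :
    lieConn V Γ x a b c = covMixed g (covVec g V) x b c a
      + ∑ d, riemann (christoffel g) x a c d b * V x d
      + ∑ d, (V x d * covConn g (distortion g Γ) x a b c d
        - covVec g V x d a * distortion g Γ x d b c
        + covVec g V x b d * distortion g Γ x a d c
        + covVec g V x c d * distortion g Γ x a b d) := by
  have hC : ∀ i j k, DifferentiableAt ℝ (fun y => christoffel g y i j k) x := fun i j k =>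
    differentiableAt_of_smoothOn hU (christoffel_smoothOn hU hg i j k) hx
  have hG : ∀ i j k, DifferentiableAt ℝ (fun y => Γ y i j k) x := fun i j k =>
    differentiableAt_of_smoothOn hU (hΓ.smooth i j k) hx
  have hV' : ∀ i, DifferentiableAt ℝ (fun y => V y i) x := fun i =>
    differentiableAt_of_smoothOn hU (smoothOn_apply hV i) hx
  have hdV : DifferentiableAt ℝ (pd c fun y => V y a) x :=
    differentiableAt_of_smoothOn hU (pd_smoothOn hU (smoothOn_apply hV a) c) hx
  have h1 : pd b (fun y => covVec g V y c a) x = pd b (pd c fun y => V y a) x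
      + ∑ d, (pd b (fun y => christoffel g y a c d) x * V x d
        + christoffel g x a c d * pd b (fun y => V y d) x) := by
    unfold covVec
    rw [pd_add hdV (DifferentiableAt.fun_sum fun d _ => (hC a c d).fun_mul (hV' d)),
      pd_sum fun d _ => (hC a c d).fun_mul (hV' d)]
    congr 1
    exact Finset.sum_congr rfl fun d _ => pd_mul (hC a c d) (hV' d) b
  have h2 : ∀ d, pd b (fun y => christoffel g y a d c) x = pd b (fun y => christoffel g y a c d) x :=
    fun d => pd_congr hU hx (fun y hy => christoffel_symm hU hg hy a d c) b
  have hCs := christoffel_symm hU hg hx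
  unfold lieConn riemann covMixed covConn distortion
  rw [h1]
  simp only [pd_sub (hG _ _ _) (hC _ _ _)]
  unfold covVec
  simp only [h2]
  have h3 : ∀ e d, christoffel g x e d c = christoffel g x e c d := fun e d => hCs e d c
  have h4 : ∀ e d, christoffel g x e d b = christoffel g x e b d := fun e d => hCs e d b
  generalize hdC : (fun a b d => pd d (fun y => christoffel g y a b c) x) = dC
  have hdC' : ∀ a b d, pd d (fun y => christoffel g y a b c) x = dC a b d := fun a b d => by
    rw [← hdC]
  simp only [hdC']
  generalize pd b (pd c fun y => V y a) x = ddV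
  generalize hdV : (fun d b => pd d (fun y => V y b) x) = dV
  have hdV' : ∀ d b, pd d (fun y => V y b) x = dV d b := fun d b => by rw [← hdV]
  simp only [hdV']
  generalize christoffel g x = C at *
  generalize Γ x = G at *
  simp only [Fin.sum_univ_four, h3 _ 0, h3 _ 1, h3 _ 2, h3 _ 3, h4 _ 0, h4 _ 1, h4 _ 2, h4 _ 3,
    hCs _ 1 0, hCs _ 2 0, hCs _ 3 0, hCs _ 2 1, hCs _ 3 1, hCs _ 3 2]
  ring

/-- The first trace in Θ. Here the curvature term is V contracted with −Ric, which is zero in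
vacuum, and the upper-index and matching lower-index terms of ℒ_V K cancel. -/
theorem sum_lieConn_trace (hU : IsOpen U) (hg : IsLorentzMetricOn U g)
    (hΓ : IsSymmetricTeleparallelOn U Γ) (hx : x ∈ U) (hvac : IsVacuumOn U g)
    (hV : ContDiffOn ℝ ∞ V U) (c : Fin 4) :
    ∑ b, lieConn V Γ x b b c = ∑ b, covMixed g (covVec g V) x b c b
      + ∑ d, V x d * ∑ b, covConn g (distortion g Γ) x b b c d
      + ∑ d, covVec g V x c d * distTrace g Γ x d := by
  have h : ∑ b, ∑ d, riemann (christoffel g) x b c d b * V x d = 0 := by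
    rw [Finset.sum_comm]
    refine Finset.sum_eq_zero fun d _ => ?_
    rw [← Finset.sum_mul, ricci_trace, hvac x hx, neg_zero, zero_mul]
  simp only [lieConn_eq hU hg hΓ hx hV]
  rw [Finset.sum_add_distrib, Finset.sum_add_distrib, h, add_zero, add_assoc]
  congr 1
  unfold distTrace
  generalize covConn g (distortion g Γ) x = DK
  generalize distortion g Γ x = K
  generalize covVec g V x = Dv
  simp only [Fin.sum_univ_four]
  ring

/-- The second trace in Θ. The curvature term is again Ricci, by `riemann_contract`. The terms from
the two lower slots of K coincide because g^{bc} is symmetric, hence the factor 2. -/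
theorem sum_lieConn_contract (hU : IsOpen U) (hg : IsLorentzMetricOn U g)
    (hΓ : IsSymmetricTeleparallelOn U Γ) (hx : x ∈ U) (hvac : IsVacuumOn U g)
    (hV : ContDiffOn ℝ ∞ V U) (a : Fin 4) :
    ∑ b, ∑ c, inv g x b c * lieConn V Γ x a b c
      = ∑ b, ∑ c, inv g x b c * covMixed g (covVec g V) x b c a
      + ∑ d, V x d * ∑ b, ∑ c, inv g x b c * covConn g (distortion g Γ) x a b c d
      - ∑ d, covVec g V x d a * distContr g Γ x d
      + 2 * ∑ b, ∑ c, inv g x b c * ∑ d, covVec g V x b d * distortion g Γ x a c d := by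
  have h : ∑ b, ∑ c, inv g x b c * ∑ d, riemann (christoffel g) x a c d b * V x d = 0 := by
    have h1 : ∀ d, ∑ b, ∑ c, inv g x b c * riemann (christoffel g) x a c d b = 0 := fun d => by
      rw [riemann_contract hU hg hx]
      exact Finset.sum_eq_zero fun e _ => by rw [hvac x hx, mul_zero]
    have h2 : ∑ b, ∑ c, inv g x b c * ∑ d, riemann (christoffel g) x a c d b * V x d
        = ∑ d, (∑ b, ∑ c, inv g x b c * riemann (christoffel g) x a c d b) * V x d := by
      generalize riemann (christoffel g) x = R
      generalize inv g x = G
      simp only [Fin.sum_univ_four]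
      ring
    rw [h2]
    exact Finset.sum_eq_zero fun d _ => by rw [h1, zero_mul]
  have h3 : ∑ b, ∑ c, inv g x b c * ∑ d, covVec g V x c d * distortion g Γ x a b d
      = ∑ b, ∑ c, inv g x b c * ∑ d, covVec g V x b d * distortion g Γ x a c d := by
    rw [Finset.sum_comm]
    exact Finset.sum_congr rfl fun b _ => Finset.sum_congr rfl fun c _ => by rw [inv_symm hg hx]
  have h4 : ∀ b d, distortion g Γ x a b d = distortion g Γ x a d b := fun b d =>
    distortion_symm hU hg hΓ hx a b d
  have h5 : ∀ b c, inv g x b c * lieConn V Γ x a b c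
      = inv g x b c * covMixed g (covVec g V) x b c a
        + inv g x b c * ∑ d, riemann (christoffel g) x a c d b * V x d
        + inv g x b c * ∑ d, (V x d * covConn g (distortion g Γ) x a b c d
          - covVec g V x d a * distortion g Γ x d b c)
        + inv g x b c * ∑ d, covVec g V x b d * distortion g Γ x a c d
        + inv g x b c * ∑ d, covVec g V x c d * distortion g Γ x a b d := by
    intro b c
    rw [lieConn_eq hU hg hΓ hx hV]
    simp only [Finset.sum_add_distrib, h4 _ c]
    ring
  simp only [h5, Finset.sum_add_distrib, h, h3]
  have h6 : ∑ b, ∑ c, inv g x b c * ∑ d, (V x d * covConn g (distortion g Γ) x a b c d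
          - covVec g V x d a * distortion g Γ x d b c)
      = ∑ d, V x d * ∑ b, ∑ c, inv g x b c * covConn g (distortion g Γ) x a b c d
      - ∑ d, covVec g V x d a * distContr g Γ x d := by
    unfold distContr
    generalize covConn g (distortion g Γ) x = DK
    generalize distortion g Γ x = K
    generalize covVec g V x = Dv
    generalize inv g x = G
    simp only [Fin.sum_univ_four]
    ring
  rw [h6]
  ring

/-- The first and third terms on the right are shaped to cancel against the δΓ part of Θ in
`theta_lie_eq`. -/
theorem sum_conjP_lieMetric (hU : IsOpen U) (hg : IsLorentzMetricOn U g)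
    (hΓ : IsSymmetricTeleparallelOn U Γ) (hx : x ∈ U) (a : Fin 4) :
    ∑ b, ∑ c, conjP g Γ x a b c * lieMetric V g x b c
      = -∑ b, ∑ c, inv g x b c * ∑ d, covVec g V x b d * distortion g Γ x a c d
      + (1 / 2) * (distContr g Γ x a - distTraceUp g Γ x a) * ∑ d, covVec g V x d d
      + (1 / 2) * ∑ b, inv g x a b * ∑ d, covVec g V x b d * distTrace g Γ x d
      + (1 / 2) * ∑ b, distTraceUp g Γ x b * covVec g V x b a := by
  -- P is symmetric in its last two indices, so both halves of ℒ_V g contribute equally.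
  have hsymm : ∀ T : Fin 4 → Fin 4 → ℝ, (∀ b c, T b c = T c b) →
      ∑ b, ∑ c, T b c * lieMetric V g x b c
        = 2 * ∑ b, ∑ d, covVec g V x b d * ∑ c, g x d c * T b c := by
    intro T hT
    have e : ∑ b, ∑ c, T b c * ∑ d, covVec g V x c d * g x b d
        = ∑ b, ∑ c, T b c * ∑ d, covVec g V x b d * g x d c := by
      rw [Finset.sum_comm]
      exact Finset.sum_congr rfl fun b _ => Finset.sum_congr rfl fun c _ => by
        rw [hT c b]
        exact congrArg _ (Finset.sum_congr rfl fun d _ => by rw [hg.symm hx c d])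
    simp only [lieMetric_eq hU hg hx, Finset.sum_add_distrib, mul_add, e]
    generalize covVec g V x = Dv
    generalize g x = m
    simp only [Fin.sum_univ_four]
    ring
  rw [hsymm _ fun b c => by
    rw [conjP_eq hU hg hΓ hx, conjP_eq hU hg hΓ hx, distUp_symm hU hg hΓ hx a b c,
      inv_symm hg hx b c]; ring]
  have e1 : ∀ b d, ∑ c, g x d c * conjP g Γ x a b c
      = -(1 / 2) * ∑ c, inv g x b c * distortion g Γ x a c d
        + (1 / 4) * (distContr g Γ x a - distTraceUp g Γ x a) * (if d = b then 1 else 0)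
        + (1 / 4) * (inv g x a b * distTrace g Γ x d
          + (if d = a then 1 else 0) * distTraceUp g Γ x b) := by
    intro b d
    have f1 : ∑ c, g x d c * distUp g Γ x a b c = ∑ c, inv g x b c * distortion g Γ x a c d := by
      rw [← metric_mul_inv_mul hg hx d fun e => ∑ c, inv g x b c * distortion g Γ x a c e]
      refine Finset.sum_congr rfl fun c _ => ?_
      unfold distUp
      simp only [Fin.sum_univ_four]
      ring
    have f2 : ∑ c, g x d c * inv g x b c = if d = b then 1 else 0 := by
      rw [← metric_mul_inv hg hx d b]
      exact Finset.sum_congr rfl fun c _ => by rw [inv_symm hg hx]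
    have f3 : ∑ c, g x d c * inv g x a c = if d = a then 1 else 0 := by
      rw [← metric_mul_inv hg hx d a]
      exact Finset.sum_congr rfl fun c _ => by rw [inv_symm hg hx]
    have f4 : ∑ c, g x d c * distTraceUp g Γ x c = distTrace g Γ x d :=
      metric_mul_inv_mul hg hx d (distTrace g Γ x)
    rw [← f1, ← f2, ← f3, ← f4]
    simp only [conjP_eq hU hg hΓ hx, Fin.sum_univ_four]
    ring
  simp only [e1]
  generalize distortion g Γ x = K
  generalize distTrace g Γ x = κ
  generalize distTraceUp g Γ x = κ'
  generalize distContr g Γ x = k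
  generalize covVec g V x = Dv
  generalize inv g x = G
  have e2 : ∑ b, ∑ d, Dv b d * (-(1 / 2) * ∑ c, G b c * K a c d
        + (1 / 4) * (k a - κ' a) * (if d = b then 1 else 0)
        + (1 / 4) * (G a b * κ d + (if d = a then 1 else 0) * κ' b))
      = -(1 / 2) * ∑ b, ∑ c, G b c * ∑ d, Dv b d * K a c d
        + (1 / 4) * (k a - κ' a) * ∑ b, ∑ d, Dv b d * (if d = b then 1 else 0)
        + (1 / 4) * ∑ b, G a b * ∑ d, Dv b d * κ d
        + (1 / 4) * ∑ b, κ' b * ∑ d, Dv b d * (if d = a then 1 else 0) := by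
    generalize (k a - κ' a) = A
    generalize hδ : (fun d b : Fin 4 => if d = b then (1 : ℝ) else 0) = δ
    have hδ' : ∀ d b : Fin 4, (if d = b then (1 : ℝ) else 0) = δ d b := fun d b => by rw [← hδ]
    simp only [hδ', Fin.sum_univ_four]
    ring
  rw [e2]
  simp only [mul_ite, mul_one, mul_zero, Finset.sum_ite_eq', Finset.mem_univ, if_true]
  ring

/-- `Θ^a(ℒ_V g, ℒ_V Γ) + ½ ℚ V^a` is a divergence in vacuum. -/
theorem theta_lie_eq (hU : IsOpen U) (hg : IsLorentzMetricOn U g)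
    (hΓ : IsSymmetricTeleparallelOn U Γ) (hx : x ∈ U) (hvac : IsVacuumOn U g)
    (hV : ContDiffOn ℝ ∞ V U) (a : Fin 4) :
    theta g Γ (lieMetric V g) (lieConn V Γ) x a
      = (1 / 2) * (∑ b, ∑ d, inv g x b d * covMixed g (covVec g V) x b d a
          - ∑ b, ∑ d, inv g x a d * covMixed g (covVec g V) x b d b)
        + (1 / 2) * (∑ d, V x d * ∑ b, ∑ c, inv g x b c * covConn g (distortion g Γ) x a b c d
          - ∑ d, V x d * ∑ c, inv g x a c * ∑ b, covConn g (distortion g Γ) x b b c d)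
        + (1 / 2) * ((distContr g Γ x a - distTraceUp g Γ x a) * ∑ d, covVec g V x d d
          - ∑ d, covVec g V x d a * (distContr g Γ x d - distTraceUp g Γ x d)) := by
  unfold theta
  rw [sum_conjP_lieMetric hU hg hΓ hx]
  simp only [Finset.sum_add_distrib, Finset.sum_neg_distrib]
  rw [sum_lieConn_contract hU hg hΓ hx hvac hV]
  have e : ∑ b, ∑ c, inv g x a c * lieConn V Γ x b b c
      = ∑ c, inv g x a c * ∑ b, lieConn V Γ x b b c := by
    simp only [Fin.sum_univ_four]
    ring
  rw [e]
  simp only [sum_lieConn_trace hU hg hΓ hx hvac hV]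
  generalize covConn g (distortion g Γ) x = DK
  generalize covMixed g (covVec g V) x = DDv
  generalize distTrace g Γ x = κ
  generalize distTraceUp g Γ x = κ'
  generalize distContr g Γ x = k
  generalize covVec g V x = Dv
  generalize inv g x = G
  have e3 : ∑ c, G a c * (∑ b, DDv b c b + ∑ d, V x d * ∑ b, DK b b c d + ∑ d, Dv c d * κ d)
      = ∑ b, ∑ d, G a d * DDv b d b + ∑ d, V x d * ∑ c, G a c * ∑ b, DK b b c d
        + ∑ b, G a b * ∑ d, Dv b d * κ d := by
    simp only [Fin.sum_univ_four]
    ring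
  have e4 : ∑ d, Dv d a * (k d - κ' d) = ∑ d, Dv d a * k d - ∑ b, κ' b * Dv b a := by
    simp only [mul_sub, Finset.sum_sub_distrib]
    congr 1
    exact Finset.sum_congr rfl fun b _ => mul_comm _ _
  -- The contractions g^{bc} 𝒟_bV^d K^a_{cd} and g^{ab} 𝒟_bV^d κ_d now occur with opposite signs in
  -- the δΓ part and the P part. Apart from derivatives of K, only products of 𝒟V with A survive.
  rw [e3, e4]
  ring

/-- The charge tensor `-𝒟^a V^b + ½ (A^a V^b - A^b V^a)`, with `A^a = Q^a - Q̃^a`. -/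
noncomputable def chargeTensor (g : MetricField) (Γ : ConnField) (V : VField) (x : Spacetime)
    (a b : Fin 4) : ℝ :=
  -gradUp g V x a b
      + ∑ d, (1 / 2) * ((if b = d then 1 else 0) * (trOneUp g Γ x a - trTwoUp g Γ x a)
          - (if a = d then 1 else 0) * (trOneUp g Γ x b - trTwoUp g Γ x b)) * V x d

theorem chargeTensor_eq (hU : IsOpen U) (hg : IsLorentzMetricOn U g)
    (hΓ : IsSymmetricTeleparallelOn U Γ) (hx : x ∈ U) (a b : Fin 4) :
    chargeTensor g Γ V x a b = -(∑ d, inv g x a d * covVec g V x d b)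
      + (1 / 2) * ((distContr g Γ x a - distTraceUp g Γ x a) * V x b
        - V x a * (distContr g Γ x b - distTraceUp g Γ x b)) := by
  unfold chargeTensor gradUp covVec
  simp only [tr_sub_eq hU hg hΓ hx]
  congr 1
  simp only [mul_sub, sub_mul, Finset.sum_sub_distrib, mul_assoc, ite_mul, one_mul, zero_mul,
    mul_ite, mul_zero, Finset.sum_ite_eq, Finset.mem_univ, if_true]
  ring

/-- In vacuum, the Noether current is the divergence of the charge tensor. -/
theorem divergence_chargeTensor (hU : IsOpen U) (hg : IsLorentzMetricOn U g)
    (hΓ : IsSymmetricTeleparallelOn U Γ) (hx : x ∈ U) (hvac : IsVacuumOn U g)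
    (hV : ContDiffOn ℝ ∞ V U) (a : Fin 4) :
    (1 / 2) * ∑ b, pd b (fun y => volDensity g y
        * (chargeTensor g Γ V y a b - chargeTensor g Γ V y b a)) x
      = volDensity g x * (theta g Γ (lieMetric V g) (lieConn V Γ) x a
        + (1 / 2) * quadQ g Γ x * V x a) := by
  let A : Spacetime → Fin 4 → ℝ := fun y a => distContr g Γ y a - distTraceUp g Γ y a
  let X : Spacetime → Fin 4 → Fin 4 → ℝ := fun y a b => ∑ d, inv g y a d * covVec g V y d b
  let Y : Spacetime → Fin 4 → Fin 4 → ℝ := fun y a b => A y a * V y b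
  have hV' : ∀ i, DifferentiableAt ℝ (fun y => V y i) x := fun i =>
    differentiableAt_of_smoothOn hU (smoothOn_apply hV i) hx
  have hDV : ∀ i j, DifferentiableAt ℝ (fun y => covVec g V y i j) x := fun i j =>
    differentiableAt_of_smoothOn hU (covVec_smoothOn hU hg hV i j) hx
  have hG : ∀ i j, DifferentiableAt ℝ (fun y => inv g y i j) x := fun i j =>
    differentiableAt_of_smoothOn hU (inv_smoothOn hg i j) hx
  have hK : ∀ i j k, DifferentiableAt ℝ (fun y => distortion g Γ y i j k) x := fun i j k =>
    differentiableAt_of_smoothOn hU (distortion_smoothOn hU hg hΓ i j k) hx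
  have hk : ∀ i, DifferentiableAt ℝ (fun y => distContr g Γ y i) x := fun i =>
    differentiableAt_of_smoothOn hU (distContr_smoothOn hU hg hΓ i) hx
  have hκ : ∀ i, DifferentiableAt ℝ (fun y => distTraceUp g Γ y i) x := fun i =>
    differentiableAt_of_smoothOn hU (distTraceUp_smoothOn hU hg hΓ i) hx
  have hA : ∀ i, DifferentiableAt ℝ (fun y => A y i) x := fun i => (hk i).fun_sub (hκ i)
  have hX : ∀ i j, DifferentiableAt ℝ (fun y => X y i j) x := fun i j =>
    DifferentiableAt.fun_sum fun d _ => (hG i d).fun_mul (hDV d j)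
  have hY : ∀ i j, DifferentiableAt ℝ (fun y => Y y i j) x := fun i j => (hA i).fun_mul (hV' j)
  have hZ : ∀ i j, DifferentiableAt ℝ (fun y => Y y i j - X y i j) x := fun i j =>
    (hY i j).fun_sub (hX i j)
  have h1 : ∀ b, pd b (fun y => volDensity g y
        * (chargeTensor g Γ V y a b - chargeTensor g Γ V y b a)) x
      = pd b (fun y => volDensity g y * ((Y y a b - X y a b) - (Y y b a - X y b a))) x := fun b =>
    pd_congr hU hx (fun y hy => by
      simp only [chargeTensor_eq hU hg hΓ hy, X, Y, A]
      ring) b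
  simp only [h1]
  rw [sum_pd_volDensity_mul hU hg hx (Y := fun y a b => Y y a b - X y a b) hZ]
  have h2 : ∀ c a b, covUp g (fun y a b => Y y a b - X y a b) x c a b
      = covUp g Y x c a b - covUp g X x c a b := fun c a b => by
    unfold covUp
    rw [pd_sub (hY a b) (hX a b)]
    simp only [Fin.sum_univ_four]
    ring
  have h3 : ∀ c a, covVec g A x c a
      = ∑ b, ∑ d, inv g x b d * covConn g (distortion g Γ) x a b d c
        - ∑ d, inv g x a d * ∑ b, covConn g (distortion g Γ) x b b d c := fun c a => by
    have e : covVec g A x c a = covVec g (distContr g Γ) x c a - covVec g (distTraceUp g Γ) x c a := by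
      unfold covVec
      simp only [A]
      rw [pd_sub (hk a) (hκ a)]
      simp only [Fin.sum_univ_four]
      ring
    rw [e]
    congr 1
    · exact covVec_contract hU hg hx hK c a
    · have := covVec_raise hU hg hx (κ := distTrace g Γ)
        (fun b => DifferentiableAt.fun_sum fun d _ => hK d d b) c a
      refine this.trans (Finset.sum_congr rfl fun d _ => congrArg _ ?_)
      exact covCovec_trace hK c d
  have h4 : ∀ c a b, covUp g X x c a b = ∑ d, inv g x a d * covMixed g (covVec g V) x c d b :=
    fun c a b => covUp_raise hU hg hx hDV c a b
  have h5 : ∀ c a b, covUp g Y x c a b = covVec g A x c a * V x b + A x a * covVec g V x c b :=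
    fun c a b => covUp_mul hA hV' c a b
  -- The place where flatness of Γ supplies the Lagrangian term of the current.
  have h6 : ∑ b, covVec g A x b b = -quadQ g Γ x := by
    simp only [h3, Finset.sum_sub_distrib]
    exact div_eq_neg_quadQ hU hg hΓ hx hvac
  rw [theta_lie_eq hU hg hΓ hx hvac hV]
  have h7 : ∑ d, V x d * ∑ b, ∑ c, inv g x b c * covConn g (distortion g Γ) x a b c d
          - ∑ d, V x d * ∑ c, inv g x a c * ∑ b, covConn g (distortion g Γ) x b b c d
      = ∑ d, V x d * covVec g A x d a := by
    simp only [h3, mul_sub, Finset.sum_sub_distrib]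
  rw [h7]
  -- Leibniz rule for the antisymmetrised product of A and V; the term with div A will turn into ℚV.
  have h8 : ∑ b, (covUp g (fun y a b => Y y a b - X y a b) x b a b
        - covUp g (fun y a b => Y y a b - X y a b) x b b a)
      = ∑ d, V x d * covVec g A x d a + A x a * ∑ d, covVec g V x d d
        - (∑ b, covVec g A x b b) * V x a - ∑ d, covVec g V x d a * A x d
        - ∑ b, covUp g X x b a b + ∑ b, covUp g X x b b a := by
    simp only [h2, h5, Finset.sum_sub_distrib, Finset.sum_add_distrib, Finset.mul_sum,
      Finset.sum_mul, mul_comm (V x _), mul_comm (A x _) (covVec g V x _ a)]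
    ring
  rw [h8, h6]
  simp only [h4]
  ring

end NoetherIdentity

/-! ### Exterior derivatives of dual forms -/

section Forms

variable {U : Set Spacetime} {x : Spacetime} {g : MetricField} {Γ : ConnField} {V : VField}

theorem coordVol_apply (v : Fin 4 → Spacetime) : coordVol v = Matrix.det (Matrix.of v) := rfl

/-- The 2-form `ε_{ab··}` of the coordinate volume form. -/
noncomputable def coordTwo (a b : Fin 4) : Spacetime [⋀^Fin 2]→L[ℝ] ℝ :=
  (coordVol.curryLeft (basisVec a)).curryLeft (basisVec b)

theorem coordTwo_apply (a b : Fin 4) (v : Fin 2 → Spacetime) :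
    coordTwo a b v = coordVol ![basisVec a, basisVec b, v 0, v 1] := by
  simp only [coordTwo, ContinuousAlternatingMap.curryLeft_apply_apply]
  congr 1
  ext i : 1
  fin_cases i <;> rfl

theorem curryLeft_coordVol_apply (u : Spacetime) (v : Fin 3 → Spacetime) :
    coordVol.curryLeft u v = coordVol ![u, v 0, v 1, v 2] := by
  simp only [ContinuousAlternatingMap.curryLeft_apply_apply]
  congr 1
  ext i : 1
  fin_cases i <;> rfl

theorem coordVol_vec (p u v w : Spacetime) : coordVol ![p, u, v, w] =
    p 0 * (u 1 * (v 2 * w 3 - v 3 * w 2) - u 2 * (v 1 * w 3 - v 3 * w 1)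
        + u 3 * (v 1 * w 2 - v 2 * w 1))
      - p 1 * (u 0 * (v 2 * w 3 - v 3 * w 2) - u 2 * (v 0 * w 3 - v 3 * w 0)
        + u 3 * (v 0 * w 2 - v 2 * w 0))
      + p 2 * (u 0 * (v 1 * w 3 - v 3 * w 1) - u 1 * (v 0 * w 3 - v 3 * w 0)
        + u 3 * (v 0 * w 1 - v 1 * w 0))
      - p 3 * (u 0 * (v 1 * w 2 - v 2 * w 1) - u 1 * (v 0 * w 2 - v 2 * w 0)
        + u 2 * (v 0 * w 1 - v 1 * w 0)) := by
  rw [coordVol_apply, Matrix.det_succ_row_zero, Fin.sum_univ_four]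
  simp [Matrix.det_fin_three, Fin.succAbove, Matrix.submatrix_apply]
  ring

/-- A 5-form on a four-dimensional space vanishes: this is l ∧ vol evaluated on p, q, u, v, w. It
turns a differential wedged with a double contraction of vol into single contractions. -/
theorem wedge_coordTwo (l : Fin 4 → ℝ) (p q u v w : Spacetime) :
    (∑ c, u c * l c) * coordVol ![p, q, v, w]
      - (∑ c, v c * l c) * coordVol ![p, q, u, w]
      + (∑ c, w c * l c) * coordVol ![p, q, u, v]
      = (∑ c, q c * l c) * coordVol ![p, u, v, w]
        - (∑ c, p c * l c) * coordVol ![q, u, v, w] := by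
  simp only [coordVol_vec, Fin.sum_univ_four]
  ring

theorem fderiv_eq_sum_pd (f : Spacetime → ℝ) (x v : Spacetime) :
    fderiv ℝ f x v = ∑ c, v c * pd c f x := by
  conv_lhs => rw [pi_eq_sum_univ' v]
  rw [map_sum]
  exact Finset.sum_congr rfl fun c _ => by rw [map_smul, smul_eq_mul]; rfl

theorem sum_basisVec_mul (b : Fin 4) (l : Fin 4 → ℝ) : ∑ c, basisVec b c * l c = l b := by
  simp [basisVec, Pi.single_apply]

theorem dualTwo_eq (g : MetricField) (W : Spacetime → Fin 4 → Fin 4 → ℝ) :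
    dualTwo g W = fun y => ∑ a, ∑ b, ((1 / 2) * (volDensity g y * W y a b)) • coordTwo a b := by
  funext y
  simp only [dualTwo, volForm, coordTwo, Finset.smul_sum, ContinuousAlternatingMap.curryLeft_smul,
    smul_smul, smul_apply, volDensity]
  exact Finset.sum_congr rfl fun a _ => Finset.sum_congr rfl fun b _ => by congr 1; ring

theorem curryLeft_coordVol_eq_sum (A : Spacetime) (v : Fin 3 → Spacetime) :
    coordVol.curryLeft A v = ∑ a, A a * coordVol ![basisVec a, v 0, v 1, v 2] := by
  conv_lhs => rw [pi_eq_sum_univ' A]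
  rw [map_sum, ContinuousAlternatingMap.sum_apply]
  refine Finset.sum_congr rfl fun a _ => ?_
  rw [map_smul, ContinuousAlternatingMap.smul_apply, curryLeft_coordVol_apply, smul_eq_mul]
  rfl

/-- By `wedge_coordTwo`, wedging the differential of each coefficient with its constant 2-form
leaves single contractions of the volume form. Collecting them gives an ordinary divergence, with no
connection, and only the antisymmetric part of `W` matters. -/
theorem extDeriv_dualTwo {W : Spacetime → Fin 4 → Fin 4 → ℝ}
    (hW : ∀ a b, DifferentiableAt ℝ (fun y => volDensity g y * W y a b) x) :
    extDeriv (dualTwo g W) x = coordVol.curryLeft fun a =>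
      (1 / 2) * ∑ b, pd b (fun y => volDensity g y * (W y a b - W y b a)) x := by
  have hf : ∀ a b, DifferentiableAt ℝ (fun y => (1 / 2) * (volDensity g y * W y a b)) x :=
    fun a b => (hW a b).const_mul _
  have hd : DifferentiableAt ℝ (fun y => ∑ a, ∑ b,
      ((1 / 2) * (volDensity g y * W y a b)) • coordTwo a b) x :=
    DifferentiableAt.fun_sum fun a _ => DifferentiableAt.fun_sum fun b _ =>
      (hf a b).smul_const _
  have hfd : ∀ (w : Fin 2 → Spacetime) (u : Spacetime),
      fderiv ℝ (fun y => (∑ a, ∑ b, ((1 / 2) * (volDensity g y * W y a b)) • coordTwo a b) w) x u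
      = ∑ a, ∑ b, (∑ c, u c * pd c (fun y => (1 / 2) * (volDensity g y * W y a b)) x)
          * coordVol ![basisVec a, basisVec b, w 0, w 1] := by
    intro w u
    have e : (fun y => (∑ a, ∑ b, ((1 / 2) * (volDensity g y * W y a b)) • coordTwo a b) w)
        = fun y => ∑ a, ∑ b, ((1 / 2) * (volDensity g y * W y a b)) * coordTwo a b w := by
      funext y
      simp [ContinuousAlternatingMap.sum_apply]
    rw [e, fderiv_fun_sum fun a _ => DifferentiableAt.fun_sum fun b _ => (hf a b).mul_const _]
    rw [sum_apply]
    refine Finset.sum_congr rfl fun a _ => ?_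
    rw [fderiv_fun_sum fun b _ => (hf a b).mul_const _, sum_apply]
    refine Finset.sum_congr rfl fun b _ => ?_
    rw [fderiv_mul_const (hf a b), smul_apply, fderiv_eq_sum_pd, coordTwo_apply, smul_eq_mul,
      mul_comm]
  rw [dualTwo_eq]
  ext v
  rw [extDeriv_apply hd, Fin.sum_univ_three, curryLeft_coordVol_eq_sum]
  simp only [hfd]
  have r0 : (Fin.removeNth 0 v : Fin 2 → Spacetime) = ![v 1, v 2] := by
    ext i : 1; fin_cases i <;> rfl
  have r1 : (Fin.removeNth 1 v : Fin 2 → Spacetime) = ![v 0, v 2] := by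
    ext i : 1; fin_cases i <;> rfl
  have r2 : (Fin.removeNth 2 v : Fin 2 → Spacetime) = ![v 0, v 1] := by
    ext i : 1; fin_cases i <;> rfl
  rw [r0, r1, r2]
  simp only [Matrix.cons_val_zero, Matrix.cons_val_one]
  have key : ∀ a b, (∑ c, v 0 c * pd c (fun y => (1 / 2) * (volDensity g y * W y a b)) x)
          * coordVol ![basisVec a, basisVec b, v 1, v 2]
        - (∑ c, v 1 c * pd c (fun y => (1 / 2) * (volDensity g y * W y a b)) x)
          * coordVol ![basisVec a, basisVec b, v 0, v 2]
        + (∑ c, v 2 c * pd c (fun y => (1 / 2) * (volDensity g y * W y a b)) x)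
          * coordVol ![basisVec a, basisVec b, v 0, v 1]
      = (1 / 2) * pd b (fun y => volDensity g y * W y a b) x
          * coordVol ![basisVec a, v 0, v 1, v 2]
        - (1 / 2) * pd a (fun y => volDensity g y * W y a b) x
          * coordVol ![basisVec b, v 0, v 1, v 2] := fun a b => by
    rw [wedge_coordTwo (fun c => pd c (fun y => (1 / 2) * (volDensity g y * W y a b)) x),
      sum_basisVec_mul, sum_basisVec_mul, pd_const_mul _ (hW a b), pd_const_mul _ (hW a b)]
  have hsub : ∀ a b, pd b (fun y => volDensity g y * (W y a b - W y b a)) x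
      = pd b (fun y => volDensity g y * W y a b) x - pd b (fun y => volDensity g y * W y b a) x :=
    fun a b => by
      simp only [mul_sub]
      exact pd_sub (hW a b) (hW b a) b
  have hlhs := Finset.sum_congr rfl fun a (_ : a ∈ Finset.univ) =>
    Finset.sum_congr rfl fun b (_ : b ∈ Finset.univ) => key a b
  simp only [Finset.sum_add_distrib, Finset.sum_sub_distrib] at hlhs
  simp only [hsub, Finset.sum_sub_distrib]
  have hswap : ∑ a, ∑ b, (1 / 2) * pd a (fun y => volDensity g y * W y a b) x
          * coordVol ![basisVec b, v 0, v 1, v 2]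
      = ∑ a, ∑ b, (1 / 2) * pd b (fun y => volDensity g y * W y b a) x
          * coordVol ![basisVec a, v 0, v 1, v 2] := Finset.sum_comm
  rw [hswap] at hlhs
  simp only [Fin.isValue, Fin.val_zero, pow_zero, one_smul, Fin.val_one, pow_one, neg_smul,
    Fin.val_two, even_two, Even.neg_pow, one_pow]
  rw [← sub_eq_add_neg, hlhs, ← Finset.sum_sub_distrib]
  refine Finset.sum_congr rfl fun a _ => ?_
  rw [← Finset.sum_mul, ← Finset.sum_mul, ← Finset.mul_sum, ← Finset.mul_sum]
  ring

theorem chargeForm_eq (g : MetricField) (Γ : ConnField) (V : VField) :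
    chargeForm g Γ V = dualTwo g (chargeTensor g Γ V) := rfl

/-- Both parts of the current are contractions of one volume form, and −i_V of −½ℚ ε contributes
+½ℚV to the contracted vector. -/
theorem noetherCurrent_eq (g : MetricField) (Γ : ConnField) (V : VField) (x : Spacetime) :
    noetherCurrent g Γ V x = coordVol.curryLeft fun a => volDensity g x
      * (theta g Γ (lieMetric V g) (lieConn V Γ) x a + (1 / 2) * quadQ g Γ x * V x a) := by
  have e : (fun a => volDensity g x
      * (theta g Γ (lieMetric V g) (lieConn V Γ) x a + (1 / 2) * quadQ g Γ x * V x a))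
      = volDensity g x • theta g Γ (lieMetric V g) (lieConn V Γ) x
        + (volDensity g x * ((1 / 2) * quadQ g Γ x)) • V x := by
    funext a
    simp only [Pi.add_apply, Pi.smul_apply, smul_eq_mul]
    ring
  rw [e, map_add, map_smul, map_smul]
  simp only [noetherCurrent, thetaForm, dualVec, interiorProd, lagrangianForm, volForm,
    ContinuousAlternatingMap.curryLeft_smul, smul_apply, smul_smul]
  rw [← volDensity]
  module

theorem chargeTensor_smoothOn (hU : IsOpen U) (hg : IsLorentzMetricOn U g)
    (hΓ : IsSymmetricTeleparallelOn U Γ) (hV : ContDiffOn ℝ ∞ V U) (a b : Fin 4) :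
    ContDiffOn ℝ ∞ (fun y => chargeTensor g Γ V y a b) U := by
  refine ContDiffOn.congr ?_ fun y hy => chargeTensor_eq hU hg hΓ hy a b
  have hA : ∀ a, ContDiffOn ℝ ∞ (fun y => distContr g Γ y a - distTraceUp g Γ y a) U := fun a =>
    (distContr_smoothOn hU hg hΓ a).sub (distTraceUp_smoothOn hU hg hΓ a)
  exact (ContDiffOn.sum fun d _ => (inv_smoothOn hg a d).mul
      (covVec_smoothOn hU hg hV d b)).neg.add (contDiffOn_const.mul
    (((hA a).mul (smoothOn_apply hV b)).sub ((smoothOn_apply hV a).mul (hA b))))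

theorem chargeForm_smoothOn (hU : IsOpen U) (hg : IsLorentzMetricOn U g)
    (hΓ : IsSymmetricTeleparallelOn U Γ) (hV : ContDiffOn ℝ ∞ V U) :
    ContDiffOn ℝ ∞ (chargeForm g Γ V) U := by
  rw [chargeForm_eq, dualTwo_eq]
  exact ContDiffOn.sum fun a _ => ContDiffOn.sum fun b _ => ContDiffOn.smul
    (contDiffOn_const.mul ((volDensity_smoothOn hg).mul (chargeTensor_smoothOn hU hg hΓ hV a b)))
    contDiffOn_const

theorem extDeriv_chargeForm (hU : IsOpen U) (hg : IsLorentzMetricOn U g)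
    (hΓ : IsSymmetricTeleparallelOn U Γ) (hvac : IsVacuumOn U g) (hV : ContDiffOn ℝ ∞ V U)
    (hx : x ∈ U) : extDeriv (chargeForm g Γ V) x = noetherCurrent g Γ V x := by
  rw [chargeForm_eq, noetherCurrent_eq, extDeriv_dualTwo fun a b => differentiableAt_of_smoothOn hU
    ((volDensity_smoothOn hg).mul (chargeTensor_smoothOn hU hg hΓ hV a b)) hx]
  congr 1
  funext a
  exact divergence_chargeTensor hU hg hΓ hx hvac hV a

/-- The charge sees only the 1-jet of the vector field at the point, whence its locality. -/
theorem chargeForm_congr {W : VField} (hx : V x = W x)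
    (hd : ∀ a b, pd a (fun y => V y b) x = pd a (fun y => W y b) x) :
    chargeForm g Γ V x = chargeForm g Γ W x := by
  simp only [chargeForm, dualTwo, gradUp, hx, hd]

theorem chargeForm_isNoetherCharge (hU : IsOpen U) (hg : IsLorentzMetricOn U g)
    (hΓ : IsSymmetricTeleparallelOn U Γ) (hvac : IsVacuumOn U g) :
    IsNoetherCharge U g Γ (chargeForm g Γ) where
  smooth V hV := chargeForm_smoothOn hU hg hΓ hV
  add V W hV hW x hx := by
    have h : ∀ a b, chargeTensor g Γ (V + W) x a b
        = chargeTensor g Γ V x a b + chargeTensor g Γ W x a b := by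
      intro a b
      have hp : ∀ c, pd c (fun y => (V + W) y b) x
          = pd c (fun y => V y b) x + pd c (fun y => W y b) x := fun c =>
        pd_add (differentiableAt_of_smoothOn hU (smoothOn_apply hV b) hx)
          (differentiableAt_of_smoothOn hU (smoothOn_apply hW b) hx) c
      have hc : ∀ d, covVec g (V + W) x d b = covVec g V x d b + covVec g W x d b := fun d => by
        unfold covVec
        rw [hp d]
        simp only [Pi.add_apply, mul_add, Finset.sum_add_distrib]
        ring
      simp only [chargeTensor_eq hU hg hΓ hx, hc, Pi.add_apply, mul_add, Finset.sum_add_distrib]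
      ring
    simp only [chargeForm_eq, dualTwo_eq, h, mul_add, add_smul, Finset.sum_add_distrib]
  smul c V hV x hx := by
    have h : ∀ a b, chargeTensor g Γ (c • V) x a b = c * chargeTensor g Γ V x a b := by
      intro a b
      have hp : ∀ d, pd d (fun y => (c • V) y b) x = c * pd d (fun y => V y b) x := fun d =>
        pd_const_mul c (differentiableAt_of_smoothOn hU (smoothOn_apply hV b) hx) d
      have hc : ∀ d, covVec g (c • V) x d b = c * covVec g V x d b := fun d => by
        unfold covVec
        rw [hp d, mul_add, Finset.mul_sum]
        exact congrArg _ (Finset.sum_congr rfl fun e _ => by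
          simp only [Pi.smul_apply, smul_eq_mul]; ring)
      simp only [chargeTensor_eq hU hg hΓ hx, hc, Pi.smul_apply, smul_eq_mul, mul_left_comm _ c,
        ← Finset.mul_sum]
      ring
    simp only [chargeForm_eq, dualTwo_eq, h, Finset.smul_sum, smul_smul]
    exact Finset.sum_congr rfl fun a _ => Finset.sum_congr rfl fun b _ => by congr 1; ring
  isLocal V W _ _ O hO _ hVW x hx := chargeForm_congr (hVW hx) fun a b =>
    pd_congr hO hx (fun y hy => by rw [hVW hy]) a
  potential V hV x hx := extDeriv_chargeForm hU hg hΓ hvac hV hx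

end Forms

/-! ### Stokes' theorem on spherical shells -/

section Stokes

open intervalIntegral
open MeasureTheory (volume)

variable {U : Set Spacetime}

theorem integral_swap_of_continuous {F : ℝ → ℝ → ℝ} (hF : Continuous (Function.uncurry F))
    (a b c d : ℝ) : ∫ x in a..b, ∫ y in c..d, F x y = ∫ y in c..d, ∫ x in a..b, F x y := by
  apply MeasureTheory.intervalIntegral_intervalIntegral_swap
  refine (hF.continuousOn.integrableOn_compact
    (isCompact_uIcc.prod isCompact_uIcc)).mono_set
      (Set.prod_mono uIoc_subset_uIcc uIoc_subset_uIcc)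

/-- Stokes' theorem in the coordinates `(r, θ, φ)`: the three functions are the components of a
2-form, which vanishes at the poles and is periodic in `φ`. -/
theorem flux_sub_flux {f₀ f₁ f₂ d₀ d₁ d₂ : ℝ → ℝ → ℝ → ℝ} {r₁ r₂ b c : ℝ} (hr : r₁ ≤ r₂)
    (hf₀ : ∀ r ∈ Icc r₁ r₂, Continuous fun p : ℝ × ℝ => f₀ r p.1 p.2)
    (h₀ : ∀ r ∈ Icc r₁ r₂, ∀ θ φ, HasDerivAt (fun r => f₀ r θ φ) (d₀ r θ φ) r)
    (h₁ : ∀ r ∈ Icc r₁ r₂, ∀ θ φ, HasDerivAt (fun θ => f₁ r θ φ) (d₁ r θ φ) θ)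
    (h₂ : ∀ r ∈ Icc r₁ r₂, ∀ θ φ, HasDerivAt (fun φ => f₂ r θ φ) (d₂ r θ φ) φ)
    (hc₀ : ContinuousOn (fun p : ℝ × ℝ × ℝ => d₀ p.1 p.2.1 p.2.2) {p | p.1 ∈ Icc r₁ r₂})
    (hc₁ : ContinuousOn (fun p : ℝ × ℝ × ℝ => d₁ p.1 p.2.1 p.2.2) {p | p.1 ∈ Icc r₁ r₂})
    (hc₂ : ContinuousOn (fun p : ℝ × ℝ × ℝ => d₂ p.1 p.2.1 p.2.2) {p | p.1 ∈ Icc r₁ r₂})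
    (hpole : ∀ r ∈ Icc r₁ r₂, ∀ φ, f₁ r b φ = f₁ r 0 φ)
    (hper : ∀ r ∈ Icc r₁ r₂, ∀ θ, f₂ r θ c = f₂ r θ 0) :
    (∫ θ in (0 : ℝ)..b, ∫ φ in (0 : ℝ)..c, f₀ r₂ θ φ)
      - ∫ θ in (0 : ℝ)..b, ∫ φ in (0 : ℝ)..c, f₀ r₁ θ φ
      = ∫ θ in (0 : ℝ)..b, ∫ φ in (0 : ℝ)..c, ∫ r in r₁..r₂,
          (d₀ r θ φ - d₁ r θ φ + d₂ r θ φ) := by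
  -- Clamping r to the interval makes the derivatives, known to be continuous only on the shell,
  -- continuous everywhere. On the interval the clamp is the identity.
  let k : ℝ → ℝ := fun r => max r₁ (min r r₂)
  have hk : Continuous k := by fun_prop
  have hkm : ∀ r, k r ∈ Icc r₁ r₂ := fun r => ⟨le_max_left _ _, max_le hr (min_le_right _ _)⟩
  have hkr : ∀ r ∈ uIcc r₁ r₂, k r = r := fun r hr' => by
    rw [uIcc_of_le hr] at hr'
    simp only [k, min_eq_left hr'.2, max_eq_right hr'.1]
  have hr₁ : r₁ ∈ Icc r₁ r₂ := left_mem_Icc.2 hr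
  have hr₂ : r₂ ∈ Icc r₁ r₂ := right_mem_Icc.2 hr
  have ext3 : ∀ {D : ℝ → ℝ → ℝ → ℝ},
      ContinuousOn (fun p : ℝ × ℝ × ℝ => D p.1 p.2.1 p.2.2) {p | p.1 ∈ Icc r₁ r₂} →
      Continuous fun p : ℝ × ℝ × ℝ => D (k p.1) p.2.1 p.2.2 := fun hD =>
    hD.comp_continuous (f := fun p : ℝ × ℝ × ℝ => (k p.1, p.2.1, p.2.2)) (by fun_prop)
      fun p => hkm p.1
  have c₀ := ext3 hc₀
  have c₁ := ext3 hc₁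
  have c₂ := ext3 hc₂
  have s₀ : ∀ θ φ, ∫ r in r₁..r₂, d₀ (k r) θ φ = f₀ r₂ θ φ - f₀ r₁ θ φ := fun θ φ => by
    refine integral_eq_sub_of_hasDerivAt (f := fun r => f₀ r θ φ) (f' := fun r => d₀ (k r) θ φ)
      (fun r hr' => ?_) (Continuous.intervalIntegrable (c₀.comp (by fun_prop : Continuous fun r : ℝ => (r, θ, φ))) _ _)
    rw [hkr r hr']
    exact h₀ r (by rwa [uIcc_of_le hr] at hr') θ φ
  have s₁ : ∀ r φ, ∫ θ in (0 : ℝ)..b, d₁ (k r) θ φ = 0 := fun r φ => by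
    rw [integral_eq_sub_of_hasDerivAt (fun θ _ => h₁ (k r) (hkm r) θ φ)
      (Continuous.intervalIntegrable (c₁.comp (by fun_prop : Continuous fun θ : ℝ => (r, θ, φ))) _ _),
      hpole _ (hkm r), sub_self]
  have s₂ : ∀ r θ, ∫ φ in (0 : ℝ)..c, d₂ (k r) θ φ = 0 := fun r θ => by
    rw [integral_eq_sub_of_hasDerivAt (fun φ _ => h₂ (k r) (hkm r) θ φ)
      (Continuous.intervalIntegrable (c₂.comp (by fun_prop : Continuous fun φ : ℝ => (r, θ, φ))) _ _),
      hper _ (hkm r), sub_self]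
  have I : ∀ {D : ℝ → ℝ → ℝ → ℝ}, (Continuous fun p : ℝ × ℝ × ℝ => D p.1 p.2.1 p.2.2) →
      Continuous fun p : ℝ × ℝ => ∫ r in r₁..r₂, D r p.1 p.2 := fun hD => by
    apply continuous_parametric_intervalIntegral_of_continuous'
    exact hD.comp (by fun_prop : Continuous fun q : (ℝ × ℝ) × ℝ => (q.2, q.1.1, q.1.2))
  have J : ∀ {H : ℝ × ℝ → ℝ}, Continuous H → Continuous fun θ => ∫ φ in (0 : ℝ)..c, H (θ, φ) :=
    fun hH => by
      apply continuous_parametric_intervalIntegral_of_continuous'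
      exact hH
  -- Fubini puts the θ integral innermost, where it is a difference of values at the poles.
  have z₁ : ∫ θ in (0 : ℝ)..b, ∫ φ in (0 : ℝ)..c, ∫ r in r₁..r₂, d₁ (k r) θ φ = 0 := by
    rw [integral_swap_of_continuous (F := fun θ φ => ∫ r in r₁..r₂, d₁ (k r) θ φ) (I c₁)]
    have : ∀ φ, ∫ θ in (0 : ℝ)..b, ∫ r in r₁..r₂, d₁ (k r) θ φ = 0 := fun φ => by
      rw [integral_swap_of_continuous (F := fun θ r => d₁ (k r) θ φ)
        (c₁.comp (by fun_prop : Continuous fun q : ℝ × ℝ => (q.2, q.1, φ)))]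
      simp only [s₁, integral_zero]
    simp only [this, integral_zero]
  have z₂ : ∀ θ, ∫ φ in (0 : ℝ)..c, ∫ r in r₁..r₂, d₂ (k r) θ φ = 0 := fun θ => by
    rw [integral_swap_of_continuous (F := fun φ r => d₂ (k r) θ φ)
      (c₂.comp (by fun_prop : Continuous fun q : ℝ × ℝ => (q.2, θ, q.1)))]
    simp only [s₂, integral_zero]
  have e : ∀ θ φ, ∫ r in r₁..r₂, (d₀ r θ φ - d₁ r θ φ + d₂ r θ φ)
      = (f₀ r₂ θ φ - f₀ r₁ θ φ) - (∫ r in r₁..r₂, d₁ (k r) θ φ)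
        + ∫ r in r₁..r₂, d₂ (k r) θ φ := fun θ φ => by
    have i : ∀ {D : ℝ → ℝ → ℝ → ℝ}, (Continuous fun p : ℝ × ℝ × ℝ => D p.1 p.2.1 p.2.2) →
        IntervalIntegrable (fun r => D r θ φ) volume r₁ r₂ := fun hD =>
      Continuous.intervalIntegrable (hD.comp (by fun_prop : Continuous fun r : ℝ => (r, θ, φ))) _ _
    rw [← s₀, ← integral_sub (i c₀) (i c₁), ← integral_add ((i c₀).sub (i c₁)) (i c₂)]
    exact integral_congr fun r hr' => by simp only [hkr r hr']
  simp only [e]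
  have jf : ∀ {H : ℝ × ℝ → ℝ}, Continuous H → ∀ θ,
      IntervalIntegrable (fun φ => H (θ, φ)) volume 0 c := fun hH θ =>
    Continuous.intervalIntegrable (hH.comp (by fun_prop : Continuous fun φ : ℝ => (θ, φ))) _ _
  have jt : ∀ {H : ℝ × ℝ → ℝ}, Continuous H →
      IntervalIntegrable (fun θ => ∫ φ in (0 : ℝ)..c, H (θ, φ)) volume 0 b := fun hH =>
    (J hH).intervalIntegrable _ _
  have g₁ := hf₀ r₁ hr₁
  have g₂ := hf₀ r₂ hr₂
  have e' : ∀ θ, ∫ φ in (0 : ℝ)..c, ((f₀ r₂ θ φ - f₀ r₁ θ φ) - (∫ r in r₁..r₂, d₁ (k r) θ φ)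
        + ∫ r in r₁..r₂, d₂ (k r) θ φ)
      = ((∫ φ in (0 : ℝ)..c, f₀ r₂ θ φ) - ∫ φ in (0 : ℝ)..c, f₀ r₁ θ φ)
        - ∫ φ in (0 : ℝ)..c, ∫ r in r₁..r₂, d₁ (k r) θ φ := fun θ => by
    rw [integral_add (((jf g₂ θ).sub (jf g₁ θ)).sub (jf (I c₁) θ)) (jf (I c₂) θ), z₂, add_zero,
      integral_sub ((jf g₂ θ).sub (jf g₁ θ)) (jf (I c₁) θ), integral_sub (jf g₂ θ) (jf g₁ θ)]
  simp only [e']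
  rw [integral_sub ((jt g₂).sub (jt g₁)) (jt (I c₁)), z₁, sub_zero, integral_sub (jt g₂) (jt g₁)]

end Stokes

/-! ### Spherical coordinates and Stokes' theorem for 2-forms on the slice -/

section SphericalCoordinates

open intervalIntegral

variable {U : Set Spacetime} {t₀ R₀ : ℝ}

/-- The radial coordinate vector of spherical coordinates. -/
noncomputable def sphR (θ φ : ℝ) : Spacetime :=
  ![0, Real.sin θ * Real.cos φ, Real.sin θ * Real.sin φ, Real.cos θ]

/-- The polar coordinate vector of spherical coordinates. -/
noncomputable def sphTheta (r θ φ : ℝ) : Spacetime :=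
  ![0, r * Real.cos θ * Real.cos φ, r * Real.cos θ * Real.sin φ, -(r * Real.sin θ)]

/-- The azimuthal coordinate vector of spherical coordinates. -/
noncomputable def sphPhi (r θ φ : ℝ) : Spacetime :=
  ![0, -(r * Real.sin θ * Real.sin φ), r * Real.sin θ * Real.cos φ, 0]

theorem hasDerivAt_spherePoint_r (t₀ r θ φ : ℝ) :
    HasDerivAt (fun r => spherePoint t₀ r θ φ) (sphR θ φ) r := by
  rw [hasDerivAt_pi]
  intro i
  fin_cases i
  · exact hasDerivAt_const _ _
  · simpa [spherePoint, sphR, mul_assoc] using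
      (hasDerivAt_id r).mul_const (Real.sin θ * Real.cos φ)
  · simpa [spherePoint, sphR, mul_assoc] using
      (hasDerivAt_id r).mul_const (Real.sin θ * Real.sin φ)
  · simpa [spherePoint, sphR] using (hasDerivAt_id r).mul_const (Real.cos θ)

theorem hasDerivAt_spherePoint_theta (t₀ r θ φ : ℝ) :
    HasDerivAt (fun θ => spherePoint t₀ r θ φ) (sphTheta r θ φ) θ := by
  rw [hasDerivAt_pi]
  intro i
  fin_cases i
  · exact hasDerivAt_const _ _
  · simpa [spherePoint, sphTheta] using
      ((Real.hasDerivAt_sin θ).const_mul r).mul_const (Real.cos φ)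
  · simpa [spherePoint, sphTheta] using
      ((Real.hasDerivAt_sin θ).const_mul r).mul_const (Real.sin φ)
  · simpa [spherePoint, sphTheta] using (Real.hasDerivAt_cos θ).const_mul r

theorem hasDerivAt_spherePoint_phi (t₀ r θ φ : ℝ) :
    HasDerivAt (fun φ => spherePoint t₀ r θ φ) (sphPhi r θ φ) φ := by
  rw [hasDerivAt_pi]
  intro i
  fin_cases i
  · exact hasDerivAt_const _ _
  · simpa [spherePoint, sphPhi] using (Real.hasDerivAt_cos φ).const_mul (r * Real.sin θ)
  · simpa [spherePoint, sphPhi] using (Real.hasDerivAt_sin φ).const_mul (r * Real.sin θ)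
  · exact hasDerivAt_const _ _

theorem sphereFlux_eq (t₀ r : ℝ) (α : Form 2) : sphereFlux t₀ r α =
    ∫ θ in (0 : ℝ)..Real.pi, ∫ φ in (0 : ℝ)..(2 * Real.pi),
      α (spherePoint t₀ r θ φ) ![sphTheta r θ φ, sphPhi r θ φ] := by
  simp only [sphereFlux, (hasDerivAt_spherePoint_theta _ _ _ _).deriv,
    (hasDerivAt_spherePoint_phi _ _ _ _).deriv]

theorem radius_spherePoint (t₀ θ φ : ℝ) {r : ℝ} (hr : 0 ≤ r) :
    radius (spherePoint t₀ r θ φ) = r := by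
  have : (spherePoint t₀ r θ φ) 1 ^ 2 + (spherePoint t₀ r θ φ) 2 ^ 2
      + (spherePoint t₀ r θ φ) 3 ^ 2 = r ^ 2 := by
    simp only [spherePoint, Matrix.cons_val]
    linear_combination (r ^ 2 * Real.sin θ ^ 2) * Real.sin_sq_add_cos_sq φ
      + r ^ 2 * Real.sin_sq_add_cos_sq θ
  rw [radius, this, Real.sqrt_sq hr]

/-- Spherical coordinates on the slice. -/
noncomputable def sphCoord (t₀ : ℝ) (p : Fin 3 → ℝ) : Spacetime := spherePoint t₀ (p 0) (p 1) (p 2)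

theorem contDiff_sphCoord (t₀ : ℝ) : ContDiff ℝ ∞ (sphCoord t₀) := by
  rw [contDiff_pi]
  intro i
  fin_cases i <;> simp [sphCoord, spherePoint] <;> fun_prop

theorem hasDerivAt_line_zero (r θ φ : ℝ) :
    HasDerivAt (fun r => (![r, θ, φ] : Fin 3 → ℝ)) ![1, 0, 0] r := by
  rw [hasDerivAt_pi]
  intro i
  fin_cases i
  · exact hasDerivAt_id _
  · exact hasDerivAt_const _ _
  · exact hasDerivAt_const _ _

theorem hasDerivAt_line_one (r θ φ : ℝ) :
    HasDerivAt (fun θ => (![r, θ, φ] : Fin 3 → ℝ)) ![0, 1, 0] θ := by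
  rw [hasDerivAt_pi]
  intro i
  fin_cases i
  · exact hasDerivAt_const _ _
  · exact hasDerivAt_id _
  · exact hasDerivAt_const _ _

theorem hasDerivAt_line_two (r θ φ : ℝ) :
    HasDerivAt (fun φ => (![r, θ, φ] : Fin 3 → ℝ)) ![0, 0, 1] φ := by
  rw [hasDerivAt_pi]
  intro i
  fin_cases i
  · exact hasDerivAt_const _ _
  · exact hasDerivAt_const _ _
  · exact hasDerivAt_id _

theorem fderiv_sphCoord (t₀ r θ φ : ℝ) :
    fderiv ℝ (sphCoord t₀) ![r, θ, φ] ![1, 0, 0] = sphR θ φ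
      ∧ fderiv ℝ (sphCoord t₀) ![r, θ, φ] ![0, 1, 0] = sphTheta r θ φ
      ∧ fderiv ℝ (sphCoord t₀) ![r, θ, φ] ![0, 0, 1] = sphPhi r θ φ := by
  have hd : HasFDerivAt (sphCoord t₀) (fderiv ℝ (sphCoord t₀) ![r, θ, φ]) ![r, θ, φ] :=
    ((contDiff_sphCoord t₀).differentiable (by simp) _).hasFDerivAt
  refine ⟨?_, ?_, ?_⟩
  · exact (HasFDerivAt.comp_hasDerivAt (f := fun r => (![r, θ, φ] : Fin 3 → ℝ)) r hd
      (hasDerivAt_line_zero r θ φ)).unique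
      (hasDerivAt_spherePoint_r t₀ r θ φ)
  · exact (HasFDerivAt.comp_hasDerivAt (f := fun θ => (![r, θ, φ] : Fin 3 → ℝ)) θ hd
      (hasDerivAt_line_one r θ φ)).unique
      (hasDerivAt_spherePoint_theta t₀ r θ φ)
  · exact (HasFDerivAt.comp_hasDerivAt (f := fun φ => (![r, θ, φ] : Fin 3 → ℝ)) φ hd
      (hasDerivAt_line_two r θ φ)).unique
      (hasDerivAt_spherePoint_phi t₀ r θ φ)

/-- Bilinearity, peeled off one slot at a time. It reduces smoothness of a pullback to smoothness of
scalar components. -/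
theorem twoForm_apply (α : Spacetime [⋀^Fin 2]→L[ℝ] ℝ) (u v : Spacetime) :
    α ![u, v] = ∑ i, ∑ j, u i * v j * α ![basisVec i, basisVec j] := by
  have e : ∀ u v : Spacetime, α ![u, v] = ((α.curryLeft u).curryLeft v) ![] := fun u v => rfl
  have e2 : ∀ u, α.curryLeft u = ∑ i, u i • α.curryLeft (basisVec i) := fun u => by
    conv_lhs => rw [pi_eq_sum_univ' u]
    rw [map_sum]
    exact Finset.sum_congr rfl fun i _ => map_smul _ _ _
  have e3 : ∀ (β : Spacetime [⋀^Fin 1]→L[ℝ] ℝ) (v : Spacetime),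
      β.curryLeft v = ∑ i, v i • β.curryLeft (basisVec i) := fun β v => by
    conv_lhs => rw [pi_eq_sum_univ' v]
    rw [map_sum]
    exact Finset.sum_congr rfl fun i _ => map_smul _ _ _
  have e4 : ∀ (v : Fin 1 → Spacetime), (α.curryLeft u) v
      = ∑ i, u i * (α.curryLeft (basisVec i)) v := fun v => by
    rw [e2 u, ContinuousAlternatingMap.sum_apply]
    rfl
  have e5 : ∀ (β : Spacetime [⋀^Fin 1]→L[ℝ] ℝ) (v : Spacetime),
      β ![v] = ∑ i, v i * β ![basisVec i] := fun β v => by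
    change (β.curryLeft v) ![] = _
    rw [e3 β v, ContinuousAlternatingMap.sum_apply]
    rfl
  change (α.curryLeft u) ![v] = _
  rw [e4]
  refine Finset.sum_congr rfl fun i _ => ?_
  rw [e5, Finset.mul_sum]
  exact Finset.sum_congr rfl fun j _ => by rw [mul_assoc]; rfl

theorem sphCoord_mem (hR₀ : 0 < R₀) (hend : ∀ x : Spacetime, x 0 = t₀ → R₀ < radius x → x ∈ U)
    {r : ℝ} (hr : R₀ < r) (θ φ : ℝ) : spherePoint t₀ r θ φ ∈ U :=
  hend _ rfl (by rwa [radius_spherePoint _ _ _ (hR₀.trans hr).le])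

theorem pullback_smoothOn (hR₀ : 0 < R₀)
    (hend : ∀ x : Spacetime, x 0 = t₀ → R₀ < radius x → x ∈ U) {α : Form 2}
    (hα : ContDiffOn ℝ ∞ α U) (u v : Fin 3 → ℝ) :
    ContDiffOn ℝ ∞ (fun p => α (sphCoord t₀ p)
      ![fderiv ℝ (sphCoord t₀) p u, fderiv ℝ (sphCoord t₀) p v]) {p | R₀ < p 0} := by
  refine ContDiffOn.congr ?_ fun p _ => twoForm_apply (α (sphCoord t₀ p)) _ _
  have hmaps : MapsTo (sphCoord t₀) {p | R₀ < p 0} U := fun p hp => sphCoord_mem hR₀ hend hp _ _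
  have hΦ : ∀ (w : Fin 3 → ℝ) (i : Fin 4),
      ContDiffOn ℝ ∞ (fun p => fderiv ℝ (sphCoord t₀) p w i) {p | R₀ < p 0} := fun w i =>
    (contDiff_pi.1 (((contDiff_sphCoord t₀).fderiv_right (m := ∞) (by simp)).clm_apply
      contDiff_const) i).contDiffOn
  refine ContDiffOn.sum fun i _ => ContDiffOn.sum fun j _ => ((hΦ u i).mul (hΦ v j)).mul ?_
  exact ((ContinuousAlternatingMap.apply ℝ Spacetime ℝ ![basisVec i, basisVec j]).contDiff.comp_contDiffOn
    (hα.comp (contDiff_sphCoord t₀).contDiffOn hmaps))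

/-- Stokes' theorem for a 2-form on the shell between two coordinate spheres. -/
theorem sphereFlux_sub (hU : IsOpen U) (hR₀ : 0 < R₀)
    (hend : ∀ x : Spacetime, x 0 = t₀ → R₀ < radius x → x ∈ U) {α : Form 2}
    (hα : ContDiffOn ℝ ∞ α U) {r₁ r₂ : ℝ} (h₁ : R₀ < r₁) (h₁₂ : r₁ ≤ r₂) :
    sphereFlux t₀ r₂ α - sphereFlux t₀ r₁ α
      = ∫ θ in (0 : ℝ)..Real.pi, ∫ φ in (0 : ℝ)..(2 * Real.pi), ∫ r in r₁..r₂,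
          extDeriv α (spherePoint t₀ r θ φ) ![sphR θ φ, sphTheta r θ φ, sphPhi r θ φ] := by
  let O : Set (Fin 3 → ℝ) := {p | R₀ < p 0}
  have hO : IsOpen O := isOpen_lt continuous_const (continuous_apply 0)
  let F : (Fin 3 → ℝ) → (Fin 3 → ℝ) → (Fin 3 → ℝ) → ℝ := fun u v p => α (sphCoord t₀ p)
      ![fderiv ℝ (sphCoord t₀) p u, fderiv ℝ (sphCoord t₀) p v]
  have hF : ∀ u v, ContDiffOn ℝ ∞ (F u v) O := pullback_smoothOn hR₀ hend hα
  let e₀ : Fin 3 → ℝ := ![1, 0, 0]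
  let e₁ : Fin 3 → ℝ := ![0, 1, 0]
  let e₂ : Fin 3 → ℝ := ![0, 0, 1]
  have hmem : ∀ r ∈ Icc r₁ r₂, ∀ θ φ : ℝ, (![r, θ, φ] : Fin 3 → ℝ) ∈ O := fun r hr θ φ =>
    h₁.trans_le hr.1
  have hFd : ∀ u v, ∀ r ∈ Icc r₁ r₂, ∀ θ φ : ℝ,
      HasFDerivAt (F u v) (fderiv ℝ (F u v) ![r, θ, φ]) ![r, θ, φ] := fun u v r hr θ φ =>
    (((hF u v).contDiffAt (hO.mem_nhds (hmem r hr θ φ))).differentiableAt (by simp)).hasFDerivAt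
  have hline : Continuous fun p : ℝ × ℝ × ℝ => (![p.1, p.2.1, p.2.2] : Fin 3 → ℝ) := by
    refine continuous_pi fun i => ?_
    fin_cases i <;> simp <;> fun_prop
  have hFc : ∀ u v w, ContinuousOn (fun p : ℝ × ℝ × ℝ => fderiv ℝ (F u v) ![p.1, p.2.1, p.2.2] w)
      {p | p.1 ∈ Icc r₁ r₂} := fun u v w =>
    ((((hF u v).fderiv_of_isOpen (m := ∞) hO (by simp)).clm_apply contDiffOn_const).continuousOn).comp
      hline.continuousOn fun p hp => hmem _ hp _ _
  have hsin : Real.sin (2 * Real.pi) = 0 := Real.sin_two_pi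
  have key := flux_sub_flux (f₀ := fun r θ φ => F e₁ e₂ ![r, θ, φ])
    (f₁ := fun r θ φ => F e₀ e₂ ![r, θ, φ]) (f₂ := fun r θ φ => F e₀ e₁ ![r, θ, φ])
    (d₀ := fun r θ φ => fderiv ℝ (F e₁ e₂) ![r, θ, φ] e₀)
    (d₁ := fun r θ φ => fderiv ℝ (F e₀ e₂) ![r, θ, φ] e₁)
    (d₂ := fun r θ φ => fderiv ℝ (F e₀ e₁) ![r, θ, φ] e₂)
    (b := Real.pi) (c := 2 * Real.pi) h₁₂
    (fun r hr => (hF e₁ e₂).continuousOn.comp_continuous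
      (f := fun p : ℝ × ℝ => (![r, p.1, p.2] : Fin 3 → ℝ))
      (hline.comp (by fun_prop : Continuous fun p : ℝ × ℝ => (r, p.1, p.2))) fun p => hmem r hr _ _)
    (fun r hr θ φ => HasFDerivAt.comp_hasDerivAt (f := fun r => (![r, θ, φ] : Fin 3 → ℝ)) r
      (hFd e₁ e₂ r hr θ φ) (hasDerivAt_line_zero r θ φ))
    (fun r hr θ φ => HasFDerivAt.comp_hasDerivAt (f := fun θ => (![r, θ, φ] : Fin 3 → ℝ)) θ
      (hFd e₀ e₂ r hr θ φ) (hasDerivAt_line_one r θ φ))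
    (fun r hr θ φ => HasFDerivAt.comp_hasDerivAt (f := fun φ => (![r, θ, φ] : Fin 3 → ℝ)) φ
      (hFd e₀ e₁ r hr θ φ) (hasDerivAt_line_two r θ φ))
    (hFc _ _ _) (hFc _ _ _) (hFc _ _ _)
    (fun r hr φ => by
      -- The azimuthal coordinate vector vanishes on the axis.
      have hz : ∀ θ, Real.sin θ = 0 → F e₀ e₂ ![r, θ, φ] = 0 := fun θ hθ => by
        simp only [F, e₂, (fderiv_sphCoord t₀ r θ φ).2.2]
        refine (α _).map_coord_zero 1 ?_
        ext i
        fin_cases i <;> simp [sphPhi, hθ]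
      rw [hz _ Real.sin_pi, hz _ Real.sin_zero])
    (fun r hr θ => by
      simp only [F, e₀, e₁, (fderiv_sphCoord t₀ r θ _).1, (fderiv_sphCoord t₀ r θ _).2.1]
      simp [sphCoord, spherePoint, sphR, sphTheta])
  have hflux : ∀ r, sphereFlux t₀ r α
      = ∫ θ in (0 : ℝ)..Real.pi, ∫ φ in (0 : ℝ)..(2 * Real.pi), F e₁ e₂ ![r, θ, φ] := fun r => by
    rw [sphereFlux_eq]
    simp only [F, e₁, e₂, (fderiv_sphCoord t₀ r _ _).2.1, (fderiv_sphCoord t₀ r _ _).2.2]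
    rfl
  rw [hflux, hflux, key]
  refine integral_congr fun θ _ => integral_congr fun φ _ => integral_congr fun r hr => ?_
  rw [uIcc_of_le h₁₂] at hr
  let p : Fin 3 → ℝ := ![r, θ, φ]
  have hαp : DifferentiableAt ℝ α (sphCoord t₀ p) :=
    (hα.contDiffAt (hU.mem_nhds (sphCoord_mem hR₀ hend (hmem r hr θ φ) _ _))).differentiableAt (by simp)
  have hΦ : ContDiffAt ℝ ∞ (sphCoord t₀) p := (contDiff_sphCoord t₀).contDiffAt
  -- Naturality of d under pullback. In the flat coordinates (r, θ, φ) the exterior derivative is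
  -- the alternating sum of partial derivatives required by `flux_sub_flux`.
  have hpull := extDeriv_pullback (r := ∞) hαp hΦ (by
    simp only [minSmoothness_of_isRCLikeNormedField]; exact WithTop.coe_le_coe.2 le_top)
  have hω : DifferentiableAt ℝ (fun p => (α (sphCoord t₀ p)).compContinuousLinearMap
      (fderiv ℝ (sphCoord t₀) p)) p :=
    DifferentiableAt.continuousAlternatingMapCompContinuousLinearMap
      (hαp.comp p (hΦ.differentiableAt (by simp)))
      ((hΦ.fderiv_right (m := ∞) (by simp)).differentiableAt (by simp))
  have hap := DFunLike.congr_fun hpull ![e₀, e₁, e₂]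
  rw [extDeriv_apply hω, Fin.sum_univ_three] at hap
  have r0 : (Fin.removeNth 0 ![e₀, e₁, e₂] : Fin 2 → Fin 3 → ℝ) = ![e₁, e₂] := by
    ext i : 1; fin_cases i <;> rfl
  have r1 : (Fin.removeNth 1 ![e₀, e₁, e₂] : Fin 2 → Fin 3 → ℝ) = ![e₀, e₂] := by
    ext i : 1; fin_cases i <;> rfl
  have r2 : (Fin.removeNth 2 ![e₀, e₁, e₂] : Fin 2 → Fin 3 → ℝ) = ![e₀, e₁] := by
    ext i : 1; fin_cases i <;> rfl
  have hc : ∀ u v, (fun y => ((α (sphCoord t₀ y)).compContinuousLinearMap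
      (fderiv ℝ (sphCoord t₀) y)) ![u, v]) = F u v := fun u v => by
    funext y
    rw [ContinuousAlternatingMap.compContinuousLinearMap_apply]
    simp only [F]
    congr 1
    ext i : 1
    fin_cases i <;> rfl
  rw [r0, r1, r2, hc, hc, hc, ContinuousAlternatingMap.compContinuousLinearMap_apply] at hap
  have hv : (fderiv ℝ (sphCoord t₀) p ∘ ![e₀, e₁, e₂])
      = ![sphR θ φ, sphTheta r θ φ, sphPhi r θ φ] := by
    ext i : 1
    obtain ⟨a, b, c⟩ := fderiv_sphCoord t₀ r θ φ
    fin_cases i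
    · exact a
    · exact b
    · exact c
  rw [hv] at hap
  refine Eq.trans ?_ hap
  simp [p]
  ring

end SphericalCoordinates

/-! ### All Noether charges have the same flux -/

section Uniqueness

open intervalIntegral

variable {U : Set Spacetime} {t₀ R₀ : ℝ} {g : MetricField} {Γ : ConnField}

theorem sphereFlux_congr {α β : Form 2} {r : ℝ}
    (h : ∀ θ φ, α (spherePoint t₀ r θ φ) = β (spherePoint t₀ r θ φ)) :
    sphereFlux t₀ r α = sphereFlux t₀ r β := by
  simp only [sphereFlux, h]

theorem spherePoint_normSq (t₀ r θ φ : ℝ) : (spherePoint t₀ r θ φ) 1 ^ 2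
    + (spherePoint t₀ r θ φ) 2 ^ 2 + (spherePoint t₀ r θ φ) 3 ^ 2 = r ^ 2 := by
  simp only [spherePoint, Matrix.cons_val]
  linear_combination (r ^ 2 * Real.sin θ ^ 2) * Real.sin_sq_add_cos_sq φ
    + r ^ 2 * Real.sin_sq_add_cos_sq θ

theorem contDiff_timeTranslation : ContDiff ℝ ∞ timeTranslation := contDiff_const

/-- Noether charges of the same fields have the same flux for the time translation. -/
theorem IsNoetherCharge.sphereFlux_eq (hU : IsOpen U) (hR₀ : 0 < R₀)
    (hend : ∀ x : Spacetime, x 0 = t₀ → R₀ < radius x → x ∈ U) {M N : VField → Form 2}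
    (hM : IsNoetherCharge U g Γ M) (hN : IsNoetherCharge U g Γ N) {r : ℝ} (hr : R₀ < r) :
    sphereFlux t₀ r (M timeTranslation) = sphereFlux t₀ r (N timeTranslation) := by
  have hr0 : 0 < r := hR₀.trans hr
  let s : Spacetime → ℝ := fun x => x 1 ^ 2 + x 2 ^ 2 + x 3 ^ 2
  have hs : ContDiff ℝ ∞ s := by fun_prop
  -- The cutoff varies only between radii r + 1/3 and r + 2/3, so both boundary spheres have
  -- neighbourhoods on which it is constant. It is a function of the squared radius, a polynomial,
  -- which avoids any singularity on the axis.
  let a : ℝ := (r + 1 / 3) ^ 2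
  let b : ℝ := (r + 2 / 3) ^ 2
  have hab : a < b := by simp only [a, b]; nlinarith
  let χ : Spacetime → ℝ := fun x => Real.smoothTransition ((b - s x) / (b - a))
  have hχ : ContDiff ℝ ∞ χ :=
    Real.smoothTransition.contDiff.comp ((contDiff_const.sub hs).div_const _)
  let V : VField := fun x => χ x • timeTranslation x
  have hV : ContDiffOn ℝ ∞ V U := (hχ.smul contDiff_timeTranslation).contDiffOn
  have hT : ContDiffOn ℝ ∞ timeTranslation U := contDiff_timeTranslation.contDiffOn
  let O₁ : Set Spacetime := U ∩ {x | s x < a}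
  let O₂ : Set Spacetime := U ∩ {x | b < s x}
  have hO₁ : IsOpen O₁ := hU.inter (isOpen_lt hs.continuous continuous_const)
  have hO₂ : IsOpen O₂ := hU.inter (isOpen_lt continuous_const hs.continuous)
  have hV₁ : EqOn V timeTranslation O₁ := fun x hx => by
    have hxa : s x < a := hx.2
    have : χ x = 1 := Real.smoothTransition.one_of_one_le
      ((one_le_div (by linarith)).2 (by linarith))
    simp only [V, this, one_smul]
  -- Zero is written as a multiple of t so that homogeneity of the charge gives the vanishing
  -- directly.
  have hV₂ : EqOn V ((0 : ℝ) • timeTranslation) O₂ := fun x hx => by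
    have hxb : b < s x := hx.2
    have : χ x = 0 := Real.smoothTransition.zero_of_nonpos
      (div_nonpos_of_nonpos_of_nonneg (by linarith) (by linarith))
    simp only [V, this, Pi.smul_apply]
  have h0 : ContDiffOn ℝ ∞ ((0 : ℝ) • timeTranslation) U :=
    show ContDiffOn ℝ ∞ (fun y => (0 : ℝ) • timeTranslation y) U from hT.const_smul 0
  -- The right-hand side depends only on the current, so it is common to all charges.
  have key : ∀ {N : VField → Form 2}, IsNoetherCharge U g Γ N →
      sphereFlux t₀ r (N timeTranslation)
        = -∫ θ in (0 : ℝ)..Real.pi, ∫ φ in (0 : ℝ)..(2 * Real.pi), ∫ ρ in r..(r + 1),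
          noetherCurrent g Γ V (spherePoint t₀ ρ θ φ)
            ![sphR θ φ, sphTheta ρ θ φ, sphPhi ρ θ φ] := by
    intro N hN
    have e₁ : sphereFlux t₀ r (N timeTranslation) = sphereFlux t₀ r (N V) :=
      sphereFlux_congr fun θ φ => (hN.isLocal V _ hV hT O₁ hO₁ inter_subset_left hV₁
        ⟨sphCoord_mem hR₀ hend hr θ φ, by
          change s (spherePoint t₀ r θ φ) < a
          simp only [s, spherePoint_normSq, a]; nlinarith⟩).symm
    have e₂ : sphereFlux t₀ (r + 1) (N V) = 0 := by
      have hr' : R₀ < r + 1 := by linarith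
      have : ∀ θ φ, N V (spherePoint t₀ (r + 1) θ φ) = (0 : Form 2) (spherePoint t₀ (r + 1) θ φ) :=
        fun θ φ => by
          have hx := sphCoord_mem (t₀ := t₀) hR₀ hend hr' θ φ
          rw [hN.isLocal V _ hV h0 O₂ hO₂ inter_subset_left hV₂
            ⟨hx, by
              change b < s (spherePoint t₀ (r + 1) θ φ)
              simp only [s, spherePoint_normSq, b]; nlinarith⟩, hN.smul 0 _ hT _ hx, zero_smul]
          rfl
      rw [sphereFlux_congr this]
      simp [sphereFlux]
    have e₃ := sphereFlux_sub hU hR₀ hend (hN.smooth V hV) hr (by linarith : r ≤ r + 1)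
    rw [e₂, zero_sub] at e₃
    rw [e₁, ← neg_neg (sphereFlux t₀ r (N V)), e₃]
    congr 1
    refine integral_congr fun θ _ => integral_congr fun φ _ => integral_congr fun ρ hρ => ?_
    rw [uIcc_of_le (by linarith)] at hρ
    rw [hN.potential V hV _ (sphCoord_mem hR₀ hend (hr.trans_le hρ.1) θ φ)]
  rw [key hM, key hN]

end Uniqueness

/-! ### Asymptotics at spatial infinity -/

section Asymptotics

variable {U : Set Spacetime} {t₀ R₀ : ℝ} {g : MetricField} {Γ : ConnField}

/-- The decay rate `1/r²`. -/
noncomputable def decay (x : Spacetime) : ℝ := 1 / radius x ^ 2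

theorem eventually_spatialInfinity {p : Spacetime → Prop} :
    (∀ᶠ x in spatialInfinity t₀, p x) ↔ ∃ R, ∀ x : Spacetime, x 0 = t₀ → R < radius x → p x := by
  rw [spatialInfinity, eventually_inf_principal, eventually_comap]
  constructor
  · intro h
    obtain ⟨R, hR⟩ := (atTop_basis_Ioi.eventually_iff).1 h
    exact ⟨R, fun x hx hr => hR.2 hr x rfl hx⟩
  · rintro ⟨R, hR⟩
    exact (eventually_gt_atTop R).mono fun b hb x hx h0 => hR x h0 (hx ▸ hb)

theorem eventually_mem_of_end (hend : ∀ x : Spacetime, x 0 = t₀ → R₀ < radius x → x ∈ U) :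
    ∀ᶠ x in spatialInfinity t₀, x ∈ U :=
  eventually_spatialInfinity.2 ⟨R₀, hend⟩

theorem tendsto_radius : Tendsto radius (spatialInfinity t₀) atTop :=
  tendsto_comap.mono_left inf_le_left

theorem tendsto_metric (h : IsAsymptoticallyFlat t₀ g) (a b : Fin 4) :
    Tendsto (fun x => g x a b) (spatialInfinity t₀) (𝓝 (minkowski a b)) := by
  have h0 : Tendsto (fun x => g x a b - minkowski a b) (spatialInfinity t₀) (𝓝 0) :=
    (h a b).1.trans_tendsto (tendsto_radius.const_div_atTop 1)
  simpa using h0.add_const (minkowski a b)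

theorem pd_metric_isBigO (h : IsAsymptoticallyFlat t₀ g) (a b c : Fin 4) :
    (pd c fun x => g x a b) =O[spatialInfinity t₀] decay := (h a b).2 c

theorem tendsto_matrix_inv {ι : Type*} [Fintype ι] [DecidableEq ι] {X : Type*} {l : Filter X}
    {M : X → Matrix ι ι ℝ} {A : Matrix ι ι ℝ} (hA : A.det ≠ 0)
    (hM : ∀ i j, Tendsto (fun x => M x i j) l (𝓝 (A i j))) (i j : ι) :
    Tendsto (fun x => (M x)⁻¹ i j) l (𝓝 (A⁻¹ i j)) := by
  have hM' : Tendsto M l (𝓝 A) := tendsto_pi_nhds.2 fun i => tendsto_pi_nhds.2 fun j => hM i j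
  have hd : Tendsto (fun x => (M x).det) l (𝓝 A.det) :=
    ((Continuous.matrix_det continuous_id).tendsto A).comp hM'
  have ha : Tendsto (fun x => (M x).adjugate i j) l (𝓝 (A.adjugate i j)) :=
    (((Continuous.matrix_adjugate continuous_id).matrix_elem i j).tendsto A).comp hM'
  simp only [Matrix.inv_def, Ring.inverse_eq_inv', Matrix.smul_apply, smul_eq_mul]
  exact (hd.inv₀ hA).mul ha

theorem minkowski_det : minkowski.det = -1 := by
  simp [minkowski, Matrix.det_diagonal, Fin.prod_univ_four]

theorem minkowski_inv : minkowski⁻¹ = minkowski := by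
  apply Matrix.inv_eq_right_inv
  rw [minkowski, Matrix.diagonal_mul_diagonal, ← Matrix.diagonal_one]
  congr 1
  ext i
  fin_cases i <;> simp

theorem tendsto_inv (h : IsAsymptoticallyFlat t₀ g) (a b : Fin 4) :
    Tendsto (fun x => inv g x a b) (spatialInfinity t₀) (𝓝 (minkowski a b)) := by
  have := tendsto_matrix_inv (by rw [minkowski_det]; norm_num) (tendsto_metric h) a b
  rwa [minkowski_inv] at this

theorem tendsto_volDensity (h : IsAsymptoticallyFlat t₀ g) :
    Tendsto (volDensity g) (spatialInfinity t₀) (𝓝 1) := by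
  have hM' : Tendsto g (spatialInfinity t₀) (𝓝 minkowski) :=
    tendsto_pi_nhds.2 fun i => tendsto_pi_nhds.2 fun j => tendsto_metric h i j
  have hd : Tendsto (fun x => (g x).det) (spatialInfinity t₀) (𝓝 minkowski.det) :=
    ((Continuous.matrix_det continuous_id).tendsto _).comp hM'
  have := hd.neg.sqrt
  rw [minkowski_det, neg_neg, Real.sqrt_one] at this
  exact this

theorem isBigO_mul_of_tendsto {f h : Spacetime → ℝ} {c : ℝ} {ρ : Spacetime → ℝ}
    {l : Filter Spacetime} (hf : Tendsto f l (𝓝 c)) (hh : h =O[l] ρ) :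
    (fun x => f x * h x) =O[l] ρ := by
  simpa using (hf.isBigO_one ℝ).mul hh

/-- Both ∂g and Γg are O(1/r²). Since g and its inverse converge, raising indices and taking traces
preserve this rate in the estimates that follow. -/
theorem nonmet_isBigO (h : IsAsymptoticallyFlat t₀ g) (hΓ : ConnDecays t₀ Γ) (a b c : Fin 4) :
    (fun x => nonmet g Γ x a b c) =O[spatialInfinity t₀] decay := by
  refine (pd_metric_isBigO h b c a).sub (IsBigO.fun_sum fun d _ => ?_)
  refine IsBigO.add ?_ ?_
  · exact (isBigO_mul_of_tendsto (tendsto_metric h d c) (hΓ d a b)).congr_left fun x => mul_comm _ _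
  · exact (isBigO_mul_of_tendsto (tendsto_metric h b d) (hΓ d a c)).congr_left fun x => mul_comm _ _

theorem nonmetUp_isBigO (h : IsAsymptoticallyFlat t₀ g) (hΓ : ConnDecays t₀ Γ) (a b c : Fin 4) :
    (fun x => nonmetUp g Γ x a b c) =O[spatialInfinity t₀] decay :=
  IsBigO.fun_sum fun d _ => IsBigO.fun_sum fun e _ => IsBigO.fun_sum fun f _ =>
    isBigO_mul_of_tendsto (((tendsto_inv h a d).mul (tendsto_inv h b e)).mul (tendsto_inv h c f))
      (nonmet_isBigO h hΓ d e f)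

theorem trOne_isBigO (h : IsAsymptoticallyFlat t₀ g) (hΓ : ConnDecays t₀ Γ) (a : Fin 4) :
    (fun x => trOne g Γ x a) =O[spatialInfinity t₀] decay :=
  IsBigO.fun_sum fun b _ => IsBigO.fun_sum fun c _ =>
    isBigO_mul_of_tendsto (tendsto_inv h b c) (nonmet_isBigO h hΓ a b c)

theorem trTwo_isBigO (h : IsAsymptoticallyFlat t₀ g) (hΓ : ConnDecays t₀ Γ) (a : Fin 4) :
    (fun x => trTwo g Γ x a) =O[spatialInfinity t₀] decay :=
  IsBigO.fun_sum fun b _ => IsBigO.fun_sum fun c _ =>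
    isBigO_mul_of_tendsto (tendsto_inv h b c) (nonmet_isBigO h hΓ b c a)

theorem trOneUp_isBigO (h : IsAsymptoticallyFlat t₀ g) (hΓ : ConnDecays t₀ Γ) (a : Fin 4) :
    (fun x => trOneUp g Γ x a) =O[spatialInfinity t₀] decay :=
  IsBigO.fun_sum fun b _ => isBigO_mul_of_tendsto (tendsto_inv h a b) (trOne_isBigO h hΓ b)

theorem trTwoUp_isBigO (h : IsAsymptoticallyFlat t₀ g) (hΓ : ConnDecays t₀ Γ) (a : Fin 4) :
    (fun x => trTwoUp g Γ x a) =O[spatialInfinity t₀] decay :=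
  IsBigO.fun_sum fun b _ => isBigO_mul_of_tendsto (tendsto_inv h a b) (trTwo_isBigO h hΓ b)

theorem conjP_isBigO (h : IsAsymptoticallyFlat t₀ g) (hΓ : ConnDecays t₀ Γ) (a b c : Fin 4) :
    (fun x => conjP g Γ x a b c) =O[spatialInfinity t₀] decay := by
  have hi : ∀ (k : ℝ) (i j : Fin 4), Tendsto (fun x => k * inv g x i j) (spatialInfinity t₀)
      (𝓝 (k * minkowski i j)) := fun k i j => (tendsto_inv h i j).const_mul k
  unfold conjP
  exact ((((((nonmetUp_isBigO h hΓ a b c).const_mul_left _).add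
    ((nonmetUp_isBigO h hΓ b a c).const_mul_left _)).add
    ((nonmetUp_isBigO h hΓ c a b).const_mul_left _)).add
    (isBigO_mul_of_tendsto (hi _ b c) ((trOneUp_isBigO h hΓ a).sub (trTwoUp_isBigO h hΓ a)))).sub
    (isBigO_mul_of_tendsto (hi _ a b) (trOneUp_isBigO h hΓ c))).sub
    (isBigO_mul_of_tendsto (hi _ a c) (trOneUp_isBigO h hΓ b))

theorem quadQ_isBigO (h : IsAsymptoticallyFlat t₀ g) (hΓ : ConnDecays t₀ Γ) :
    (quadQ g Γ) =O[spatialInfinity t₀] fun x => decay x * decay x := by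
  have h1 := nonmet_isBigO h hΓ
  have h2 := nonmetUp_isBigO h hΓ
  have h3 := trOne_isBigO h hΓ
  unfold quadQ
  exact (((IsBigO.const_mul_left (IsBigO.fun_sum fun a _ => IsBigO.fun_sum fun b _ => IsBigO.fun_sum fun c _ =>
      (h1 a b c).mul (h2 a b c)) _).sub
    (IsBigO.const_mul_left (IsBigO.fun_sum fun a _ => IsBigO.fun_sum fun b _ => IsBigO.fun_sum fun c _ =>
      (h1 a b c).mul (h2 b a c)) _)).sub
    (IsBigO.const_mul_left (IsBigO.fun_sum fun a _ => (h3 a).mul (trOneUp_isBigO h hΓ a)) _)).add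
    (IsBigO.const_mul_left (IsBigO.fun_sum fun a _ => (h3 a).mul (trTwoUp_isBigO h hΓ a)) _)

theorem isLittleO_mul_of_tendsto {f h : Spacetime → ℝ} {c : ℝ} {ρ : Spacetime → ℝ}
    {l : Filter Spacetime} (hf : Tendsto f l (𝓝 c)) (hh : h =o[l] ρ) :
    (fun x => f x * h x) =o[l] ρ := by
  simpa using (hf.isBigO_one ℝ).mul_isLittleO hh

/-- Bounded times δΓ = o(1/r²), and P = O(1/r²) times δg = o(1): the two decay conditions on
variations are what each half of Θ requires. -/
theorem theta_isLittleO (h : IsAsymptoticallyFlat t₀ g) (hΓ : ConnDecays t₀ Γ)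
    {δg : MetricField} {δΓ : ConnField} (hδ : VariationVanishesAtInfinity t₀ δg δΓ) (a : Fin 4) :
    (fun x => theta g Γ δg δΓ x a) =o[spatialInfinity t₀] decay := by
  unfold theta
  refine IsLittleO.add (IsLittleO.const_mul_left (IsLittleO.fun_sum fun b _ => IsLittleO.fun_sum fun c _ =>
    IsLittleO.add (IsLittleO.neg_left ?_) ?_) _) (IsLittleO.fun_sum fun b _ => IsLittleO.fun_sum fun c _ => ?_)
  · exact isLittleO_mul_of_tendsto (tendsto_inv h a c) (hδ.2 b b c)
  · exact isLittleO_mul_of_tendsto (tendsto_inv h b c) (hδ.2 a b c)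
  · simpa using (conjP_isBigO h hΓ a b c).mul_isLittleO (hδ.1 b c)

end Asymptotics

/-! ### Flux integrals over large spheres and the boundary functional -/

section Flux

open intervalIntegral

variable {U : Set Spacetime} {t₀ R₀ : ℝ} {g : MetricField} {Γ : ConnField}

theorem radial_spherePoint (t₀ θ φ : ℝ) {r : ℝ} (hr : 0 < r) (i : Fin 3) :
    radial (spherePoint t₀ r θ φ) i = sphR θ φ i.succ := by
  rw [radial, radius_spherePoint t₀ θ φ hr.le]
  fin_cases i <;> simp [spherePoint, sphR] <;> field_simp

theorem abs_radial_le_one (x : Spacetime) (i : Fin 3) : |radial x i| ≤ 1 := by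
  rw [radial, abs_div, abs_of_nonneg (show 0 ≤ radius x from Real.sqrt_nonneg _)]
  refine div_le_one_of_le₀ (Real.abs_le_sqrt ?_) (Real.sqrt_nonneg _)
  fin_cases i <;> simp <;> nlinarith [sq_nonneg (x 1), sq_nonneg (x 2), sq_nonneg (x 3)]

/-- The spatial cross product of the two tangent vectors is r² sin θ times the unit normal. Both
have zero time component, so only time-space components of A ∧ B contribute. -/
theorem coordVol_sphere (A B : Spacetime) (r θ φ : ℝ) :
    coordVol ![A, B, sphTheta r θ φ, sphPhi r θ φ]
      = (∑ i : Fin 3, (A 0 * B i.succ - A i.succ * B 0) * sphR θ φ i.succ)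
        * (r ^ 2 * Real.sin θ) := by
  rw [coordVol_vec, Fin.sum_univ_three]
  simp only [sphTheta, sphPhi, sphR, Matrix.cons_val, Fin.succ_zero_eq_one, Fin.succ_one_eq_two,
    show (Fin.succ 2 : Fin 4) = 3 from rfl]
  linear_combination ((A 0 * B 3 - A 3 * B 0) * r ^ 2 * Real.cos θ * Real.sin θ)
    * Real.sin_sq_add_cos_sq φ

theorem coordVol_shell (A : Spacetime) (r θ φ : ℝ) :
    coordVol ![A, sphR θ φ, sphTheta r θ φ, sphPhi r θ φ] = A 0 * (r ^ 2 * Real.sin θ) := by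
  rw [coordVol_sphere, Fin.sum_univ_three]
  simp only [sphR, Matrix.cons_val, Fin.succ_zero_eq_one, Fin.succ_one_eq_two,
    show (Fin.succ 2 : Fin 4) = 3 from rfl]
  linear_combination (A 0 * (r ^ 2 * Real.sin θ)) * Real.sin_sq_add_cos_sq θ
    + (A 0 * (r ^ 2 * Real.sin θ) * Real.sin θ ^ 2) * Real.sin_sq_add_cos_sq φ

theorem sphereFlux_dualTwo (W : Spacetime → Fin 4 → Fin 4 → ℝ) {r : ℝ} (hr : 0 < r) :
    sphereFlux t₀ r (dualTwo g W) = sphereIntegral t₀ r fun x =>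
      (1 / 2) * volDensity g x * ∑ i : Fin 3, (W x 0 i.succ - W x i.succ 0) * radial x i := by
  rw [sphereFlux_eq, sphereIntegral]
  refine integral_congr fun θ _ => integral_congr fun φ _ => ?_
  simp only [dualTwo_eq, ContinuousAlternatingMap.sum_apply, ContinuousAlternatingMap.smul_apply,
    coordTwo_apply, smul_eq_mul, radial_spherePoint t₀ θ φ hr]
  simp only [Matrix.cons_val, coordVol_sphere, basisVec, Fin.sum_univ_four, Fin.sum_univ_three]
  simp
  ring

/-- The minus sign arises because t is inserted in the slot after A; the time component of A drops
out. -/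
theorem sphereFlux_dualVec (A : VField) {r : ℝ} (hr : 0 < r) :
    sphereFlux t₀ r (interiorProd timeTranslation (dualVec g A)) = sphereIntegral t₀ r fun x =>
      -volDensity g x * ∑ i : Fin 3, A x i.succ * radial x i := by
  rw [sphereFlux_eq, sphereIntegral]
  refine integral_congr fun θ _ => integral_congr fun φ _ => ?_
  have h : interiorProd timeTranslation (dualVec g A) (spherePoint t₀ r θ φ)
      ![sphTheta r θ φ, sphPhi r θ φ] = volDensity g (spherePoint t₀ r θ φ) *
        coordVol ![A (spherePoint t₀ r θ φ), basisVec 0, sphTheta r θ φ, sphPhi r θ φ] := rfl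
  simp only [h, coordVol_sphere, radial_spherePoint t₀ θ φ hr]
  simp [basisVec, Fin.sum_univ_three]
  ring

/-- The area factor r² compensates the decay 1/r², and |sin θ| ≤ 1 gives the crude constant 2π·π. No
regularity of `f` is required, which matters because the variations carry none. -/
theorem abs_sphereIntegral_le {f : Spacetime → ℝ} {r C : ℝ} (hr : 0 < r)
    (h : ∀ θ φ, |f (spherePoint t₀ r θ φ)| ≤ C * decay (spherePoint t₀ r θ φ)) :
    |sphereIntegral t₀ r f| ≤ C * (2 * Real.pi) * Real.pi := by
  have h0 : ∀ θ φ, ‖f (spherePoint t₀ r θ φ) * (r ^ 2 * Real.sin θ)‖ ≤ C := by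
    intro θ φ
    have h1 := h θ φ
    rw [decay, radius_spherePoint t₀ θ φ hr.le] at h1
    have hC : 0 ≤ C * (1 / r ^ 2) := (abs_nonneg _).trans h1
    rw [Real.norm_eq_abs, abs_mul, abs_mul, abs_of_pos (pow_pos hr 2)]
    calc _ ≤ C * (1 / r ^ 2) * (r ^ 2 * 1) := by
          gcongr
          exact Real.abs_sin_le_one θ
      _ = C := by field_simp
  have h1 : ∀ θ, ‖∫ φ in (0 : ℝ)..(2 * Real.pi), f (spherePoint t₀ r θ φ)
      * (r ^ 2 * Real.sin θ)‖ ≤ C * (2 * Real.pi) := by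
    intro θ
    have := norm_integral_le_of_norm_le_const (a := (0 : ℝ)) (b := 2 * Real.pi)
      fun φ _ => h0 θ φ
    rwa [sub_zero, abs_of_pos Real.two_pi_pos] at this
  have := norm_integral_le_of_norm_le_const (a := (0 : ℝ)) (b := Real.pi) fun θ _ => h1 θ
  rwa [sub_zero, abs_of_pos Real.pi_pos] at this

theorem tendsto_sphereIntegral_zero {f : Spacetime → ℝ} (hf : f =o[spatialInfinity t₀] decay) :
    Tendsto (fun r => sphereIntegral t₀ r f) atTop (𝓝 0) := by
  rw [Metric.tendsto_atTop]
  intro ε hε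
  have hp := Real.pi_pos
  -- The extra 2 makes the final bound ε/2, hence strict.
  have hC : 0 < ε / (2 * ((2 * Real.pi) * Real.pi)) := by positivity
  obtain ⟨R, hR⟩ := eventually_spatialInfinity.1 (hf.bound hC)
  refine ⟨max R 0 + 1, fun r hr => ?_⟩
  have hrR : R < r := by linarith [le_max_left R 0]
  have hr0 : 0 < r := by linarith [le_max_right R 0]
  have h := abs_sphereIntegral_le (t₀ := t₀) (f := f) hr0 (C := ε / (2 * ((2 * Real.pi) * Real.pi)))
    fun θ φ => by
      have := hR (spherePoint t₀ r θ φ) rfl (by rwa [radius_spherePoint t₀ θ φ hr0.le])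
      rwa [Real.norm_eq_abs, Real.norm_eq_abs,
        abs_of_nonneg (by unfold decay; positivity : 0 ≤ decay _)] at this
  rw [Real.dist_eq, sub_zero]
  refine h.trans_lt ?_
  rw [mul_assoc, div_mul_eq_mul_div, div_lt_iff₀ (by positivity)]
  nlinarith [mul_pos hε (by positivity : 0 < (2 * Real.pi) * Real.pi)]

theorem radial_mul_isLittleO {f : Spacetime → ℝ} {l : Filter Spacetime} (hf : f =o[l] decay)
    (i : Fin 3) : (fun x => f x * radial x i) =o[l] decay := by
  have h : (fun x => radial x i) =O[l] fun _ => (1 : ℝ) :=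
    IsBigO.of_bound 1 (Eventually.of_forall fun x => by simpa using abs_radial_le_one x i)
  simpa using hf.mul_isBigO h

theorem sphereFlux_zero (t₀ r : ℝ) : sphereFlux t₀ r (fun _ => 0) = 0 := by
  simp [sphereFlux]

/-- For variations that vanish at infinity, the integral of `i_t Θ` at infinity is zero. -/
theorem isBoundaryFunctional_zero (h : IsAsymptoticallyFlat t₀ g) (hΓ : ConnDecays t₀ Γ) :
    IsBoundaryFunctional t₀ g Γ (fun _ _ => 0) := by
  intro δg δΓ hδ
  refine ⟨fun _ => 0, 0, Eventually.of_forall fun s => ?_, hasDerivAt_const _ _, ?_⟩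
  · have : ∀ r, sphereFlux t₀ r (interiorProd timeTranslation
        ((fun _ _ => 0 : MetricField → ConnField → Form 3) (g + s • δg) (Γ + s • δΓ))) = 0 :=
      fun r => sphereFlux_zero t₀ r
    simp only [this]
    exact tendsto_const_nhds
  · refine (tendsto_sphereIntegral_zero (isLittleO_mul_of_tendsto (tendsto_volDensity h).neg
      (IsLittleO.fun_sum (s := Finset.univ) fun (i : Fin 3) _ =>
        radial_mul_isLittleO (theta_isLittleO h hΓ hδ i.succ) i))).congr' ?_
    exact (eventually_gt_atTop 0).mono fun r hr => (sphereFlux_dualVec _ hr).symm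

/-- With B = 0 the energy is a limit of charge fluxes, and these agree for all charges once r > R₀.
-/
theorem isCanonicalEnergy_zero_iff (hU : IsOpen U) (hR₀ : 0 < R₀)
    (hend : ∀ x : Spacetime, x 0 = t₀ → R₀ < radius x → x ∈ U)
    {M N : VField → Form 2} (hM : IsNoetherCharge U g Γ M) (hN : IsNoetherCharge U g Γ N)
    (hB : IsBoundaryFunctional t₀ g Γ (fun _ _ => 0)) (E : ℝ) :
    IsCanonicalEnergy U t₀ g Γ N (fun _ _ => 0) E ↔
      Tendsto (fun r => sphereFlux t₀ r (M timeTranslation)) atTop (𝓝 E) := by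
  have he : (fun r => sphereFlux t₀ r fun x => N timeTranslation x - interiorProd timeTranslation
      ((fun _ _ => 0 : MetricField → ConnField → Form 3) g Γ) x)
      =ᶠ[atTop] fun r => sphereFlux t₀ r (M timeTranslation) := by
    refine (eventually_gt_atTop R₀).mono fun r hr => ?_
    exact (sphereFlux_congr fun θ φ => sub_zero _).trans
      (hN.sphereFlux_eq hU hR₀ hend hM hr)
  exact ⟨fun h => h.limit.congr' he, fun h => ⟨hN, hB, h.congr' he.symm⟩⟩

end Flux

/-! ### Existence of the energy in the coincident gauge -/

section Existence

open intervalIntegral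

variable {U : Set Spacetime} {t₀ R₀ : ℝ} {g : MetricField} {Γ : ConnField}

theorem integral_div_sq_le {C r₁ r₂ : ℝ} (hC : 0 ≤ C) (h₁ : 0 < r₁) (h₁₂ : r₁ ≤ r₂) :
    ∫ r in r₁..r₂, C / r ^ 2 ≤ C / r₁ := by
  have hne : ∀ r ∈ uIcc r₁ r₂, r ≠ 0 := fun r hr => by
    rw [uIcc_of_le h₁₂] at hr
    exact (h₁.trans_le hr.1).ne'
  have hd : ∀ r ∈ uIcc r₁ r₂, HasDerivAt (fun r => -(C / r)) (C / r ^ 2) r := fun r hr => by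
    have := ((hasDerivAt_inv (hne r hr)).const_mul C).neg
    refine (this.congr_deriv (by ring)).congr_of_eventuallyEq (Eventually.of_forall fun y => ?_)
    simp [div_eq_mul_inv]
  have hi : ContinuousOn (fun r : ℝ => C / r ^ 2) (uIcc r₁ r₂) :=
    continuousOn_const.div (by fun_prop) fun r hr => pow_ne_zero 2 (hne r hr)
  rw [integral_eq_sub_of_hasDerivAt hd hi.intervalIntegrable]
  have : 0 ≤ C / r₂ := by have := h₁.trans_le h₁₂; positivity
  linarith

/-- The flux of a 2-form has a limit at infinity if the divergence is `O(1/r⁴)`. -/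
theorem exists_tendsto_sphereFlux (hU : IsOpen U) (hR₀ : 0 < R₀)
    (hend : ∀ x : Spacetime, x 0 = t₀ → R₀ < radius x → x ∈ U) {α : Form 2}
    (hα : ContDiffOn ℝ ∞ α U) {J : VField}
    (hd : ∀ x ∈ U, extDeriv α x = coordVol.curryLeft (J x))
    (hJ : (fun x => J x 0) =O[spatialInfinity t₀] fun x => decay x * decay x) :
    ∃ M, Tendsto (fun r => sphereFlux t₀ r α) atTop (𝓝 M) := by
  obtain ⟨C, hC, hb⟩ := hJ.exists_pos
  obtain ⟨R, hR⟩ := eventually_spatialInfinity.1 hb.bound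
  have hp := Real.pi_pos
  -- Cauchy estimate: on a shell inside the slice only J⁰ enters (`coordVol_shell`), and the decay
  -- r⁻⁴ times the volume factor r² integrates to at most C/r₁, uniformly in r₂.
  have key : ∀ r₁ r₂, max R R₀ < r₁ → r₁ ≤ r₂ →
      |sphereFlux t₀ r₂ α - sphereFlux t₀ r₁ α| ≤ C / r₁ * (2 * Real.pi) * Real.pi := by
    intro r₁ r₂ h₁ h₁₂
    have hr₁ : 0 < r₁ := hR₀.trans ((le_max_right _ _).trans_lt h₁)
    rw [sphereFlux_sub hU hR₀ hend hα ((le_max_right _ _).trans_lt h₁) h₁₂]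
    have h0 : ∀ θ φ, ‖∫ r in r₁..r₂, extDeriv α (spherePoint t₀ r θ φ)
        ![sphR θ φ, sphTheta r θ φ, sphPhi r θ φ]‖ ≤ C / r₁ := by
      intro θ φ
      refine (norm_integral_le_of_norm_le (g := fun r => C / r ^ 2) h₁₂
        (Eventually.of_forall fun r hr => ?_) ?_).trans (integral_div_sq_le hC.le hr₁ h₁₂)
      · have hr0 : 0 < r := hr₁.trans hr.1
        have hrr : radius (spherePoint t₀ r θ φ) = r := radius_spherePoint t₀ θ φ hr0.le
        have hmem := hend (spherePoint t₀ r θ φ) rfl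
          (by rw [hrr]; exact (le_max_right _ _).trans_lt (h₁.trans hr.1))
        have hJb := hR (spherePoint t₀ r θ φ) rfl
          (by rw [hrr]; exact (le_max_left _ _).trans_lt (h₁.trans hr.1))
        rw [hd _ hmem, curryLeft_coordVol_apply]
        change ‖coordVol ![_, sphR θ φ, sphTheta r θ φ, sphPhi r θ φ]‖ ≤ _
        rw [coordVol_shell, norm_mul]
        rw [decay, hrr] at hJb
        have hs : ‖r ^ 2 * Real.sin θ‖ ≤ r ^ 2 * 1 := by
          rw [norm_mul, Real.norm_of_nonneg (sq_nonneg r)]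
          gcongr
          exact Real.abs_sin_le_one θ
        rw [Real.norm_of_nonneg (by positivity : 0 ≤ 1 / r ^ 2 * (1 / r ^ 2))] at hJb
        calc _ ≤ C * (1 / r ^ 2 * (1 / r ^ 2)) * (r ^ 2 * 1) := by gcongr
          _ = C / r ^ 2 := by field_simp
      · refine ContinuousOn.intervalIntegrable ?_
        refine continuousOn_const.div (by fun_prop) fun r hr => pow_ne_zero 2 ?_
        rw [uIcc_of_le h₁₂] at hr
        exact (hr₁.trans_le hr.1).ne'
    have h1 : ∀ θ, ‖∫ φ in (0 : ℝ)..(2 * Real.pi), ∫ r in r₁..r₂,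
        extDeriv α (spherePoint t₀ r θ φ) ![sphR θ φ, sphTheta r θ φ, sphPhi r θ φ]‖
          ≤ C / r₁ * (2 * Real.pi) := by
      intro θ
      have := norm_integral_le_of_norm_le_const (a := (0 : ℝ)) (b := 2 * Real.pi)
        fun φ _ => h0 θ φ
      rwa [sub_zero, abs_of_pos Real.two_pi_pos] at this
    have := norm_integral_le_of_norm_le_const (a := (0 : ℝ)) (b := Real.pi) fun θ _ => h1 θ
    rwa [sub_zero, abs_of_pos Real.pi_pos] at this
  refine cauchySeq_tendsto_of_complete (Metric.cauchySeq_iff'.2 fun ε hε => ?_)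
  have ht : Tendsto (fun r : ℝ => C / r * (2 * Real.pi) * Real.pi) atTop (𝓝 0) := by
    simpa using ((tendsto_id.const_div_atTop C).mul_const (2 * Real.pi)).mul_const Real.pi
  obtain ⟨r₁, h₁, h₁'⟩ := ((eventually_gt_atTop (max R R₀)).and (ht.eventually_lt_const hε)).exists
  exact ⟨r₁, fun r₂ h => (key r₁ r₂ h₁ h).trans_lt h₁'⟩

theorem lieMetric_timeTranslation (x : Spacetime) (a b : Fin 4) :
    lieMetric timeTranslation g x a b = pd 0 (fun y => g y a b) x := by
  simp [lieMetric, timeTranslation, basisVec, pd_const, Pi.single_apply]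

theorem lieConn_timeTranslation (x : Spacetime) (a b c : Fin 4) :
    lieConn timeTranslation Γ x a b c = pd 0 (fun y => Γ y a b c) x := by
  have h : pd b (pd c fun y => timeTranslation y a) x = 0 := by
    have : (pd c fun y => timeTranslation y a) = fun _ => 0 := funext fun y => pd_const c _
    rw [this, pd_const]
  rw [lieConn, h]
  simp [timeTranslation, basisVec, pd_const, Pi.single_apply]

theorem lieConn_timeTranslation_of_gauge (hU : IsOpen U) (hΓ : IsCoincidentGaugeOn U Γ)
    {x : Spacetime} (hx : x ∈ U) (a b c : Fin 4) : lieConn timeTranslation Γ x a b c = 0 := by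
  rw [lieConn_timeTranslation, pd_congr hU hx (h := fun _ => 0) (fun y hy => hΓ y hy a b c),
    pd_const]

theorem IsCoincidentGaugeOn.connDecays (hΓ : IsCoincidentGaugeOn U Γ)
    (hend : ∀ x : Spacetime, x 0 = t₀ → R₀ < radius x → x ∈ U) : ConnDecays t₀ Γ :=
  fun a b c => (isBigO_zero _ _).congr'
    ((eventually_mem_of_end hend).mono fun x hx => (hΓ x hx a b c).symm) EventuallyEq.rfl

/-- With Γ = 0 on the open set `U`, also ℒ_tΓ = 0 there, so Θ is just P contracted with ∂_t g, a
product of two O(1/r²) factors. -/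
theorem theta_timeTranslation_isBigO (hU : IsOpen U)
    (hend : ∀ x : Spacetime, x 0 = t₀ → R₀ < radius x → x ∈ U)
    (h : IsAsymptoticallyFlat t₀ g) (hΓ : IsCoincidentGaugeOn U Γ) (a : Fin 4) :
    (fun x => theta g Γ (lieMetric timeTranslation g) (lieConn timeTranslation Γ) x a)
      =O[spatialInfinity t₀] fun x => decay x * decay x := by
  have h1 : (fun x => ∑ b, ∑ c, conjP g Γ x a b c * pd 0 (fun y => g y b c) x)
      =O[spatialInfinity t₀] fun x => decay x * decay x :=
    IsBigO.fun_sum fun b _ => IsBigO.fun_sum fun c _ =>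
      (conjP_isBigO h (hΓ.connDecays hend) a b c).mul (pd_metric_isBigO h b c 0)
  refine h1.congr' ((eventually_mem_of_end hend).mono fun x hx => ?_) EventuallyEq.rfl
  simp [theta, lieMetric_timeTranslation, lieConn_timeTranslation_of_gauge hU hΓ hx]

/-- In the coincident gauge the flux of the charge form for the time translation has a limit. -/
theorem exists_tendsto_sphereFlux_chargeForm (hU : IsOpen U) (hR₀ : 0 < R₀)
    (hend : ∀ x : Spacetime, x 0 = t₀ → R₀ < radius x → x ∈ U)
    (hg : IsLorentzMetricOn U g) (hΓ : IsSymmetricTeleparallelOn U Γ) (hvac : IsVacuumOn U g)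
    (h : IsAsymptoticallyFlat t₀ g) (hΓ0 : IsCoincidentGaugeOn U Γ) :
    ∃ M, Tendsto (fun r => sphereFlux t₀ r (chargeForm g Γ timeTranslation)) atTop (𝓝 M) := by
  have hV : ContDiffOn ℝ ∞ timeTranslation U := contDiff_timeTranslation.contDiffOn
  refine exists_tendsto_sphereFlux hU hR₀ hend (chargeForm_smoothOn hU hg hΓ hV)
    (fun x hx => (extDeriv_chargeForm hU hg hΓ hvac hV hx).trans (noetherCurrent_eq g Γ _ x))
    (isBigO_mul_of_tendsto (tendsto_volDensity h)
      ((theta_timeTranslation_isBigO hU hend h hΓ0 0).add ?_))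
  simpa [timeTranslation, basisVec] using
    (quadQ_isBigO h (hΓ0.connDecays hend)).const_mul_left (1 / 2)

end Existence

/-! ### Leading order at spatial infinity -/

section LeadingOrder

variable {U : Set Spacetime} {t₀ R₀ : ℝ} {g : MetricField} {Γ : ConnField}
  {l : Filter Spacetime} {u v u' v' : Spacetime → ℝ}

/-- `u` is `v` to leading order `1/r²`. -/
structure LeadingOrder (l : Filter Spacetime) (u v : Spacetime → ℝ) : Prop where
  sub_isLittleO : (fun x => u x - v x) =o[l] decay
  isBigO : v =O[l] decay

theorem LeadingOrder.refl (h : u =O[l] decay) : LeadingOrder l u u :=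
  ⟨by simp, h⟩

theorem LeadingOrder.congr (h : LeadingOrder l u v) (hu : u' =ᶠ[l] u) (hv : v' =ᶠ[l] v) :
    LeadingOrder l u' v' :=
  ⟨h.sub_isLittleO.congr' (hu.symm.sub hv.symm) EventuallyEq.rfl,
    h.isBigO.congr' hv.symm EventuallyEq.rfl⟩

theorem LeadingOrder.sub (h : LeadingOrder l u v) (h' : LeadingOrder l u' v') :
    LeadingOrder l (fun x => u x - u' x) (fun x => v x - v' x) :=
  ⟨(h.sub_isLittleO.sub h'.sub_isLittleO).congr_left fun x => by ring, h.isBigO.sub h'.isBigO⟩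

theorem LeadingOrder.sum {ι : Type*} {s : Finset ι} {u v : ι → Spacetime → ℝ}
    (h : ∀ i ∈ s, LeadingOrder l (u i) (v i)) :
    LeadingOrder l (fun x => ∑ i ∈ s, u i x) (fun x => ∑ i ∈ s, v i x) :=
  ⟨(IsLittleO.fun_sum fun i hi => (h i hi).sub_isLittleO).congr_left fun _ =>
    Finset.sum_sub_distrib _ _, IsBigO.fun_sum fun i hi => (h i hi).isBigO⟩

/-- f u − c v = f (u − v) + (f − c) v. The second summand is why the relation also records v =
O(1/r²). -/
theorem LeadingOrder.mul_of_tendsto {f : Spacetime → ℝ} {c : ℝ} (hf : Tendsto f l (𝓝 c))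
    (h : LeadingOrder l u v) : LeadingOrder l (fun x => f x * u x) (fun x => c * v x) := by
  refine ⟨?_, h.isBigO.const_mul_left c⟩
  have h1 := isLittleO_mul_of_tendsto hf h.sub_isLittleO
  have h2 : (fun x => (f x - c) * v x) =o[l] decay := by
    have h0 : (fun x => f x - c) =o[l] fun _ => (1 : ℝ) :=
      (isLittleO_one_iff ℝ).2 (by simpa using hf.sub_const c)
    simpa using h0.mul_isBigO h.isBigO
  exact (h1.add h2).congr_left fun x => by ring

theorem LeadingOrder.mul_radial (h : LeadingOrder l u v) (i : Fin 3) :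
    LeadingOrder l (fun x => u x * radial x i) (fun x => v x * radial x i) := by
  refine ⟨(radial_mul_isLittleO h.sub_isLittleO i).congr_left fun x => by ring, ?_⟩
  have hr : (fun x => radial x i) =O[l] fun _ => (1 : ℝ) :=
    IsBigO.of_bound 1 (Eventually.of_forall fun x => by simpa using abs_radial_le_one x i)
  simpa using h.isBigO.mul hr

theorem christoffel_leadingOrder (h : IsAsymptoticallyFlat t₀ g) (a b c : Fin 4) :
    LeadingOrder (spatialInfinity t₀) (fun x => christoffel g x a b c) fun x =>
      ∑ d, (1 / 2) * minkowski a d * (pd b (fun y => g y d c) x + pd c (fun y => g y d b) x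
        - pd d (fun y => g y b c) x) :=
  .sum fun d _ => .mul_of_tendsto ((tendsto_inv h a d).const_mul (1 / 2))
    (.refl (((pd_metric_isBigO h d c b).add (pd_metric_isBigO h d b c)).sub
      (pd_metric_isBigO h b c d)))

/-- For constant t, 𝒟^a t^b is g^{ac} Γ^b_{c0} with the Levi-Civita symbols; replacing inverse
metrics by η leaves the linearised expression. -/
theorem gradUp_leadingOrder (h : IsAsymptoticallyFlat t₀ g) (a b : Fin 4) :
    LeadingOrder (spatialInfinity t₀) (fun x => gradUp g timeTranslation x a b) fun x =>
      ∑ c, minkowski a c * ∑ d, (1 / 2) * minkowski b d *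
        (pd c (fun y => g y d 0) x + pd 0 (fun y => g y d c) x - pd d (fun y => g y c 0) x) := by
  have h1 : LeadingOrder (spatialInfinity t₀)
      (fun x => ∑ c, inv g x a c * christoffel g x b c 0) _ :=
    .sum fun c _ => .mul_of_tendsto (tendsto_inv h a c) (christoffel_leadingOrder h b c 0)
  refine h1.congr (Eventually.of_forall fun x => ?_) EventuallyEq.rfl
  simp [gradUp, timeTranslation, basisVec, pd_const, Pi.single_apply]

theorem nonmet_leadingOrder (hend : ∀ x : Spacetime, x 0 = t₀ → R₀ < radius x → x ∈ U)
    (h : IsAsymptoticallyFlat t₀ g) (hΓ : IsCoincidentGaugeOn U Γ) (a b c : Fin 4) :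
    LeadingOrder (spatialInfinity t₀) (fun x => nonmet g Γ x a b c)
      fun x => pd a (fun y => g y b c) x :=
  (LeadingOrder.refl (pd_metric_isBigO h b c a)).congr
    ((eventually_mem_of_end hend).mono fun x hx => by simp [nonmet, hΓ x hx]) EventuallyEq.rfl

theorem trOneUp_leadingOrder (hend : ∀ x : Spacetime, x 0 = t₀ → R₀ < radius x → x ∈ U)
    (h : IsAsymptoticallyFlat t₀ g) (hΓ : IsCoincidentGaugeOn U Γ) (a : Fin 4) :
    LeadingOrder (spatialInfinity t₀) (fun x => trOneUp g Γ x a) fun x =>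
      ∑ d, minkowski a d * ∑ b, ∑ c, minkowski b c * pd d (fun y => g y b c) x :=
  .sum fun d _ => .mul_of_tendsto (tendsto_inv h a d) <| .sum fun b _ => .sum fun c _ =>
    .mul_of_tendsto (tendsto_inv h b c) (nonmet_leadingOrder hend h hΓ d b c)

theorem trTwoUp_leadingOrder (hend : ∀ x : Spacetime, x 0 = t₀ → R₀ < radius x → x ∈ U)
    (h : IsAsymptoticallyFlat t₀ g) (hΓ : IsCoincidentGaugeOn U Γ) (a : Fin 4) :
    LeadingOrder (spatialInfinity t₀) (fun x => trTwoUp g Γ x a) fun x =>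
      ∑ d, minkowski a d * ∑ b, ∑ c, minkowski b c * pd b (fun y => g y c d) x :=
  .sum fun d _ => .mul_of_tendsto (tendsto_inv h a d) <| .sum fun b _ => .sum fun c _ =>
    .mul_of_tendsto (tendsto_inv h b c) (nonmet_leadingOrder hend h hΓ b c d)

/-- The integrand of the ADM mass. -/
noncomputable def admFlux (g : MetricField) (x : Spacetime) : ℝ :=
  ∑ i, ∑ j, (pd j.succ (fun y => spatialMetric g y i j) x
    - pd i.succ (fun y => spatialMetric g y j j) x) * radial x i

/-- The integrand of the flux of the charge form for the time translation. -/
noncomputable def chargeFlux (g : MetricField) (Γ : ConnField) (x : Spacetime) : ℝ :=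
  (1 / 2) * volDensity g x * ∑ i : Fin 3, (chargeTensor g Γ timeTranslation x 0 i.succ
    - chargeTensor g Γ timeTranslation x i.succ 0) * radial x i

theorem chargeTensor_timeTranslation_sub (x : Spacetime) (i : Fin 3) :
    chargeTensor g Γ timeTranslation x 0 i.succ - chargeTensor g Γ timeTranslation x i.succ 0
      = gradUp g timeTranslation x i.succ 0 - gradUp g timeTranslation x 0 i.succ
        - (trOneUp g Γ x i.succ - trTwoUp g Γ x i.succ) := by
  simp [chargeTensor, timeTranslation, basisVec, Pi.single_apply]
  ring

/-- The linearised Komar part is −∂_i g_{00} + ∂_0 g_{0i}. Subtracting Q^i − Q̃^i removes both terms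
and adds ∂_j h_{ij} − ∂_i h_{jj}, so no stationarity is needed. -/
theorem chargeFlux_leadingOrder (hU : IsOpen U) (hg : IsLorentzMetricOn U g)
    (hend : ∀ x : Spacetime, x 0 = t₀ → R₀ < radius x → x ∈ U)
    (h : IsAsymptoticallyFlat t₀ g) (hΓ : IsCoincidentGaugeOn U Γ) :
    LeadingOrder (spatialInfinity t₀) (chargeFlux g Γ) fun x => (1 / 2) * admFlux g x := by
  have hv : Tendsto (fun x => (1 / 2) * volDensity g x) (spatialInfinity t₀) (𝓝 ((1 / 2) * 1)) :=
    (tendsto_volDensity h).const_mul _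
  have h1 := LeadingOrder.mul_of_tendsto hv (LeadingOrder.sum (s := Finset.univ)
    fun (i : Fin 3) _ => (((gradUp_leadingOrder h i.succ 0).sub
      (gradUp_leadingOrder h 0 i.succ)).sub ((trOneUp_leadingOrder hend h hΓ i.succ).sub
        (trTwoUp_leadingOrder hend h hΓ i.succ))).mul_radial i)
  refine h1.congr (Eventually.of_forall fun x => ?_)
    ((eventually_mem_of_end hend).mono fun x hx => ?_)
  · simp only [chargeFlux, chargeTensor_timeTranslation_sub]
  · simp only [admFlux, mul_one]
    congr 1
    refine Finset.sum_congr rfl fun i _ => ?_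
    rw [← Finset.sum_mul]
    congr 1
    simp only [spatialMetric, Matrix.of_apply, minkowski, Matrix.diagonal_apply, ite_mul, mul_ite,
      zero_mul, mul_zero, Finset.sum_ite_eq, Finset.mem_univ, if_true]
    have hs := pd_metric_symm hU hg hx
    fin_cases i <;> simp [Fin.sum_univ_four, Fin.sum_univ_three]
    · rw [hs 0 1 0, hs 2 2 1, hs 3 3 1]; ring
    · rw [hs 0 2 0, hs 1 2 1, hs 3 3 2]; ring
    · rw [hs 0 3 0, hs 1 3 1, hs 2 3 2]; ring

theorem tendsto_spatialMetric (h : IsAsymptoticallyFlat t₀ g) (i j : Fin 3) :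
    Tendsto (fun x => spatialMetric g x i j) (spatialInfinity t₀)
      (𝓝 ((1 : Matrix (Fin 3) (Fin 3) ℝ) i j)) := by
  have h1 : minkowski i.succ j.succ = (1 : Matrix (Fin 3) (Fin 3) ℝ) i j := by
    fin_cases i <;> fin_cases j <;> simp [minkowski]
  exact h1 ▸ tendsto_metric h i.succ j.succ

theorem tendsto_spatialMetric_inv (h : IsAsymptoticallyFlat t₀ g) (i j : Fin 3) :
    Tendsto (fun x => (spatialMetric g x)⁻¹ i j) (spatialInfinity t₀)
      (𝓝 ((1 : Matrix (Fin 3) (Fin 3) ℝ) i j)) := by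
  simpa only [inv_one] using tendsto_matrix_inv (by simp) (tendsto_spatialMetric h) i j

/-- Needed for continuity of the inverse spatial metric: a Lorentzian g alone does not make its
spatial block invertible. -/
theorem eventually_spatialMetric_det_ne_zero (h : IsAsymptoticallyFlat t₀ g) :
    ∀ᶠ x in spatialInfinity t₀, (spatialMetric g x).det ≠ 0 := by
  have hM : Tendsto (spatialMetric g) (spatialInfinity t₀) (𝓝 1) :=
    tendsto_pi_nhds.2 fun i => tendsto_pi_nhds.2 fun j => tendsto_spatialMetric h i j
  have := ((Continuous.matrix_det continuous_id).tendsto _).comp hM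
  exact this.eventually_ne (by simp)

/-- Replacing h^{ij} by its limit δ^{ij} changes the integrand only by o(1/r²). -/
theorem admIntegrand_leadingOrder (h : IsAsymptoticallyFlat t₀ g) :
    LeadingOrder (spatialInfinity t₀) (admIntegrand g) (admFlux g) := by
  have h1 := LeadingOrder.sum (s := Finset.univ) fun (i : Fin 3) _ =>
    LeadingOrder.sum (s := Finset.univ) fun (j : Fin 3) _ =>
      LeadingOrder.mul_of_tendsto (tendsto_spatialMetric_inv h i j)
        (LeadingOrder.sum (s := Finset.univ) fun (k : Fin 3) _ => LeadingOrder.mul_radial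
          (.refl ((pd_metric_isBigO h k.succ j.succ i.succ).sub
            (pd_metric_isBigO h i.succ j.succ k.succ))) k)
  refine h1.congr (Eventually.of_forall fun x => ?_) (Eventually.of_forall fun x => ?_)
  · simp only [admIntegrand, spatialMetric, Matrix.of_apply, mul_comm (radial x _)]
  · simp only [admFlux, spatialMetric, Matrix.of_apply, Matrix.one_apply, ite_mul, one_mul,
      zero_mul, Finset.sum_ite_eq, Finset.mem_univ, if_true]
    exact Finset.sum_comm

end LeadingOrder

/-! ### Equality of the flux limits with the ADM mass -/

section Comparison

open intervalIntegral

variable {U : Set Spacetime} {t₀ R₀ : ℝ} {g : MetricField} {Γ : ConnField}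
  {f h : Spacetime → ℝ}

theorem sphereIntegral_sub {r : ℝ} (hf : ∀ θ φ, ContinuousAt f (spherePoint t₀ r θ φ))
    (hh : ∀ θ φ, ContinuousAt h (spherePoint t₀ r θ φ)) :
    sphereIntegral t₀ r (fun x => f x - h x) = sphereIntegral t₀ r f - sphereIntegral t₀ r h := by
  have hc : ∀ k : Spacetime → ℝ, (∀ θ φ, ContinuousAt k (spherePoint t₀ r θ φ)) →
      Continuous (Function.uncurry fun θ φ => k (spherePoint t₀ r θ φ) * (r ^ 2 * Real.sin θ)) := by
    intro k hk
    have hs : Continuous fun p : ℝ × ℝ => spherePoint t₀ r p.1 p.2 := by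
      refine continuous_pi fun i => ?_
      fin_cases i <;> simp [spherePoint] <;> fun_prop
    refine Continuous.mul (continuous_iff_continuousAt.2 fun p => ?_) (by fun_prop)
    exact ContinuousAt.comp (f := fun p : ℝ × ℝ => spherePoint t₀ r p.1 p.2) (hk p.1 p.2)
      hs.continuousAt
  have hθ : ∀ (F : ℝ → ℝ → ℝ), Continuous (Function.uncurry F) → ∀ θ, Continuous (F θ) :=
    fun F hF θ => hF.comp (by fun_prop : Continuous fun φ : ℝ => (θ, φ))
  unfold sphereIntegral
  rw [← integral_sub
    ((continuous_parametric_intervalIntegral_of_continuous' (hc f hf) _ _).intervalIntegrable _ _)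
    ((continuous_parametric_intervalIntegral_of_continuous' (hc h hh) _ _).intervalIntegrable _ _)]
  refine integral_congr fun θ _ => ?_
  simp only
  rw [← integral_sub ((hθ _ (hc f hf) θ).intervalIntegrable _ _)
    ((hθ _ (hc h hh) θ).intervalIntegrable _ _)]
  simp only [sub_mul]

/-- The integral of the difference tends to zero. Continuity serves only to split that integral into
two. -/
theorem LeadingOrder.tendsto_sphereIntegral_iff (hfh : LeadingOrder (spatialInfinity t₀) f h)
    (hf : ∀ᶠ x in spatialInfinity t₀, ContinuousAt f x)
    (hh : ∀ᶠ x in spatialInfinity t₀, ContinuousAt h x) {M : ℝ} :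
    Tendsto (fun r => sphereIntegral t₀ r f) atTop (𝓝 M) ↔
      Tendsto (fun r => sphereIntegral t₀ r h) atTop (𝓝 M) := by
  obtain ⟨R, hR⟩ := eventually_spatialInfinity.1 (hf.and hh)
  have he : (fun r => sphereIntegral t₀ r f - sphereIntegral t₀ r h)
      =ᶠ[atTop] fun r => sphereIntegral t₀ r fun x => f x - h x := by
    filter_upwards [eventually_gt_atTop R, eventually_ge_atTop 0] with r hr hr0
    have hp : ∀ θ φ, R < radius (spherePoint t₀ r θ φ) := fun θ φ => by
      rwa [radius_spherePoint t₀ θ φ hr0]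
    exact (sphereIntegral_sub (fun θ φ => (hR _ rfl (hp θ φ)).1)
      fun θ φ => (hR _ rfl (hp θ φ)).2).symm
  have h0 : Tendsto (fun r => sphereIntegral t₀ r f - sphereIntegral t₀ r h) atTop (𝓝 0) :=
    (tendsto_sphereIntegral_zero hfh.sub_isLittleO).congr' he.symm
  constructor
  · intro hM
    simpa using hM.sub h0
  · intro hM
    simpa using hM.add h0

theorem continuousAt_radial {x : Spacetime} (hx : radius x ≠ 0) (i : Fin 3) :
    ContinuousAt (fun y => radial y i) x := by
  have : Continuous radius := by unfold radius; fun_prop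
  exact (continuous_apply _).continuousAt.div this.continuousAt hx

theorem eventually_radius_ne_zero : ∀ᶠ x in spatialInfinity t₀, radius x ≠ 0 :=
  (tendsto_radius.eventually_gt_atTop 0).mono fun _ hx => hx.ne'

theorem continuousAt_pd_spatialMetric (hU : IsOpen U) (hg : IsLorentzMetricOn U g)
    {x : Spacetime} (hx : x ∈ U) (c : Fin 4) (i j : Fin 3) :
    ContinuousAt (pd c fun y => spatialMetric g y i j) x :=
  (differentiableAt_of_smoothOn hU (pd_smoothOn hU (hg.smooth i.succ j.succ) c) hx).continuousAt

theorem continuousAt_admFlux (hU : IsOpen U) (hg : IsLorentzMetricOn U g)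
    {x : Spacetime} (hx : x ∈ U) (hr : radius x ≠ 0) : ContinuousAt (admFlux g) x :=
  tendsto_finsetSum _ fun i _ => tendsto_finsetSum _ fun j _ =>
    ((continuousAt_pd_spatialMetric hU hg hx j.succ i j).sub
      (continuousAt_pd_spatialMetric hU hg hx i.succ j j)).mul (continuousAt_radial hr i)

theorem continuousAt_admIntegrand (hU : IsOpen U) (hg : IsLorentzMetricOn U g)
    {x : Spacetime} (hx : x ∈ U) (hr : radius x ≠ 0) (hd : (spatialMetric g x).det ≠ 0) :
    ContinuousAt (admIntegrand g) x := by
  have hi : ∀ i j, ContinuousAt (fun y => (spatialMetric g y)⁻¹ i j) x :=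
    tendsto_matrix_inv hd fun i j =>
      (differentiableAt_of_smoothOn hU (hg.smooth i.succ j.succ) hx).continuousAt
  exact tendsto_finsetSum _ fun i _ => tendsto_finsetSum _ fun j _ => (hi i j).mul <|
    tendsto_finsetSum _ fun k _ => (continuousAt_radial hr k).mul
      ((continuousAt_pd_spatialMetric hU hg hx i.succ k j).sub
        (continuousAt_pd_spatialMetric hU hg hx k.succ i j))

theorem continuousAt_chargeFlux (hU : IsOpen U) (hg : IsLorentzMetricOn U g)
    (hΓ : IsSymmetricTeleparallelOn U Γ) {x : Spacetime} (hx : x ∈ U) (hr : radius x ≠ 0) :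
    ContinuousAt (chargeFlux g Γ) x := by
  have hW : ∀ a b, ContinuousAt (fun y => chargeTensor g Γ timeTranslation y a b) x := fun a b =>
    (differentiableAt_of_smoothOn hU (chargeTensor_smoothOn hU hg hΓ
      contDiff_timeTranslation.contDiffOn a b) hx).continuousAt
  have hv : ContinuousAt (volDensity g) x :=
    (differentiableAt_of_smoothOn hU (volDensity_smoothOn hg) hx).continuousAt
  exact (hv.const_mul _).mul <| tendsto_finsetSum _ fun i _ =>
    ((hW 0 i.succ).sub (hW i.succ 0)).mul (continuousAt_radial hr i)

/-- In the coincident gauge the flux of the charge form at infinity exists and is the ADM mass. -/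
theorem exists_admMass (hU : IsOpen U) (hR₀ : 0 < R₀)
    (hend : ∀ x : Spacetime, x 0 = t₀ → R₀ < radius x → x ∈ U)
    (hg : IsLorentzMetricOn U g) (hΓ : IsSymmetricTeleparallelOn U Γ) (hvac : IsVacuumOn U g)
    (hflat : IsAsymptoticallyFlat t₀ g) (hΓ0 : IsCoincidentGaugeOn U Γ) :
    ∃ M : ℝ, Tendsto (fun r => sphereFlux t₀ r (chargeForm g Γ timeTranslation)) atTop (𝓝 M) ∧
      Tendsto (fun r => (1 / 2) * sphereIntegral t₀ r (admIntegrand g)) atTop (𝓝 M) ∧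
      IsADMMass t₀ g M := by
  obtain ⟨M, hM⟩ := exists_tendsto_sphereFlux_chargeForm hU hR₀ hend hg hΓ hvac hflat hΓ0
  have hmem := (eventually_mem_of_end hend).and (eventually_radius_ne_zero (t₀ := t₀))
  have hc := hmem.mono fun x hx => continuousAt_admFlux hU hg hx.1 hx.2
  have h1 : Tendsto (fun r => sphereIntegral t₀ r (chargeFlux g Γ)) atTop (𝓝 M) :=
    -- By `sphereFlux_dualTwo` the flux of the 2-form is a surface integral of its time-radial
    -- component.
    hM.congr' ((eventually_gt_atTop 0).mono fun r hr => sphereFlux_dualTwo _ hr)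
  have h2 := ((chargeFlux_leadingOrder hU hg hend hflat hΓ0).tendsto_sphereIntegral_iff
    (hmem.mono fun x hx => continuousAt_chargeFlux hU hg hΓ hx.1 hx.2)
    (hc.mono fun x hx => hx.const_mul _)).1 h1
  have hmul : ∀ r, sphereIntegral t₀ r (fun x => (1 / 2) * admFlux g x)
      = (1 / 2) * sphereIntegral t₀ r (admFlux g) := fun r => by
    simp only [sphereIntegral, mul_assoc, integral_const_mul]
  simp only [hmul] at h2
  refine ⟨M, hM, ?_, h2⟩
  have h3 : Tendsto (fun r => sphereIntegral t₀ r (admFlux g)) atTop (𝓝 (2 * M)) :=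
    (h2.const_mul 2).congr fun r => by ring
  have h4 := ((admIntegrand_leadingOrder hflat).tendsto_sphereIntegral_iff
    ((hmem.and (eventually_spatialMetric_det_ne_zero hflat)).mono fun x hx =>
      continuousAt_admIntegrand hU hg hx.1.1 hx.1.2 hx.2) hc).2 h3
  have h5 := h4.const_mul (1 / 2)
  rwa [show (1 / 2 : ℝ) * (2 * M) = M by ring] at h5

end Comparison

end STEGR

theorem mainTheorem7
    (U : Set STEGR.Spacetime) (hU : IsOpen U) (t₀ R₀ : ℝ) (hR₀ : 0 < R₀)
    (hend : ∀ x : STEGR.Spacetime, x 0 = t₀ → R₀ < STEGR.radius x → x ∈ U)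
    (g : STEGR.MetricField) (Γ : STEGR.ConnField)
    (hg : STEGR.IsLorentzMetricOn U g)
    (hΓ : STEGR.IsSymmetricTeleparallelOn U Γ)
    (hvac : STEGR.IsVacuumOn U g) :
    -- the charge form is a Noether charge, and all Noether charges have the same flux
    (STEGR.IsNoetherCharge U g Γ (STEGR.chargeForm g Γ) ∧
      ∀ N, STEGR.IsNoetherCharge U g Γ N → ∀ r, R₀ < r →
        STEGR.sphereFlux t₀ r (N STEGR.timeTranslation)
          = STEGR.sphereFlux t₀ r (STEGR.chargeForm g Γ STEGR.timeTranslation)) ∧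
    -- the energy, with `B = 0`, is the integral of the charge form at infinity
    (STEGR.IsAsymptoticallyFlat t₀ g → STEGR.ConnDecays t₀ Γ →
      STEGR.IsBoundaryFunctional t₀ g Γ (fun _ _ => 0) ∧
      ∀ N, STEGR.IsNoetherCharge U g Γ N → ∀ E,
        (STEGR.IsCanonicalEnergy U t₀ g Γ N (fun _ _ => 0) E ↔
          Tendsto (fun r =>
            STEGR.sphereFlux t₀ r (STEGR.chargeForm g Γ STEGR.timeTranslation))
            atTop (𝓝 E))) ∧
    -- in the coincident gauge the energy exists and equals the ADM mass
    (STEGR.IsAsymptoticallyFlat t₀ g → STEGR.IsCoincidentGaugeOn U Γ →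
      ∃ M : ℝ,
        (∀ N, STEGR.IsNoetherCharge U g Γ N →
          STEGR.IsCanonicalEnergy U t₀ g Γ N (fun _ _ => 0) M) ∧
        Tendsto (fun r =>
          STEGR.sphereFlux t₀ r (STEGR.chargeForm g Γ STEGR.timeTranslation)) atTop (𝓝 M) ∧
        Tendsto (fun r => (1 / 2) * STEGR.sphereIntegral t₀ r (STEGR.admIntegrand g))
          atTop (𝓝 M) ∧
        STEGR.IsADMMass t₀ g M) := by
  have hq := STEGR.chargeForm_isNoetherCharge hU hg hΓ hvac
  refine ⟨⟨hq, fun N hN r hr => hN.sphereFlux_eq hU hR₀ hend hq hr⟩, fun hflat hdec => ?_,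
    fun hflat hΓ0 => ?_⟩
  · have hB := STEGR.isBoundaryFunctional_zero hflat hdec
    exact ⟨hB, fun N hN E => STEGR.isCanonicalEnergy_zero_iff hU hR₀ hend hq hN hB E⟩
  · obtain ⟨M, hM, hI, hA⟩ := STEGR.exists_admMass hU hR₀ hend hg hΓ hvac hflat hΓ0
    have hB := STEGR.isBoundaryFunctional_zero hflat (hΓ0.connDecays hend)
    exact ⟨M, fun N hN => (STEGR.isCanonicalEnergy_zero_iff hU hR₀ hend hq hN hB M).2 hM,
      hM, hI, hA⟩
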